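/- Let $p$ be an odd prime. For a prime $q$ let $\mathcal H_n(\mathbb Z_q)$ be the set of symmetric $n\times n$ matrices over $\mathbb Q_q$ with diagonal entries in $\mathbb Z_q$ and off-diagonal entries in $\tfrac12\mathbb Z_q$, and let $\mathcal H_n(\mathbb Z_q)^{\mathrm{nd}}$ be its subset of matrices with non-zero determinant. Write $S[X]={}^tXSX$ and $A\perp B=\begin{pmatrix}A&0\\0&B\end{pmatrix}$. For $S\in\mathcal H_m(\mathbb Z_q)^{\mathrm{nd}}$ and $T\in\mathcal H_n(\mathbb Z_q)^{\mathrm{nd}}$ with $m\ge n$, the local density is $$\alpha_q(S,T)=2^{-\delta_{m,n}}\lim_{e\to\infty}q^{e(-mn+n(n+1)/2)}\,\#\{X\in M_{mn}(\mathbb Z_q)/q^eM_{mn}(\mathbb Z_q)\mid S[X]\equiv T \bmod q^e\mathcal H_n(\mathbb Z_q)\},$$ where $\delta_{m,n}$ is the Kronecker delta. For $0\ne a\in\mathbb Z_q$ put $\chi_q(a)=1$, $-1$ or $0$ according as $\mathbb Q_q(\sqrt a)$ equals $\mathbb Q_q$, is an unramified quadratic extension of $\mathbb Q_q$, or is a ramified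 quadratic extension of $\mathbb Q_q$. Let $\langle\ ,\ \rangle$ be the Hilbert symbol on $\mathbb Q_q$. For a non-degenerate symmetric matrix $T$ of degree $n$ over $\mathbb Q_q$ that is $GL_n(\mathbb Q_q)$-equivalent to $b_1\perp\cdots\perp b_n$, put $\varepsilon_q(T)=\prod_{i<j}\langle b_i,b_j\rangle$ (this does not depend on the choice of the $b_i$), and let $\eta_q(T)$ be the Clifford invariant, $$\eta_q(T)=\begin{cases}\langle-1,-1\rangle^{m(m+1)/2}\langle(-1)^m,\det T\rangle\,\varepsilon_q(T)&\text{if } n=2m+1,\\ \langle-1,-1\rangle^{m(m-1)/2}\langle(-1)^{m+1},\det T\rangle\,\varepsilon_q(T)&\text{if } n=2m.\end{cases}$$ Let $\epsilon\in\mathbb Z_p^\times$ with $\chi_p(-\epsilon)=-1$, and let $U_0=1\perp\epsilon$. Then the limits defining the local densities below exist, and: (1) For every $T\in\mathcal H_3(\mathbb Z_p)^{\mathrm{nd}}$, $$\alpha_p(U_0\perp pU_0,T)=(1+p)(1+p^{-1})(1-\eta_p(T)).$$ (2) Let $T\in\mathcal H_4(\mathbb Z_p)^{\mathrm{nd}}$.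 If $\alpha_p(U_0\perp pU_0,T)\neq0$, then $\det(2T)=p^{2m}\xi^2$ with $m\in\mathbb Z_{>0}$ and $\xi\in\mathbb Z_p^\times$, and $\eta_p(T)=-1$. Conversely, if $T$ satisfies these conditions, then $$\alpha_p(U_0\perp pU_0,T)=2(1+p)^2p^m.$$ -/

import Mathlib

open Filter Topology Matrix

noncomputable section

namespace LocalDensity

/-- `A[X] = ᵗX A X`. -/
def bracket {R ι κ : Type*} [CommRing R] [Fintype ι] (A : Matrix ι ι R) (X : Matrix ι κ R) :
    Matrix κ κ R :=
  Xᵀ * A * X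

/-- The orthogonal sum `X ⊥ Y` of two square matrices. -/
def orthSum {R ι κ : Type*} [CommRing R] (X : Matrix ι ι R) (Y : Matrix κ κ R) :
    Matrix (ι ⊕ κ) (ι ⊕ κ) R :=
  fromBlocks X 0 0 Y

/-- Half-integral matrices over `ℤ_q`: symmetric matrices over `ℚ_q` whose diagonal entries lie in
`ℤ_q` and whose other entries lie in `(1/2) ℤ_q`. -/
def IsHalfIntegral {q : ℕ} [Fact q.Prime] {κ : Type*} (A : Matrix κ κ ℚ_[q]) : Prop :=
  A.IsSymm ∧ (∀ i, ∃ r : ℤ_[q], A i i = r) ∧ ∀ i j, i ≠ j → ∃ r : ℤ_[q], A i j = (r : ℚ_[q]) / 2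

/-- `A ≡ B` modulo `q^e` times the lattice of half-integral matrices. -/
def CongrHalfIntegral {q : ℕ} [Fact q.Prime] {κ : Type*} (e : ℕ) (A B : Matrix κ κ ℚ_[q]) : Prop :=
  ∃ H : Matrix κ κ ℚ_[q], IsHalfIntegral H ∧ A - B = ((q : ℚ_[q]) ^ e) • H

/-- The submodule `q^e M_{mn}(ℤ_q)` of `M_{mn}(ℤ_q)`. -/
def levelSubmodule (q : ℕ) [Fact q.Prime] (ι κ : Type*) (e : ℕ) :
    Submodule ℤ_[q] (Matrix ι κ ℤ_[q]) :=
  LinearMap.range (((q : ℤ_[q]) ^ e) • (LinearMap.id : Matrix ι κ ℤ_[q] →ₗ[ℤ_[q]] Matrix ι κ ℤ_[q]))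

/-- The set of classes `X ∈ M_{mn}(ℤ_q) / q^e M_{mn}(ℤ_q)` such that `S[X] ≡ T` modulo `q^e` times
the half-integral matrices. For half-integral `S` the condition does not depend on the
representative of the class. -/
def solutionSet {q : ℕ} [Fact q.Prime] {ι κ : Type*} [Fintype ι]
    (S : Matrix ι ι ℚ_[q]) (T : Matrix κ κ ℚ_[q]) (e : ℕ) :
    Set (Matrix ι κ ℤ_[q] ⧸ levelSubmodule q ι κ e) :=
  {x | ∃ X : Matrix ι κ ℤ_[q], (levelSubmodule q ι κ e).mkQ X = x ∧
    CongrHalfIntegral e (bracket S (X.map (fun a => (a : ℚ_[q])))) T}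

/-- `2^{-δ_{m,n}} q^{e(-mn + n(n+1)/2)} #A_e(S,T)`, where `S` has degree `m` and `T` degree `n`. -/
def densitySeq {q : ℕ} [Fact q.Prime] {ι κ : Type*} [Fintype ι] [Fintype κ]
    (S : Matrix ι ι ℚ_[q]) (T : Matrix κ κ ℚ_[q]) (e : ℕ) : ℝ :=
  (if Fintype.card ι = Fintype.card κ then (2 : ℝ)⁻¹ else 1) *
    ((q : ℝ) ^ ((e : ℤ) * (-((Fintype.card ι : ℤ) * (Fintype.card κ : ℤ)) +
        (Fintype.card κ : ℤ) * ((Fintype.card κ : ℤ) + 1) / 2)) *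
      ((solutionSet S T e).ncard : ℝ))

/-- `a` is the limit that defines the local density of `S` and `T`. -/
def HasLocalDensity {q : ℕ} [Fact q.Prime] {ι κ : Type*} [Fintype ι] [Fintype κ]
    (S : Matrix ι ι ℚ_[q]) (T : Matrix κ κ ℚ_[q]) (a : ℝ) : Prop :=
  Tendsto (densitySeq S T) atTop (𝓝 a)

/-- The local density `α_q(S,T)`; meaningful when the limit exists, i.e. when
`HasLocalDensity S T (localDensity S T)`. -/
def localDensity {q : ℕ} [Fact q.Prime] {ι κ : Type*} [Fintype ι] [Fintype κ]
    (S : Matrix ι ι ℚ_[q]) (T : Matrix κ κ ℚ_[q]) : ℝ :=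
  limUnder atTop (densitySeq S T)

open Classical in
/-- The Hilbert symbol on `ℚ_q` (for non-zero arguments). -/
def hilbertSymbol {q : ℕ} [Fact q.Prime] (a b : ℚ_[q]) : ℤ :=
  if ∃ x y z : ℚ_[q], (x, y, z) ≠ (0, 0, 0) ∧ a * x ^ 2 + b * y ^ 2 = z ^ 2 then 1 else -1

/-- `T` is `GL_n(ℚ_q)`-equivalent to `b_1 ⊥ ⋯ ⊥ b_n` with all `b_i` non-zero. -/
def IsDiagonalization {q : ℕ} [Fact q.Prime] {n : ℕ} (T : Matrix (Fin n) (Fin n) ℚ_[q])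
    (b : Fin n → ℚ_[q]) : Prop :=
  (∀ i, b i ≠ 0) ∧ ∃ g : GL (Fin n) ℚ_[q], bracket T (g : Matrix (Fin n) (Fin n) ℚ_[q]) = diagonal b

/-- Every non-degenerate symmetric matrix over `ℚ_q` is equivalent to a diagonal one. -/
theorem exists_isDiagonalization {q : ℕ} [Fact q.Prime] {n : ℕ}
    (T : Matrix (Fin n) (Fin n) ℚ_[q]) (hT : T.IsSymm) (hd : T.det ≠ 0) :
    ∃ b : Fin n → ℚ_[q], IsDiagonalization T b := by
  have : Invertible (2 : ℚ_[q]) := invertibleOfNonzero two_ne_zero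
  obtain ⟨v, hv⟩ := LinearMap.BilinForm.exists_orthogonal_basis
    (B := Matrix.toBilin' T) (by
      constructor
      intro x y
      have := congrArg (fun M => x ⬝ᵥ M *ᵥ y) hT.eq
      simp only [RingHom.id_apply, Matrix.toBilin'_apply'] at this ⊢
      rw [← this, mulVec_transpose, dotProduct_comm, ← dotProduct_mulVec])
  have hn : Module.finrank ℚ_[q] (Fin n → ℚ_[q]) = n := by simp
  let w := v.reindex (finCongr hn)
  let G : Matrix (Fin n) (Fin n) ℚ_[q] := (Pi.basisFun ℚ_[q] (Fin n)).toMatrix w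
  have hG : IsUnit G := by
    have := (Pi.basisFun ℚ_[q] (Fin n)).invertibleToMatrix w
    exact isUnit_of_invertible G
  have hentry : ∀ i j, bracket T G i j = Matrix.toBilin' T (w i) (w j) := by
    intro i j
    rw [Matrix.toBilin'_apply', bracket, Matrix.mul_assoc, Matrix.mul_apply']
    rfl
  have hdiag : bracket T G = diagonal fun i => bracket T G i i := by
    ext i j
    by_cases h : i = j
    · subst h; simp
    · rw [diagonal_apply_ne _ h, hentry]
      have := hv (i := (finCongr hn).symm i) (j := (finCongr hn).symm j) (by simpa using h)
      simpa [w] using this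
  refine ⟨fun i => bracket T G i i, ?_, hG.unit, by simpa using hdiag⟩
  have hdet : (bracket T G).det ≠ 0 := by
    have h2 : G.det ≠ 0 := ((Matrix.isUnit_iff_isUnit_det G).1 hG).ne_zero
    simp [bracket, hd, h2]
  rw [hdiag, det_diagonal] at hdet
  intro i
  exact Finset.prod_ne_zero_iff.1 hdet i (Finset.mem_univ i)

open Classical in
/-- `ε_q(T) = ∏_{i<j} ⟨b_i, b_j⟩` for a diagonalization `b_1 ⊥ ⋯ ⊥ b_n` of the non-degenerate
symmetric matrix `T`; the value does not depend on the diagonalization. -/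
def epsInvariant {q : ℕ} [Fact q.Prime] {n : ℕ} (T : Matrix (Fin n) (Fin n) ℚ_[q]) : ℤ :=
  if h : ∃ b : Fin n → ℚ_[q], IsDiagonalization T b then
    ∏ i : Fin n, ∏ j ∈ Finset.Ioi i, hilbertSymbol (h.choose i) (h.choose j)
  else 1

/-- The Clifford invariant `η_q(T)` of a non-degenerate symmetric matrix `T` of degree `n`,
where `m = n / 2` is the integer part, so that `n = 2m` or `n = 2m+1`. -/
def cliffordInvariant {q : ℕ} [Fact q.Prime] {n : ℕ} (T : Matrix (Fin n) (Fin n) ℚ_[q]) : ℤ :=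
  if Odd n then
    hilbertSymbol (-1 : ℚ_[q]) (-1) ^ ((n / 2) * (n / 2 + 1) / 2) *
      hilbertSymbol ((-1 : ℚ_[q]) ^ (n / 2)) T.det * epsInvariant T
  else
    hilbertSymbol (-1 : ℚ_[q]) (-1) ^ ((n / 2) * (n / 2 - 1) / 2) *
      hilbertSymbol ((-1 : ℚ_[q]) ^ (n / 2 + 1)) T.det * epsInvariant T

/-- The algebra `ℚ_q[X]/(X² - a)`, which is the field `ℚ_q(√a)` if `a` is not a square. -/
abbrev SqrtExt (q : ℕ) [Fact q.Prime] (a : ℤ_[q]) : Type :=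
  AdjoinRoot (Polynomial.X ^ 2 - Polynomial.C (a : ℚ_[q]))

open Classical in
/-- `χ_q(a)` for `a ∈ ℤ_q`, `a ≠ 0`: it is `1` if `ℚ_q(√a) = ℚ_q`, `-1` if `ℚ_q(√a)` is an
unramified quadratic extension (its ring of integers is unramified over `ℤ_q`), and `0` if it is a
ramified quadratic extension. -/
def quadChar {q : ℕ} [Fact q.Prime] (a : ℤ_[q]) : ℤ :=
  if IsSquare (a : ℚ_[q]) then 1
  else if Algebra.FormallyUnramified ℤ_[q] (integralClosure ℤ_[q] (SqrtExt q a)) then -1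
  else 0

/-- `U_0 = 1 ⊥ ε`. -/
def U0 {q : ℕ} [Fact q.Prime] (ε : ℤ_[q]) : Matrix (Fin 2) (Fin 2) ℚ_[q] :=
  diagonal ![1, (ε : ℚ_[q])]

/-- `U_0 ⊥ q U_0`. -/
def U0perp {q : ℕ} [Fact q.Prime] (ε : ℤ_[q]) : Matrix (Fin 2 ⊕ Fin 2) (Fin 2 ⊕ Fin 2) ℚ_[q] :=
  orthSum (U0 ε) ((q : ℚ_[q]) • U0 ε)

end LocalDensity

end

/-! Let S = 1 ⊥ ε ⊥ p ⊥ pε. Since -ε is a non-square modulo p, the plane 1 ⊥ ε is anisotropic over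
𝔽_p, and therefore p² ∣ S[x] forces p ∣ x. This single property drives the proof; in particular S is
anisotropic over ℚ_p.

Up to the factor 1/2 when the degrees agree, the density is the eventual value of p^(e n(n+1)/2)
times the Haar volume of {X : S[X] ≡ T mod p^e}. A Newton step shows that a symmetric matrix close
to T is T[g] to higher precision, with g in GL_n(ℤ_p). Such a g preserves the volume, so the
normalised volume is eventually constant (`exists_bracket_congr`, `mass_succ`).

If det g has valuation v, then α(S, T[g]) = p^((n+1-4)v) α(S, T)
(`HasMassDensity.change_of_variables`). Indeed g is peeled into unimodular factors and factors
diag(1, …, p, …, 1), and for the latter the property above makes every solution for the scaled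
matrix divisible by the factor. Hence it suffices to treat one T per rational class, namely a
diagonal one with entries u_j or p u_j, the u_j being units (`exists_modularDiag`).

For these T the volume is a count modulo p: the entries u_j are represented by orthogonal vectors in
the first plane and the entries p u_j by orthogonal vectors in the second
(`mem_congrSet_modularDiag_iff`). An anisotropic T has at most two entries of each kind, so the
shapes are 2+1 or 2+2. One vector can be chosen in p+1 ways and an orthogonal pair in 2(p+1) ways,
which gives the stated values.

It remains to see which T are represented. A non-zero density yields, by compactness, an actual
solution of S[X] = T, so T is anisotropic, and for n = 4 its determinant is p²ε² times a square. The
tame formula for the Hilbert symbol shows that anisotropy means η_p(T) = -1 when n = 3, and when n =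
4 with square determinant. -/

noncomputable section

namespace LocalDensity

open MeasureTheory

/-! ### Haar measure on integral matrices -/

section Haar

/-- The fibres of a homomorphism onto a finite group with open kernel have equal Haar measure. -/
theorem measureReal_preimage_finite {G F : Type*} [AddCommGroup G] [TopologicalSpace G]
    [IsTopologicalAddGroup G] [MeasurableSpace G] [BorelSpace G] (μ : Measure G)
    [IsProbabilityMeasure μ] [μ.IsAddLeftInvariant] [AddCommGroup F] [Finite F] (π : G →+ F)
    (hπ : Function.Surjective π) (hk : IsOpen (π ⁻¹' {0})) (A : Set F) :
    μ.real (π ⁻¹' A) = A.ncard / Nat.card F := by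
  classical
  have := Fintype.ofFinite F
  have hfib : ∀ y : F, π ⁻¹' {y} = (fun x => -(hπ y).choose + x) ⁻¹' (π ⁻¹' {0}) := by
    intro y
    ext x
    simp only [Set.mem_preimage, Set.mem_singleton_iff, map_add, map_neg, (hπ y).choose_spec]
    rw [neg_add_eq_zero, eq_comm]
  have hmeas : ∀ y : F, MeasurableSet (π ⁻¹' {y}) := by
    intro y
    rw [hfib]
    exact (hk.preimage (by fun_prop)).measurableSet
  have hval : ∀ y : F, μ.real (π ⁻¹' {y}) = μ.real (π ⁻¹' {0}) := by
    intro y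
    rw [hfib, measureReal_def, measure_preimage_add, measureReal_def]
  have hsum : ∀ B : Set F, μ.real (π ⁻¹' B) = B.ncard * μ.real (π ⁻¹' {0}) := by
    intro B
    have hB : π ⁻¹' B = ⋃ y ∈ B.toFinset, π ⁻¹' {y} := by
      ext x; simp
    rw [hB, measureReal_biUnion_finset]
    · simp only [hval, Finset.sum_const, nsmul_eq_mul, Set.ncard_eq_toFinset_card']
    · intro a _ b _ hab
      exact Disjoint.preimage _ (by simpa using hab)
    · intro b _; exact hmeas b
  have h1 := hsum Set.univ
  rw [Set.preimage_univ, probReal_univ, Set.ncard_univ] at h1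
  have h0 : (Nat.card F : ℝ) ≠ 0 := by
    intro h; rw [h] at h1; simp at h1
  rw [hsum A]
  field_simp
  rw [mul_assoc, mul_comm (μ.real _), ← h1, mul_one]

variable {p : ℕ} [Fact p.Prime] {ι κ : Type*}

instance : MeasurableSpace (Matrix ι κ ℤ_[p]) := borel _

instance : BorelSpace (Matrix ι κ ℤ_[p]) := ⟨rfl⟩

instance : CompactSpace (Matrix ι κ ℤ_[p]) :=
  inferInstanceAs (CompactSpace (ι → κ → ℤ_[p]))

/-- The invariant probability measure on the matrices over `ℤ_p`. -/
def haar (p : ℕ) [Fact p.Prime] (ι κ : Type*) : Measure (Matrix ι κ ℤ_[p]) :=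
  Measure.addHaarMeasure ⊤

instance : (haar p ι κ).IsAddHaarMeasure := by unfold haar; infer_instance

instance : IsProbabilityMeasure (haar p ι κ) :=
  ⟨by simpa [haar] using Measure.addHaarMeasure_self (G := Matrix ι κ ℤ_[p]) (K₀ := ⊤)⟩

/-- Right multiplication by an invertible matrix preserves the measure. -/
theorem haar_preimage_mul_right [Finite ι] [Fintype κ] [DecidableEq κ] (g h : Matrix κ κ ℤ_[p])
    (hgh : g * h = 1) {A : Set (Matrix ι κ ℤ_[p])} (hA : MeasurableSet A) :
    (haar p ι κ).real ((fun X => X * g) ⁻¹' A) = (haar p ι κ).real A := by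
  have hhg : h * g = 1 := mul_eq_one_comm.1 hgh
  let φ : Matrix ι κ ℤ_[p] ≃ₜ+ Matrix ι κ ℤ_[p] :=
    { toFun := fun X => X * g
      invFun := fun X => X * h
      left_inv := fun X => by simp [Matrix.mul_assoc, hgh]
      right_inv := fun X => by simp [Matrix.mul_assoc, hhg]
      map_add' := fun X Y => by simp [Matrix.add_mul]
      continuous_toFun := by fun_prop
      continuous_invFun := by fun_prop }
  have hc : Continuous φ := φ.continuous_toFun
  -- An automorphism carries the invariant probability measure to an invariant probability measure,
  -- and there is only one.
  have h1 : (haar p ι κ).map φ = haar p ι κ := by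
    have := φ.isAddHaarMeasure_map (haar p ι κ)
    have : IsProbabilityMeasure ((haar p ι κ).map φ) :=
      Measure.isProbabilityMeasure_map hc.measurable.aemeasurable
    exact Measure.isAddHaarMeasure_eq_of_isProbabilityMeasure _ _
  have h2 := congrArg (fun m : Measure _ => m.real A) h1
  simp only [measureReal_def] at h2 ⊢
  rwa [Measure.map_apply hc.measurable hA] at h2

/-- An injective continuous endomorphism scales the measure by the measure of its image. -/
theorem haar_image_endomorphism [Finite ι] [Finite κ]
    (φ : Matrix ι κ ℤ_[p] →+ Matrix ι κ ℤ_[p]) (hφ : Continuous φ) (hinj : Function.Injective φ)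
    (A : Set (Matrix ι κ ℤ_[p])) :
    (haar p ι κ).real (φ '' A) = (haar p ι κ).real (Set.range φ) * (haar p ι κ).real A := by
  have hemb : MeasurableEmbedding φ :=
    (hφ.isClosedEmbedding hinj).measurableEmbedding
  let ν := (haar p ι κ).comap φ
  have hν : ∀ s, ν s = haar p ι κ (φ '' s) := fun s => hemb.comap_apply _ s
  have : ν.IsAddLeftInvariant := by
    constructor
    intro g
    ext s hs
    rw [Measure.map_apply (measurable_const_add g) hs, hν, hν]
    have : φ '' ((fun x => g + x) ⁻¹' s) = (fun x => φ g + x) ⁻¹' (φ '' s) := by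
      ext y
      constructor
      · rintro ⟨x, hx, rfl⟩
        exact ⟨g + x, hx, map_add _ _ _⟩
      · rintro ⟨x, hx, hxy⟩
        refine ⟨-g + x, by simpa using hx, ?_⟩
        simp only [] at hxy
        rw [map_add, map_neg, hxy]; abel
    rw [this, measure_preimage_add]
  have : IsFiniteMeasure ν := ⟨by rw [hν]; exact measure_lt_top _ _⟩
  -- The pullback ν is finite and translation invariant, hence a multiple of Haar measure;
  -- evaluation on the whole space identifies the constant.
  have key := Measure.isAddInvariant_eq_smul_of_compactSpace ν (haar p ι κ)
  have hA := congrArg (fun m : Measure _ => m A) key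
  have hU := congrArg (fun m : Measure _ => m Set.univ) key
  simp only [hν, Measure.smul_apply, measure_univ, Set.image_univ] at hA hU
  simp only [measureReal_def, hA, hU]
  simp [ENNReal.smul_def]

end Haar

/-! ### Volumes of congruence conditions -/

section Congruence

variable {p : ℕ} [Fact p.Prime] {ι κ : Type*}

theorem pow_dvd_iff_toZModPow (e : ℕ) (z : ℤ_[p]) :
    (p : ℤ_[p]) ^ e ∣ z ↔ PadicInt.toZModPow e z = 0 := by
  rw [← RingHom.mem_ker, PadicInt.ker_toZModPow, Ideal.mem_span_singleton]

theorem dvd_iff_toZMod (z : ℤ_[p]) : (p : ℤ_[p]) ∣ z ↔ PadicInt.toZMod z = 0 := by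
  rw [← RingHom.mem_ker, PadicInt.ker_toZMod, PadicInt.maximalIdeal_eq_span_p,
    Ideal.mem_span_singleton]

theorem isClopen_pow_dvd (e : ℕ) : IsClopen {z : ℤ_[p] | (p : ℤ_[p]) ^ e ∣ z} := by
  have : {z : ℤ_[p] | (p : ℤ_[p]) ^ e ∣ z} = Metric.closedBall 0 ((p : ℝ) ^ (-(e : ℤ))) := by
    ext z
    rw [mem_closedBall_zero_iff, PadicInt.norm_le_pow_iff_mem_span_pow, Ideal.mem_span_singleton]
    rfl
  rw [this]
  refine IsUltrametricDist.isClopen_closedBall _ ?_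
  exact (zpow_pos (by exact_mod_cast (Fact.out : p.Prime).pos) _).ne'

theorem isUnit_iff_not_dvd (z : ℤ_[p]) : IsUnit z ↔ ¬ (p : ℤ_[p]) ∣ z := by
  rw [← PadicInt.norm_lt_one_iff_dvd, PadicInt.isUnit_iff]
  have := PadicInt.norm_le_one z
  constructor
  · intro h; rw [h]; exact lt_irrefl _
  · intro h; exact le_antisymm this (not_lt.1 h)

theorem forall_dvd_iff_exists_smul {R : Type*} [CommRing R] (c : R) (A : Matrix ι κ R) :
    (∀ i j, c ∣ A i j) ↔ ∃ B : Matrix ι κ R, A = c • B := by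
  constructor
  · intro h
    choose B hB using h
    exact ⟨of B, by ext i j; simpa using hB i j⟩
  · rintro ⟨B, rfl⟩ i j
    exact ⟨B i j, by simp⟩

/-- Coset representatives for p^k ℤ_p / p^e ℤ_p, used to split a coarse congruence condition into
fine ones. -/
theorem exists_unique_digit {k e : ℕ} (hke : k ≤ e) {z : ℤ_[p]} (hz : (p : ℤ_[p]) ^ k ∣ z) :
    ∃! r : Fin (p ^ (e - k)), (p : ℤ_[p]) ^ e ∣ z - (p : ℤ_[p]) ^ k * (r : ℕ) := by
  obtain ⟨y, rfl⟩ := hz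
  have hp0 : (p : ℤ_[p]) ^ k ≠ 0 := pow_ne_zero _ (by exact_mod_cast (Fact.out : p.Prime).ne_zero)
  have key : ∀ r : ℕ, (p : ℤ_[p]) ^ e ∣ (p : ℤ_[p]) ^ k * y - (p : ℤ_[p]) ^ k * r ↔
      PadicInt.toZModPow (e - k) y = r := by
    intro r
    rw [← mul_sub, show (p : ℤ_[p]) ^ e = p ^ k * p ^ (e - k) by rw [← pow_add]; congr 1; omega,
      mul_dvd_mul_iff_left hp0, pow_dvd_iff_toZModPow, map_sub, sub_eq_zero, map_natCast]
  have : NeZero (p ^ (e - k)) := ⟨pow_ne_zero _ (Fact.out : p.Prime).ne_zero⟩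
  refine ⟨⟨(PadicInt.toZModPow (e - k) y).val, ZMod.val_lt _⟩, ?_, ?_⟩
  · simp only []
    rw [key]; simp
  · intro r hr
    rw [key] at hr
    ext
    simp only [hr, ZMod.val_natCast, Nat.mod_eq_of_lt r.2]

/-- Reduction of a matrix modulo `p^e`. -/
def reduction (p : ℕ) [Fact p.Prime] (ι κ : Type*) (e : ℕ) :
    Matrix ι κ ℤ_[p] →+ Matrix ι κ (ZMod (p ^ e)) :=
  (PadicInt.toZModPow e).toAddMonoidHom.mapMatrix

@[simp] theorem reduction_apply (e : ℕ) (X : Matrix ι κ ℤ_[p]) (i : ι) (j : κ) :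
    reduction p ι κ e X i j = PadicInt.toZModPow e (X i j) := rfl

theorem reduction_surjective (e : ℕ) : Function.Surjective (reduction p ι κ e) := by
  have : NeZero (p ^ e) := ⟨pow_ne_zero _ (Fact.out : p.Prime).ne_zero⟩
  intro Y
  refine ⟨of fun i j => ((Y i j).val : ℤ_[p]), ?_⟩
  ext i j
  simp

theorem reduction_eq_iff (e : ℕ) (X Y : Matrix ι κ ℤ_[p]) :
    reduction p ι κ e X = reduction p ι κ e Y ↔ ∀ i j, (p : ℤ_[p]) ^ e ∣ (X - Y) i j := by
  simp [← Matrix.ext_iff, pow_dvd_iff_toZModPow, sub_eq_zero]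

theorem haar_preimage_reduction [Fintype ι] [Fintype κ] (e : ℕ)
    (A : Set (Matrix ι κ (ZMod (p ^ e)))) :
    (haar p ι κ).real (reduction p ι κ e ⁻¹' A) =
      A.ncard / (p : ℝ) ^ (e * (Fintype.card ι * Fintype.card κ)) := by
  classical
  have : NeZero (p ^ e) := ⟨pow_ne_zero _ (Fact.out : p.Prime).ne_zero⟩
  rw [measureReal_preimage_finite _ _ (reduction_surjective e)]
  · congr 1
    have : Nat.card (Matrix ι κ (ZMod (p ^ e))) = Nat.card (ι → κ → ZMod (p ^ e)) := rfl
    rw [this, Nat.card_fun, Nat.card_fun, Nat.card_zmod, Nat.card_eq_fintype_card,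
      Nat.card_eq_fintype_card]
    push_cast
    rw [← pow_mul, ← pow_mul]
    congr 1
    ring
  · have : reduction p ι κ e ⁻¹' {0} =
        ⋂ i, ⋂ j, (fun X : Matrix ι κ ℤ_[p] => X i j) ⁻¹' {z | (p : ℤ_[p]) ^ e ∣ z} := by
      ext X
      have := reduction_eq_iff e X 0
      simpa using this
    rw [this]
    refine isOpen_iInter_of_finite fun i => isOpen_iInter_of_finite fun j => ?_
    exact (isClopen_pow_dvd e).isOpen.preimage (by fun_prop)

/-- The matrices `X` with `S[X] ≡ T` modulo the powers `p^k(i,j)`. -/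
def congrSet [Fintype ι] (S : Matrix ι ι ℤ_[p]) (T : Matrix κ κ ℤ_[p]) (k : Sym2 κ → ℕ) :
    Set (Matrix ι κ ℤ_[p]) :=
  {X | ∀ i j, (p : ℤ_[p]) ^ k s(i, j) ∣ (bracket S X - T) i j}

theorem isClopen_congrSet [Fintype ι] [Finite κ] (S : Matrix ι ι ℤ_[p]) (T : Matrix κ κ ℤ_[p])
    (k : Sym2 κ → ℕ) : IsClopen (congrSet S T k) := by
  have : congrSet S T k = ⋂ i, ⋂ j, (fun X : Matrix ι κ ℤ_[p] => (bracket S X - T) i j) ⁻¹'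
      {z | (p : ℤ_[p]) ^ k s(i, j) ∣ z} := by
    ext X; simp [congrSet]
  rw [this]
  refine isClopen_iInter_of_finite fun i => isClopen_iInter_of_finite fun j => ?_
  refine (isClopen_pow_dvd _).preimage ?_
  unfold bracket
  have : Continuous fun X : Matrix ι κ ℤ_[p] => Xᵀ * S * X - T := by fun_prop
  exact this.matrix_elem i j

theorem measurableSet_congrSet [Fintype ι] [Finite κ] (S : Matrix ι ι ℤ_[p])
    (T : Matrix κ κ ℤ_[p]) (k : Sym2 κ → ℕ) : MeasurableSet (congrSet S T k) :=
  (isClopen_congrSet S T k).isOpen.measurableSet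

/-- The measure of the set of `X` with `S[X] ≡ T` modulo `p^e`. -/
def mass [Fintype ι] (S : Matrix ι ι ℤ_[p]) (T : Matrix κ κ ℤ_[p]) (e : ℕ) : ℝ :=
  (haar p ι κ).real (congrSet S T fun _ => e)

theorem mass_congr [Fintype ι] (S : Matrix ι ι ℤ_[p]) {T T' : Matrix κ κ ℤ_[p]} {e : ℕ}
    (h : ∀ i j, (p : ℤ_[p]) ^ e ∣ (T - T') i j) : mass S T e = mass S T' e := by
  unfold mass
  congr 1
  ext X
  refine forall₂_congr fun i j => ?_
  have : (bracket S X - T') i j = (bracket S X - T) i j + (T - T') i j := by simp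
  rw [this, dvd_add_left (h i j)]

theorem bracket_mul {R : Type*} [CommRing R] {τ : Type*} [Fintype ι] [Fintype κ]
    (S : Matrix ι ι R) (X : Matrix ι κ R) (g : Matrix κ τ R) :
    bracket S (X * g) = bracket (bracket S X) g := by
  simp [bracket, Matrix.mul_assoc, Matrix.transpose_mul]

theorem bracket_sub {R : Type*} [CommRing R] [Fintype ι]
    (S T : Matrix ι ι R) (X : Matrix ι κ R) :
    bracket (S - T) X = bracket S X - bracket T X := by
  simp [bracket, Matrix.mul_sub, Matrix.sub_mul]

theorem dvd_bracket {R : Type*} [CommRing R] [Fintype ι] {c : R}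
    {A : Matrix ι ι R} (h : ∀ i j, c ∣ A i j) (X : Matrix ι κ R) (i j : κ) :
    c ∣ bracket A X i j := by
  obtain ⟨B, rfl⟩ := (forall_dvd_iff_exists_smul c A).1 h
  exact ⟨bracket B X i j, by simp [bracket]⟩

theorem bracket_isSymm {R : Type*} [CommRing R] [Fintype ι] {S : Matrix ι ι R} (hS : S.IsSymm)
    (X : Matrix ι κ R) : (bracket S X).IsSymm := by
  unfold bracket Matrix.IsSymm
  rw [transpose_mul, transpose_mul, transpose_transpose, hS.eq, Matrix.mul_assoc]

theorem bracket_one {R : Type*} [CommRing R] [Fintype ι] [DecidableEq ι] (S : Matrix ι ι R) :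
    bracket S 1 = S := by
  simp [bracket]

/-- The measure-preserving map X ↦ Xg exchanges the two solution sets, since the congruence for Xg
can be undone by h. -/
theorem mass_bracket [Fintype ι] [Fintype κ] [DecidableEq κ] (S : Matrix ι ι ℤ_[p])
    (T : Matrix κ κ ℤ_[p]) (e : ℕ) {g h : Matrix κ κ ℤ_[p]} (hgh : g * h = 1) :
    mass S (bracket T g) e = mass S T e := by
  unfold mass
  rw [← haar_preimage_mul_right g h hgh (measurableSet_congrSet S _ _)]
  congr 1
  ext X
  simp only [congrSet, Set.mem_preimage, Set.mem_ofPred_eq, bracket_mul, ← bracket_sub]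
  constructor
  · intro H
    have := dvd_bracket H h
    rwa [← bracket_mul, hgh, bracket_one] at this
  · intro H
    exact dvd_bracket H g

/-- If the mass at level `e` is constant along a family of congruence conditions, then the mass
of the coarser set is obtained by counting cosets. -/
theorem haar_congrSet_eq_prod_mul_mass [Fintype ι] [Fintype κ] [DecidableEq κ]
    {S : Matrix ι ι ℤ_[p]} (hS : S.IsSymm) {T : Matrix κ κ ℤ_[p]} (hT : T.IsSymm)
    (k : Sym2 κ → ℕ) (e : ℕ) (hk : ∀ s, k s ≤ e)
    (hconst : ∀ D : Matrix κ κ ℤ_[p], D.IsSymm → (∀ i j, (p : ℤ_[p]) ^ k s(i, j) ∣ D i j) →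
      mass S (T + D) e = mass S T e) :
    (haar p ι κ).real (congrSet S T k) = (∏ s, (p : ℝ) ^ (e - k s)) * mass S T e := by
  -- Representatives modulo p^e of the symmetric matrices that satisfy the coarse divisibilities,
  -- with one digit for each unordered pair.
  let D : ((s : Sym2 κ) → Fin (p ^ (e - k s))) → Matrix κ κ ℤ_[p] :=
    fun d => of fun i j => (p : ℤ_[p]) ^ k s(i, j) * (d s(i, j) : ℕ)
  have hD1 : ∀ d, (D d).IsSymm := by
    intro d
    ext i j
    simp only [D, transpose_apply, of_apply]
    rw [Sym2.eq_swap]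
  have hD2 : ∀ d, ∀ i j, (p : ℤ_[p]) ^ k s(i, j) ∣ D d i j := fun d i j => ⟨_, rfl⟩
  have hval : ∀ X : Matrix ι κ ℤ_[p], ∀ s : Sym2 κ, ∃ z : ℤ_[p], ∀ i j, s(i, j) = s →
      (bracket S X - T) i j = z := by
    intro X s
    -- By symmetry `bracket S X - T` takes one value on each unordered pair, so digits indexed by
    -- `Sym2 κ` suffice.
    induction s with | _ a b
    refine ⟨(bracket S X - T) a b, fun i j hij => ?_⟩
    rcases Sym2.eq_iff.1 hij with ⟨rfl, rfl⟩ | ⟨rfl, rfl⟩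
    · rfl
    · exact (((bracket_isSymm hS X).sub hT).apply _ _)
  have hU : congrSet S T k = ⋃ d, congrSet S (T + D d) fun _ => e := by
    ext X
    choose z hz using hval X
    have hz' : ∀ i j, (bracket S X - T) i j = z s(i, j) := fun i j => hz _ i j rfl
    simp only [Set.mem_iUnion]
    constructor
    · intro hX
      have hdig : ∀ s, ∃ r : Fin (p ^ (e - k s)),
          (p : ℤ_[p]) ^ e ∣ z s - (p : ℤ_[p]) ^ k s * (r : ℕ) := by
        intro s
        have hs : (p : ℤ_[p]) ^ k s ∣ z s := by
          induction s with | _ a b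
          rw [← hz' a b]; exact hX a b
        exact (exists_unique_digit (hk s) hs).exists
      choose d hd using hdig
      refine ⟨d, fun i j => ?_⟩
      have := hd s(i, j)
      rw [← hz'] at this
      rw [← sub_sub]
      exact this
    · rintro ⟨d, hd⟩ i j
      have h1 := hd i j
      rw [← sub_sub] at h1
      have h2 := (pow_dvd_pow (p : ℤ_[p]) (hk s(i, j))).trans h1
      rw [sub_apply _ (D d)] at h2
      exact (dvd_sub_left (hD2 d i j)).1 h2
  have hdisj : Pairwise fun d d' =>
      Disjoint (congrSet S (T + D d) fun _ => e) (congrSet S (T + D d') fun _ => e) := by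
    intro d d' hdd'
    rw [Set.disjoint_left]
    intro X hX hX'
    apply hdd'
    ext s : 1
    induction s with | _ i j
    have h1 := hX i j
    have h2 := hX' i j
    simp only [] at h1 h2
    rw [← sub_sub, sub_apply _ (D _)] at h1 h2
    have h3 : (p : ℤ_[p]) ^ k s(i, j) ∣ (bracket S X - T) i j :=
      (dvd_sub_left (hD2 d i j)).1 ((pow_dvd_pow (p : ℤ_[p]) (hk s(i, j))).trans h1)
    exact (exists_unique_digit (hk s(i, j)) h3).unique h1 h2
  rw [hU, measureReal_def, measure_iUnion hdisj fun d => measurableSet_congrSet S _ _,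
    tsum_fintype, ENNReal.toReal_sum fun d _ => measure_ne_top _ _]
  have : ∀ d, (haar p ι κ (congrSet S (T + D d) fun _ => e)).toReal = mass S T e :=
    fun d => hconst _ (hD1 d) (hD2 d)
  simp only [this, Finset.sum_const, nsmul_eq_mul, Finset.card_univ, Fintype.card_pi,
    Fintype.card_fin]
  push_cast
  rfl

end Congruence

/-! ### Newton approximation and stabilisation of densities -/

section Stability

variable {p : ℕ} [Fact p.Prime] {ι κ : Type*} [Fintype ι] [Fintype κ] [DecidableEq κ]

theorem natCast_prime_ne_zero : (p : ℤ_[p]) ≠ 0 := by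
  exact_mod_cast (Fact.out : p.Prime).ne_zero

theorem isUnit_two (hp : p ≠ 2) : IsUnit (2 : ℤ_[p]) := by
  rw [isUnit_iff_not_dvd, dvd_iff_toZMod, map_ofNat]
  intro h
  have h2 : ((2 : ℕ) : ZMod p) = 0 := by exact_mod_cast h
  rw [ZMod.natCast_eq_zero_iff] at h2
  exact hp ((Nat.prime_dvd_prime_iff_eq Fact.out Nat.prime_two).1 h2)

theorem exists_mul_eq_one_of_isUnit_det {g : Matrix κ κ ℤ_[p]} (h : IsUnit g.det) :
    ∃ g' : Matrix κ κ ℤ_[p], g * g' = 1 :=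
  ⟨g⁻¹, Matrix.mul_nonsing_inv g h⟩

/-- A matrix congruent to the identity modulo `p` is invertible. -/
theorem isUnit_det_one_add (K : Matrix κ κ ℤ_[p]) :
    IsUnit (1 + (p : ℤ_[p]) • K).det := by
  rw [isUnit_iff_not_dvd, dvd_iff_toZMod, RingHom.map_det]
  have : (PadicInt.toZMod (p := p)).mapMatrix (1 + (p : ℤ_[p]) • K) = 1 := by
    ext i j
    by_cases h : i = j
    · subst h; simp
    · simp [h]
  rw [this]
  simp

/-- The exponent c with p^c T⁻¹ integral measures the loss of precision in the Newton step; the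
adjugate gives one with c the valuation of det T. -/
theorem exists_mul_eq_pow_smul_one {T : Matrix κ κ ℤ_[p]} (hT : T.det ≠ 0) :
    ∃ (c : ℕ) (R : Matrix κ κ ℤ_[p]), R * T = (p : ℤ_[p]) ^ c • 1 := by
  refine ⟨T.det.valuation, ((PadicInt.unitCoeff hT)⁻¹ : ℤ_[p]ˣ).1 • T.adjugate, ?_⟩
  rw [Matrix.smul_mul, adjugate_mul, smul_smul]
  congr 1
  have h := PadicInt.unitCoeff_spec hT
  generalize PadicInt.unitCoeff hT = u at h
  generalize T.det.valuation = c at h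
  rw [h]
  simp

/-- Matrices close to a non-degenerate `T` are integrally equivalent to `T` to a higher precision. -/
theorem exists_bracket_congr (hp : p ≠ 2) {T R D : Matrix κ κ ℤ_[p]} (hT : T.IsSymm) {c : ℕ}
    (hR : R * T = (p : ℤ_[p]) ^ c • 1) (hD : D.IsSymm) {f e : ℕ} (hf : c + 1 ≤ f)
    (he : e + c ≤ 2 * f) (hDf : ∀ i j, (p : ℤ_[p]) ^ f ∣ D i j) :
    ∃ g h : Matrix κ κ ℤ_[p], g * h = 1 ∧
      ∀ i j, (p : ℤ_[p]) ^ e ∣ (T + D - bracket T g) i j := by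
  obtain ⟨t, ht⟩ := (isUnit_two hp).exists_right_inv
  obtain ⟨D, rfl⟩ := (forall_dvd_iff_exists_smul _ D).1 hDf
  have hD' : D.IsSymm := by
    ext i j
    have := hD.apply i j
    simp only [Matrix.smul_apply, smul_eq_mul] at this
    exact mul_left_cancel₀ (pow_ne_zero _ natCast_prime_ne_zero) this
  have hTR : T * R = (p : ℤ_[p]) ^ c • 1 := by
    have h1 : R * (T * R - (p : ℤ_[p]) ^ c • 1) = 0 := by
      rw [Matrix.mul_sub, ← Matrix.mul_assoc, hR]; simp
    have h2 : T * (R * (T * R - (p : ℤ_[p]) ^ c • 1)) = 0 := by rw [h1]; simp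
    have hdet : R.det ≠ 0 := by
      intro h0
      have := congrArg Matrix.det hR
      rw [det_mul, h0, zero_mul, det_smul, det_one, mul_one] at this
      exact pow_ne_zero _ (pow_ne_zero _ natCast_prime_ne_zero) this.symm
    have h3 := congrArg (fun M => R.adjugate * M) h1
    simp only [← Matrix.mul_assoc, adjugate_mul, Matrix.mul_zero, Matrix.smul_mul,
      Matrix.one_mul] at h3
    have h4 := (smul_eq_zero.1 h3).resolve_left hdet
    exact sub_eq_zero.1 h4
  obtain ⟨d, rfl⟩ : ∃ d, f = c + 1 + d := ⟨f - (c + 1), by omega⟩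
  -- One Newton step: with t = 1/2, pTK is half of the perturbation p^f D, so the linear terms of
  -- T[1 + pK] produce it exactly. The quadratic term is divisible by p^(2f - c), and f ≥ c + 1
  -- keeps K integral.
  let K : Matrix κ κ ℤ_[p] := ((p : ℤ_[p]) ^ d * t) • (R * D)
  obtain ⟨h, hgh⟩ := exists_mul_eq_one_of_isUnit_det (isUnit_det_one_add K)
  refine ⟨1 + (p : ℤ_[p]) • K, h, hgh, ?_⟩
  have hTK : T * K = ((p : ℤ_[p]) ^ (c + d) * t) • D := by
    simp only [K, Matrix.mul_smul, ← Matrix.mul_assoc, hTR, Matrix.smul_mul, Matrix.one_mul,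
      smul_smul]
    congr 1; ring
  have hKT : Kᵀ * T = ((p : ℤ_[p]) ^ (c + d) * t) • D := by
    have := congrArg Matrix.transpose hTK
    rwa [Matrix.transpose_mul T, hT.eq, Matrix.transpose_smul _ D, hD'.eq] at this
  have key : bracket T (1 + (p : ℤ_[p]) • K) = T + (p : ℤ_[p]) ^ (c + 1 + d) • D +
      ((p : ℤ_[p]) ^ (c + 2 + 2 * d) * t ^ 2) • (D * (R * D)) := by
    have h1 : bracket T (1 + (p : ℤ_[p]) • K) =
        T + (p : ℤ_[p]) • (T * K) + (p : ℤ_[p]) • (Kᵀ * T) +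
          ((p : ℤ_[p]) * p) • (Kᵀ * T * K) := by
      simp only [bracket, Matrix.transpose_add, Matrix.transpose_one, Matrix.transpose_smul,
        Matrix.add_mul, Matrix.mul_add, Matrix.one_mul, Matrix.mul_one, Matrix.smul_mul,
        Matrix.mul_smul, smul_add, ← smul_smul]
      abel
    have h2 : (p : ℤ_[p]) * ((p : ℤ_[p]) ^ (c + d) * t) + (p : ℤ_[p]) * ((p : ℤ_[p]) ^ (c + d) * t)
        = (p : ℤ_[p]) ^ (c + 1 + d) := by
      rw [show (p : ℤ_[p]) * ((p : ℤ_[p]) ^ (c + d) * t) + (p : ℤ_[p]) *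
        ((p : ℤ_[p]) ^ (c + d) * t) = (p : ℤ_[p]) ^ (c + 1 + d) * (2 * t) by ring, ht, mul_one]
    rw [h1, hKT, hTK, add_assoc T, smul_smul, ← add_smul, h2]
    congr 1
    simp only [K, Matrix.smul_mul, Matrix.mul_smul, smul_smul]
    congr 1; ring
  rw [key]
  intro i j
  have : (T + (p : ℤ_[p]) ^ (c + 1 + d) • D - (T + (p : ℤ_[p]) ^ (c + 1 + d) • D +
      ((p : ℤ_[p]) ^ (c + 2 + 2 * d) * t ^ 2) • (D * (R * D)))) =
      -((p : ℤ_[p]) ^ (c + 2 + 2 * d) * t ^ 2) • (D * (R * D)) := by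
    rw [neg_smul]; abel
  rw [this, Matrix.smul_apply, smul_eq_mul, neg_mul, dvd_neg, mul_assoc]
  exact (pow_dvd_pow _ (by omega)).mul_right _

theorem mass_add (hp : p ≠ 2) (S : Matrix ι ι ℤ_[p]) {T R D : Matrix κ κ ℤ_[p]} (hT : T.IsSymm)
    {c : ℕ} (hR : R * T = (p : ℤ_[p]) ^ c • 1) (hD : D.IsSymm) {f e : ℕ} (hf : c + 1 ≤ f)
    (he : e + c ≤ 2 * f) (hDf : ∀ i j, (p : ℤ_[p]) ^ f ∣ D i j) :
    mass S (T + D) e = mass S T e := by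
  obtain ⟨g, h, hgh, hg⟩ := exists_bracket_congr hp hT hR hD hf he hDf
  rw [mass_congr S hg, mass_bracket S T e hgh]

/-- The solution set at level e is the disjoint union of those at level e + 1 for T + D, with D
symmetric and divisible by p^e. All of these have the same volume once (e + 1) + c ≤ 2e. -/
theorem mass_succ (hp : p ≠ 2) {S : Matrix ι ι ℤ_[p]} (hS : S.IsSymm) {T R : Matrix κ κ ℤ_[p]}
    (hT : T.IsSymm) {c : ℕ} (hR : R * T = (p : ℤ_[p]) ^ c • 1) {e : ℕ} (he : c + 1 ≤ e) :
    mass S T e = (p : ℝ) ^ Fintype.card (Sym2 κ) * mass S T (e + 1) := by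
  have := haar_congrSet_eq_prod_mul_mass hS hT (fun _ => e) (e + 1) (fun _ => Nat.le_succ e)
    (fun D hD hDe => mass_add hp S hT hR hD he (by omega) hDe)
  simpa [mass] using this

/-- `α` is the eventual value of `p^(e n(n+1)/2)` times the mass at level `e`. -/
def HasMassDensity (S : Matrix ι ι ℤ_[p]) (T : Matrix κ κ ℤ_[p]) (α : ℝ) : Prop :=
  ∀ᶠ e in atTop, (p : ℝ) ^ (e * Fintype.card (Sym2 κ)) * mass S T e = α

omit [DecidableEq κ] in
theorem HasMassDensity.unique {S : Matrix ι ι ℤ_[p]} {T : Matrix κ κ ℤ_[p]} {α β : ℝ}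
    (h : HasMassDensity S T α) (h' : HasMassDensity S T β) : α = β := by
  obtain ⟨e, h1, h2⟩ := (h.and h').exists
  rw [← h1, h2]

/-- From level c + 1 on the normalised mass is constant, so the density can be read off at any
single such level. -/
theorem hasMassDensity_of_le (hp : p ≠ 2) {S : Matrix ι ι ℤ_[p]} (hS : S.IsSymm)
    {T R : Matrix κ κ ℤ_[p]} (hT : T.IsSymm) {c : ℕ} (hR : R * T = (p : ℤ_[p]) ^ c • 1) {e : ℕ}
    (he : c + 1 ≤ e) :
    HasMassDensity S T ((p : ℝ) ^ (e * Fintype.card (Sym2 κ)) * mass S T e) := by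
  refine eventually_atTop.2 ⟨e, fun f hf => ?_⟩
  induction f, hf using Nat.le_induction with
  | base => rfl
  | succ f hf ih =>
    rw [← ih, mass_succ hp hS hT hR (he.trans hf), Nat.succ_mul, pow_add, mul_assoc]

theorem exists_hasMassDensity (hp : p ≠ 2) {S : Matrix ι ι ℤ_[p]} (hS : S.IsSymm)
    {T : Matrix κ κ ℤ_[p]} (hT : T.IsSymm) (hd : T.det ≠ 0) : ∃ α, HasMassDensity S T α := by
  obtain ⟨c, R, hR⟩ := exists_mul_eq_pow_smul_one hd
  exact ⟨_, hasMassDensity_of_le hp hS hT hR le_rfl⟩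

omit [DecidableEq κ] in
/-- A matrix with non-zero density is represented. -/
theorem exists_bracket_eq_of_hasMassDensity {S : Matrix ι ι ℤ_[p]} {T : Matrix κ κ ℤ_[p]} {α : ℝ}
    (h : HasMassDensity S T α) (hα : α ≠ 0) : ∃ X : Matrix ι κ ℤ_[p], bracket S X = T := by
  obtain ⟨E, hE⟩ := eventually_atTop.1 h
  have hmono : ∀ e f, e ≤ f → congrSet S T (fun _ => f) ⊆ congrSet S T fun _ => e :=
    fun e f hef X hX i j => (pow_dvd_pow _ hef).trans (hX i j)
  have hne : ∀ e, (congrSet S T fun _ => e).Nonempty := by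
    intro e
    have h1 := hE (max e E) (le_max_right _ _)
    refine Set.Nonempty.mono (hmono e _ (le_max_left e E)) ?_
    rw [Set.nonempty_iff_ne_empty]
    intro h0
    rw [mass, h0] at h1
    simp at h1
    exact hα h1.symm
  -- The solution sets are nested, compact and non-empty, so some X solves all the congruences at
  -- once.
  obtain ⟨X, hX⟩ := IsCompact.nonempty_iInter_of_sequence_nonempty_isCompact_isClosed
    (fun e : ℕ => congrSet S T fun _ => e) (fun e => hmono e _ (Nat.le_succ e)) hne
    (isClopen_congrSet S T _).isClosed.isCompact fun e => (isClopen_congrSet S T _).isClosed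
  refine ⟨X, ?_⟩
  ext i j : 1
  rw [← sub_eq_zero, ← Matrix.sub_apply]
  by_contra hne
  have h2 := Set.mem_iInter.1 hX (((bracket S X - T) i j).valuation + 1) i j
  simp only [] at h2
  rw [← Ideal.mem_span_singleton, PadicInt.mem_span_pow_iff_le_valuation _ hne] at h2
  omega

end Stability

/-! ### Densities under integral changes of variables -/

section Scaling

variable {p : ℕ} [Fact p.Prime] {ι κ : Type*} [Fintype ι] [Fintype κ] [DecidableEq κ]

/-- The multiplicity of `i` in an unordered pair. -/
def pairMult {κ : Type*} [DecidableEq κ] (i : κ) : Sym2 κ → ℕ :=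
  Sym2.lift ⟨fun a b => (if a = i then 1 else 0) + (if b = i then 1 else 0), fun _ _ => add_comm _ _⟩

omit [Fintype κ] in
theorem pairMult_mk (i a b : κ) :
    pairMult i s(a, b) = (if a = i then 1 else 0) + (if b = i then 1 else 0) := rfl

omit [Fintype κ] in
theorem pairMult_le (i : κ) (s : Sym2 κ) : pairMult i s ≤ 2 := by
  induction s with | _ a b
  rw [pairMult_mk]
  split_ifs <;> omega

/-- The pair {i, i} contributes 2 and each of the n - 1 pairs {i, j} contributes 1. This is the
total precision lost when the i-th basis vector is scaled by p. -/
theorem sum_pairMult (i : κ) : ∑ s : Sym2 κ, pairMult i s = Fintype.card κ + 1 := by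
  have hinj : Function.Injective fun j : κ => s(i, j) := by
    intro a b h
    exact Sym2.congr_right.1 h
  rw [← Finset.sum_subset (Finset.subset_univ (Finset.univ.image fun j : κ => s(i, j))),
    Finset.sum_image fun a _ b _ h => hinj h]
  · simp [pairMult_mk, Finset.sum_add_distrib]
  · intro s _ hs
    induction s with | _ a b
    simp only [Finset.mem_image, Finset.mem_univ, true_and, not_exists] at hs
    have ha : a ≠ i := by rintro rfl; exact hs b rfl
    have hb : b ≠ i := by rintro rfl; exact hs a Sym2.eq_swap
    rw [pairMult_mk, if_neg ha, if_neg hb, add_zero]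

/-- The diagonal matrix with entry `p` at the place `i` and `1` elsewhere. -/
def primeDiag (p : ℕ) [Fact p.Prime] {κ : Type*} [DecidableEq κ] (i : κ) : Matrix κ κ ℤ_[p] :=
  diagonal fun j => if j = i then (p : ℤ_[p]) else 1

theorem det_primeDiag (i : κ) : (primeDiag p i).det = p := by
  simp [primeDiag]

theorem bracket_primeDiag (T : Matrix κ κ ℤ_[p]) (i a b : κ) :
    bracket T (primeDiag p i) a b = (p : ℤ_[p]) ^ pairMult i s(a, b) * T a b := by
  simp only [bracket, primeDiag, diagonal_transpose, diagonal_mul, mul_diagonal, pairMult_mk]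
  split_ifs <;> ring

-- The volume of the image of X ↦ X · `primeDiag p i`: one condition modulo p for each row.
omit [Fintype κ] [DecidableEq κ] in
theorem haar_column_dvd (i : κ) :
    (haar p ι κ).real {X | ∀ r, (p : ℤ_[p]) ∣ X r i} = ((p : ℝ) ^ Fintype.card ι)⁻¹ := by
  let π : Matrix ι κ ℤ_[p] →+ (ι → ZMod p) :=
    { toFun := fun X r => PadicInt.toZMod (X r i)
      map_zero' := by ext; simp
      map_add' := fun X Y => by ext; simp }
  have hset : {X : Matrix ι κ ℤ_[p] | ∀ r, (p : ℤ_[p]) ∣ X r i} = π ⁻¹' {0} := by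
    ext X
    simp [π, dvd_iff_toZMod, funext_iff]
  have hclopen : IsOpen (π ⁻¹' {0}) := by
    have : π ⁻¹' {0} = ⋂ r, (fun X : Matrix ι κ ℤ_[p] => X r i) ⁻¹' {z | (p : ℤ_[p]) ^ 1 ∣ z} := by
      rw [← hset]; ext X; simp
    rw [this]
    exact isOpen_iInter_of_finite fun r => (isClopen_pow_dvd 1).isOpen.preimage (by fun_prop)
  rw [hset, measureReal_preimage_finite _ π _ hclopen]
  · rw [Nat.card_fun, Nat.card_zmod, Nat.card_eq_fintype_card]
    simp
  · intro y
    refine ⟨of fun r _ => ((y r).val : ℤ_[p]), ?_⟩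
    ext r
    simp [π]

/-- If `p² ∣ S[x]` forces `p ∣ x`, then scaling a basis vector by `p` scales the density. -/
theorem HasMassDensity.scale_column (hp : p ≠ 2) {S : Matrix ι ι ℤ_[p]} (hS : S.IsSymm)
    (hS2 : ∀ x : ι → ℤ_[p], (p : ℤ_[p]) ^ 2 ∣ x ⬝ᵥ S *ᵥ x → ∀ r, (p : ℤ_[p]) ∣ x r)
    {T : Matrix κ κ ℤ_[p]} (hT : T.IsSymm) (hd : T.det ≠ 0) {α : ℝ} (h : HasMassDensity S T α)
    (i : κ) :
    HasMassDensity S (bracket T (primeDiag p i))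
      ((p : ℝ) ^ (Fintype.card κ + 1) / (p : ℝ) ^ Fintype.card ι * α) := by
  obtain ⟨c, R, hR⟩ := exists_mul_eq_pow_smul_one hd
  have hP : ∀ (X : Matrix ι κ ℤ_[p]) r j,
      (X * primeDiag p i) r j = X r j * if j = i then (p : ℤ_[p]) else 1 := by
    intro X r j; simp [primeDiag]
  let φ : Matrix ι κ ℤ_[p] →+ Matrix ι κ ℤ_[p] :=
    { toFun := fun X => X * primeDiag p i
      map_zero' := by simp
      map_add' := fun X Y => by simp [Matrix.add_mul] }
  have hφ : Continuous φ := by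
    change Continuous fun X : Matrix ι κ ℤ_[p] => X * primeDiag p i
    fun_prop
  have hinj : Function.Injective φ := by
    intro X Y hXY
    ext r j : 1
    have := congrFun (congrFun hXY r) j
    change (X * primeDiag p i) r j = (Y * primeDiag p i) r j at this
    rw [hP, hP] at this
    refine mul_right_cancel₀ ?_ this
    split_ifs
    · exact natCast_prime_ne_zero
    · exact one_ne_zero
  have hrange : Set.range φ = {X | ∀ r, (p : ℤ_[p]) ∣ X r i} := by
    ext X
    constructor
    · rintro ⟨Y, rfl⟩ r
      change (p : ℤ_[p]) ∣ (Y * primeDiag p i) r i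
      rw [hP, if_pos rfl]; exact dvd_mul_left _ _
    · intro hX
      choose y hy using hX
      let Y : Matrix ι κ ℤ_[p] := of fun r j => if j = i then y r else X r j
      refine ⟨Y, ?_⟩
      ext r j : 1
      change (Y * primeDiag p i) r j = _
      rw [hP]
      simp only [Y, of_apply]
      by_cases hj : j = i
      · subst hj; simp [hy, mul_comm]
      · simp [hj]
  -- The bound leaves room for `mass_add` with f = e - 2, which asks for c + 1 ≤ e - 2 and e + c ≤
  -- 2(e - 2).
  filter_upwards [h, eventually_ge_atTop (c + 5)] with e he hec
  have himage : congrSet S (bracket T (primeDiag p i)) (fun _ => e) =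
      φ '' congrSet S T (fun s => e - pairMult i s) := by
    have hiff : ∀ Y : Matrix ι κ ℤ_[p], φ Y ∈ congrSet S (bracket T (primeDiag p i)) (fun _ => e) ↔
        Y ∈ congrSet S T (fun s => e - pairMult i s) := by
      intro Y
      refine forall₂_congr fun a b => ?_
      change _ ∣ (bracket S (Y * primeDiag p i) - _) a b ↔ _
      rw [bracket_mul, ← bracket_sub, bracket_primeDiag]
      have := pairMult_le i s(a, b)
      rw [show (p : ℤ_[p]) ^ e = p ^ pairMult i s(a, b) * p ^ (e - pairMult i s(a, b)) by
        rw [← pow_add]; congr 1; omega]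
      exact mul_dvd_mul_iff_left (pow_ne_zero _ natCast_prime_ne_zero)
    ext X
    constructor
    · intro hX
      have hcol : X ∈ Set.range φ := by
        rw [hrange]
        -- The i-th diagonal entry of the scaled matrix is divisible by p², so S takes a value
        -- divisible by p² on the i-th column of X.
        refine hS2 _ ?_
        have h1 := (pow_dvd_pow (p : ℤ_[p]) (show 2 ≤ e by omega)).trans (hX i i)
        rw [Matrix.sub_apply, bracket_primeDiag, pairMult_mk, if_pos rfl] at h1
        have h2 := (dvd_sub_left (dvd_mul_right ((p : ℤ_[p]) ^ 2) (T i i))).1 h1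
        have h3 : bracket S X i i = (fun r => X r i) ⬝ᵥ S *ᵥ fun r => X r i := by
          rw [bracket, Matrix.mul_assoc, Matrix.mul_apply']
          rfl
        rwa [h3] at h2
      obtain ⟨Y, rfl⟩ := hcol
      exact ⟨Y, (hiff Y).1 hX, rfl⟩
    · rintro ⟨Y, hY, rfl⟩
      exact (hiff Y).2 hY
  have hcount := haar_congrSet_eq_prod_mul_mass hS hT (fun s => e - pairMult i s) e
    (fun _ => Nat.sub_le _ _) (fun D hD hDe => mass_add hp S hT hR hD (f := e - 2) (by omega)
      (by omega) fun a b => (pow_dvd_pow _ (by have := pairMult_le i s(a, b); omega)).trans (hDe a b))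
  have hprod : ∏ s : Sym2 κ, (p : ℝ) ^ (e - (e - pairMult i s)) =
      (p : ℝ) ^ (Fintype.card κ + 1) := by
    rw [Finset.prod_pow_eq_pow_sum, ← sum_pairMult i]
    congr 1
    refine Finset.sum_congr rfl fun s _ => ?_
    have := pairMult_le i s
    omega
  rw [mass, himage, haar_image_endomorphism φ hφ hinj, hrange, haar_column_dvd, hcount, hprod, ← he]
  ring

/-- Modulo p the matrix g kills a non-zero vector. Lifting it and using it as the i-th column of k
makes the i-th column of gk divisible by p, so one factor p splits off from g. -/
theorem exists_updateCol_mul_eq {g : Matrix κ κ ℤ_[p]} (hg : (p : ℤ_[p]) ∣ g.det) :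
    ∃ (k g' : Matrix κ κ ℤ_[p]) (i : κ), k.det = 1 ∧ g * k = g' * primeDiag p i := by
  have h0 : ((PadicInt.toZMod (p := p)).mapMatrix g).det = 0 := by
    rw [← RingHom.map_det]
    exact (dvd_iff_toZMod _).1 hg
  obtain ⟨w, hw, hgw⟩ := Matrix.exists_mulVec_eq_zero_iff.2 h0
  obtain ⟨i, hi⟩ := Function.ne_iff.1 hw
  -- The kernel vector is normalised to have i-th coordinate 1, which makes the column-updated
  -- identity unimodular.
  let W : κ → ℤ_[p] := fun j => if j = i then 1 else (((w i)⁻¹ * w j).val : ℤ_[p])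
  have hWw : ∀ j, PadicInt.toZMod (W j) = (w i)⁻¹ * w j := by
    intro j
    simp only [W]
    split_ifs with hj
    · subst hj
      rw [inv_mul_cancel₀ hi, map_one]
    · simp
  have hcol : ∀ r, (p : ℤ_[p]) ∣ (g *ᵥ W) r := by
    intro r
    rw [dvd_iff_toZMod]
    have := congrFun hgw r
    simp only [mulVec, dotProduct, map_sum, map_mul, hWw, RingHom.mapMatrix_apply, map_apply,
      Pi.zero_apply] at this ⊢
    rw [← mul_zero (w i)⁻¹, ← this, Finset.mul_sum]
    exact Finset.sum_congr rfl fun j _ => by ring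
  choose y hy using hcol
  refine ⟨updateCol 1 i W, of fun r j => if j = i then y r else g r j, i, ?_, ?_⟩
  · rw [← cramer_apply, cramer_one]
    simp [W]
  · ext r j : 1
    simp only [primeDiag, mul_diagonal, of_apply]
    by_cases hj : j = i
    · subst hj
      simp only [if_true]
      rw [mul_comm, ← hy, Matrix.mul_apply, mulVec, dotProduct]
      simp
    · simp [hj, Matrix.mul_apply, Matrix.one_apply]

/-- The effect on densities of an integral change of variables. -/
theorem HasMassDensity.change_of_variables (hp : p ≠ 2) {S : Matrix ι ι ℤ_[p]} (hS : S.IsSymm)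
    (hS2 : ∀ x : ι → ℤ_[p], (p : ℤ_[p]) ^ 2 ∣ x ⬝ᵥ S *ᵥ x → ∀ r, (p : ℤ_[p]) ∣ x r)
    {T : Matrix κ κ ℤ_[p]} (hT : T.IsSymm) (hd : T.det ≠ 0) {α : ℝ} (h : HasMassDensity S T α)
    {v : ℕ} {u : ℤ_[p]} (hu : IsUnit u) {g : Matrix κ κ ℤ_[p]}
    (hg : g.det = (p : ℤ_[p]) ^ v * u) :
    HasMassDensity S (bracket T g)
      (((p : ℝ) ^ (Fintype.card κ + 1) / (p : ℝ) ^ Fintype.card ι) ^ v * α) := by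
  have hinv : ∀ {T' g g' : Matrix κ κ ℤ_[p]} {β : ℝ}, g * g' = 1 → HasMassDensity S T' β →
      HasMassDensity S (bracket T' g) β := by
    intro T' g g' β hgg hT'
    filter_upwards [hT'] with e he
    rw [mass_bracket S T' e hgg, he]
  -- Induction on the valuation of det g: unimodular factors leave the density alone, and each
  -- factor `primeDiag` costs p^(n+1) / p^m, where m is the degree of S.
  induction v generalizing g with
  | zero =>
    obtain ⟨g', hgg'⟩ := exists_mul_eq_one_of_isUnit_det (g := g) (by rw [hg]; simpa using hu)
    simpa using hinv hgg' h
  | succ v ih =>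
    obtain ⟨k, g', i, hk, hgk⟩ := exists_updateCol_mul_eq (g := g)
      (by rw [hg, pow_succ', mul_assoc]; exact dvd_mul_right _ _)
    have hdet := congrArg Matrix.det hgk
    rw [det_mul, det_mul, hk, det_primeDiag, mul_one, hg, pow_succ, mul_right_comm] at hdet
    have hg' := mul_right_cancel₀ natCast_prime_ne_zero hdet
    have h1 := (ih hg'.symm).scale_column hp hS hS2 (bracket_isSymm hT g') (by
      rw [bracket, det_mul, det_mul, det_transpose, ← hg']
      have : (p : ℤ_[p]) ^ v * u ≠ 0 := mul_ne_zero (pow_ne_zero _ natCast_prime_ne_zero) hu.ne_zero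
      exact mul_ne_zero (mul_ne_zero this hd) this) i
    obtain ⟨k', hkk'⟩ := exists_mul_eq_one_of_isUnit_det (g := k) (by rw [hk]; exact isUnit_one)
    have h2 := hinv (mul_eq_one_comm.1 hkk') h1
    rw [← bracket_mul, ← bracket_mul, ← Matrix.mul_assoc, ← hgk, Matrix.mul_assoc, hkk',
      Matrix.mul_one] at h2
    rw [pow_succ', mul_assoc]
    exact h2

end Scaling

/-! ### From volumes to local densities -/

section Density

variable {p : ℕ} [Fact p.Prime] {ι κ : Type*}

/-- The matrix over `ℚ_p` with the entries of a matrix over `ℤ_p`. -/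
abbrev toPadic (T : Matrix ι κ ℤ_[p]) : Matrix ι κ ℚ_[p] := T.map fun a => (a : ℚ_[p])

theorem toPadic_injective : Function.Injective (toPadic : Matrix ι κ ℤ_[p] → Matrix ι κ ℚ_[p]) :=
  Matrix.map_injective Subtype.coe_injective

theorem toPadic_mul {τ : Type*} [Fintype κ] (A : Matrix ι κ ℤ_[p]) (B : Matrix κ τ ℤ_[p]) :
    toPadic (A * B) = toPadic A * toPadic B :=
  Matrix.map_mul (f := PadicInt.Coe.ringHom)

theorem toPadic_bracket [Fintype ι] (S : Matrix ι ι ℤ_[p]) (X : Matrix ι κ ℤ_[p]) :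
    toPadic (bracket S X) = bracket (toPadic S) (toPadic X) := by
  simp only [bracket, toPadic_mul]
  rfl

theorem det_toPadic [Fintype κ] [DecidableEq κ] (T : Matrix κ κ ℤ_[p]) :
    (toPadic T).det = (T.det : ℚ_[p]) :=
  (RingHom.map_det PadicInt.Coe.ringHom T).symm

theorem exists_div_two (hp : p ≠ 2) (r : ℤ_[p]) : ∃ s : ℤ_[p], (r : ℚ_[p]) / 2 = s := by
  obtain ⟨t, ht⟩ := (isUnit_two hp).exists_right_inv
  refine ⟨r * t, ?_⟩
  have h : (2 : ℚ_[p]) * t = 1 := by exact_mod_cast congrArg (fun z : ℤ_[p] => (z : ℚ_[p])) ht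
  rw [PadicInt.coe_mul, div_eq_iff two_ne_zero, mul_assoc, mul_comm (t : ℚ_[p]), h, mul_one]

/-- For odd `p` the half-integral matrices are the symmetric matrices over `ℤ_p`. -/
theorem isHalfIntegral_iff (hp : p ≠ 2) (A : Matrix κ κ ℚ_[p]) :
    IsHalfIntegral A ↔ ∃ B : Matrix κ κ ℤ_[p], B.IsSymm ∧ A = toPadic B := by
  constructor
  · rintro ⟨hs, hd, ho⟩
    have : ∀ i j, ∃ r : ℤ_[p], A i j = r := by
      intro i j
      by_cases h : i = j
      · subst h; exact hd i
      · obtain ⟨r, hr⟩ := ho i j h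
        obtain ⟨s, hs⟩ := exists_div_two hp r
        exact ⟨s, hr.trans hs⟩
    choose B hB using this
    have hAB : A = toPadic (of B) := by ext i j : 1; exact hB i j
    refine ⟨of B, ?_, hAB⟩
    refine toPadic_injective ?_
    rw [← hAB, ← hs.eq, hAB]
    rfl
  · rintro ⟨B, hB, rfl⟩
    refine ⟨?_, fun i => ⟨B i i, rfl⟩, fun i j _ => ⟨B i j + B i j, ?_⟩⟩
    · rw [Matrix.IsSymm, toPadic, ← transpose_map, hB.eq]
    · rw [PadicInt.coe_add]
      exact (add_self_div_two _).symm

theorem congrHalfIntegral_iff (hp : p ≠ 2) (e : ℕ) {A B : Matrix κ κ ℤ_[p]} (hA : A.IsSymm)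
    (hB : B.IsSymm) : CongrHalfIntegral e (toPadic A) (toPadic B) ↔
      ∀ i j, (p : ℤ_[p]) ^ e ∣ (A - B) i j := by
  rw [forall_dvd_iff_exists_smul]
  have hsub : toPadic A - toPadic B = toPadic (A - B) := by ext; simp [toPadic]
  have hsmul : ∀ C : Matrix κ κ ℤ_[p],
      (p : ℚ_[p]) ^ e • toPadic C = toPadic ((p : ℤ_[p]) ^ e • C) := by
    intro C; ext; simp [toPadic]
  constructor
  · rintro ⟨H, hH, h⟩
    obtain ⟨C, -, rfl⟩ := (isHalfIntegral_iff hp H).1 hH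
    refine ⟨C, toPadic_injective ?_⟩
    rw [← hsub, h, hsmul]
  · rintro ⟨C, hC⟩
    refine ⟨toPadic C, (isHalfIntegral_iff hp _).2 ⟨C, ?_, rfl⟩, by rw [hsub, hsmul, hC]⟩
    ext i j : 1
    have := (hA.sub hB).apply i j
    rw [hC] at this
    exact mul_left_cancel₀ (pow_ne_zero e natCast_prime_ne_zero) this

theorem mem_levelSubmodule (e : ℕ) (X : Matrix ι κ ℤ_[p]) :
    X ∈ levelSubmodule p ι κ e ↔ ∀ i j, (p : ℤ_[p]) ^ e ∣ X i j := by
  rw [forall_dvd_iff_exists_smul]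
  simp [levelSubmodule, eq_comm]

/-- Whether X is a solution depends only on X modulo p^e. The solution set is thus the preimage of a
set of matrices over ℤ/p^e, and its volume is the proportion of classes in that set. -/
theorem ncard_solutionSet (hp : p ≠ 2) [Fintype ι] [Fintype κ] {S : Matrix ι ι ℤ_[p]}
    (hS : S.IsSymm) {T : Matrix κ κ ℤ_[p]} (hT : T.IsSymm) (e : ℕ) :
    ((solutionSet (toPadic S) (toPadic T) e).ncard : ℝ) =
      (p : ℝ) ^ (e * (Fintype.card ι * Fintype.card κ)) * mass S T e := by
  have hsol : ∀ X : Matrix ι κ ℤ_[p], X ∈ congrSet S T (fun _ => e) ↔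
      CongrHalfIntegral e (bracket (toPadic S) (X.map fun a => (a : ℚ_[p]))) (toPadic T) := by
    intro X
    rw [← toPadic_bracket, congrHalfIntegral_iff hp e (bracket_isSymm hS X) hT]
    rfl
  have hsat : ∀ X Y : Matrix ι κ ℤ_[p], reduction p ι κ e X = reduction p ι κ e Y →
      X ∈ congrSet S T (fun _ => e) → Y ∈ congrSet S T (fun _ => e) := by
    intro X Y hXY hX i j
    rw [reduction_eq_iff, forall_dvd_iff_exists_smul] at hXY
    obtain ⟨Z, hZ⟩ := hXY
    rw [sub_eq_iff_eq_add'] at hZ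
    rw [← dvd_add_right (b := (bracket S X - bracket S Y) i j) (c := (bracket S Y - T) i j)]
    · simpa using hX i j
    · have : bracket S X - bracket S Y = (p : ℤ_[p]) ^ e • (Zᵀ * S * Y + Yᵀ * S * Z +
          (p : ℤ_[p]) ^ e • (Zᵀ * S * Z)) := by
        rw [hZ]
        simp only [bracket, transpose_add, transpose_smul, Matrix.add_mul, Matrix.mul_add,
          Matrix.smul_mul, Matrix.mul_smul, smul_add]
        abel
      rw [this]
      exact ⟨_, rfl⟩
  let θ : (Matrix ι κ ℤ_[p] ⧸ levelSubmodule p ι κ e) → Matrix ι κ (ZMod (p ^ e)) :=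
    fun x => reduction p ι κ e (Submodule.mkQ_surjective _ x).choose
  have hθ : ∀ X, θ ((levelSubmodule p ι κ e).mkQ X) = reduction p ι κ e X := by
    intro X
    have h := (Submodule.mkQ_surjective _ ((levelSubmodule p ι κ e).mkQ X)).choose_spec
    rw [reduction_eq_iff]
    rw [← mem_levelSubmodule]
    exact (Submodule.Quotient.eq _).1 h
  have hinj : Function.Injective θ := by
    intro x y hxy
    obtain ⟨X, rfl⟩ := Submodule.mkQ_surjective _ x
    obtain ⟨Y, rfl⟩ := Submodule.mkQ_surjective _ y
    rw [hθ, hθ, reduction_eq_iff, ← mem_levelSubmodule] at hxy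
    exact (Submodule.Quotient.eq _).2 hxy
  have himage : congrSet S T (fun _ => e) =
      reduction p ι κ e ⁻¹' (θ '' solutionSet (toPadic S) (toPadic T) e) := by
    ext Y
    constructor
    · intro hY
      exact ⟨_, ⟨Y, rfl, (hsol Y).1 hY⟩, hθ Y⟩
    · rintro ⟨_, ⟨X, rfl, hX⟩, hXY⟩
      rw [hθ] at hXY
      exact hsat X Y hXY ((hsol X).2 hX)
  have hp0 : (p : ℝ) ≠ 0 := by exact_mod_cast (Fact.out : p.Prime).ne_zero
  rw [mass, himage, haar_preimage_reduction, Set.ncard_image_of_injective _ hinj]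
  field_simp

theorem densitySeq_toPadic (hp : p ≠ 2) [Fintype ι] [Fintype κ] {S : Matrix ι ι ℤ_[p]}
    (hS : S.IsSymm) {T : Matrix κ κ ℤ_[p]} (hT : T.IsSymm) (e : ℕ) :
    densitySeq (toPadic S) (toPadic T) e =
      (if Fintype.card ι = Fintype.card κ then (2 : ℝ)⁻¹ else 1) *
        ((p : ℝ) ^ (e * Fintype.card (Sym2 κ)) * mass S T e) := by
  have hp0 : (p : ℝ) ≠ 0 := by exact_mod_cast (Fact.out : p.Prime).ne_zero
  -- The integer division is exact: n(n+1)/2 is the number of unordered pairs. The term -mn of the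
  -- exponent cancels against the number of classes.
  have hN : (Fintype.card κ : ℤ) * ((Fintype.card κ : ℤ) + 1) / 2 = Fintype.card (Sym2 κ) := by
    rw [Sym2.card, Nat.choose_two_right, Nat.add_sub_cancel, mul_comm (Fintype.card κ + 1)]
    push_cast
    rfl
  rw [densitySeq, ncard_solutionSet hp hS hT, hN, ← mul_assoc ((p : ℝ) ^ _) _ (mass S T e)]
  congr 2
  rw [← zpow_natCast, ← zpow_natCast, ← zpow_add₀ hp0]
  congr 1
  push_cast
  ring

theorem HasMassDensity.hasLocalDensity (hp : p ≠ 2) [Fintype ι] [Fintype κ] {S : Matrix ι ι ℤ_[p]}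
    (hS : S.IsSymm) {T : Matrix κ κ ℤ_[p]} (hT : T.IsSymm) {α : ℝ} (h : HasMassDensity S T α) :
    HasLocalDensity (toPadic S) (toPadic T)
      ((if Fintype.card ι = Fintype.card κ then (2 : ℝ)⁻¹ else 1) * α) := by
  refine tendsto_const_nhds.congr' ?_
  filter_upwards [h] with e he
  rw [densitySeq_toPadic hp hS hT, he]

theorem HasLocalDensity.localDensity_eq {q : ℕ} [Fact q.Prime] [Fintype ι] [Fintype κ]
    {S : Matrix ι ι ℚ_[q]} {T : Matrix κ κ ℚ_[q]} {a : ℝ} (h : HasLocalDensity S T a) :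
    localDensity S T = a :=
  Tendsto.limUnder_eq h

end Density

/-! ### Orthogonal vectors in an anisotropic plane over a finite field -/

section FiniteCount

variable {F : Type*} [Field F]

/-- The symmetric bilinear form `1 ⊥ e` on the plane. -/
def planeForm (e : F) (x y : Fin 2 → F) : F := x 0 * y 0 + e * (x 1 * y 1)

/-- Families of pairwise orthogonal vectors in the plane with prescribed values. -/
def orthogonalFrames {α : Type*} (e : F) (u : α → F) : Set (α → Fin 2 → F) :=
  {y | (∀ i, planeForm e (y i) (y i) = u i) ∧ ∀ i j, i ≠ j → planeForm e (y i) (y j) = 0}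

theorem ncard_orthogonalFrames_congr {α β : Type*} (e : F) (u : α → F) (σ : β ≃ α) :
    (orthogonalFrames e (u ∘ σ)).ncard = (orthogonalFrames e u).ncard := by
  have : orthogonalFrames e (u ∘ σ) = (σ.arrowCongr (Equiv.refl (Fin 2 → F))).symm ''
      orthogonalFrames e u := by
    ext y
    rw [Equiv.image_symm_eq_preimage, Set.mem_preimage]
    simp only [orthogonalFrames, Set.mem_ofPred_eq]
    refine and_congr ?_ ?_
    · rw [σ.forall_congr_left]; simp
    · rw [σ.forall_congr_left]
      refine forall_congr' fun i => ?_
      rw [σ.forall_congr_left]; simp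
  rw [this, Set.ncard_image_of_injective _ (Equiv.injective _)]

variable {e : F} (he : ∀ x : Fin 2 → F, planeForm e x x = 0 → x = 0)

include he

theorem not_isSquare_neg : ¬ IsSquare (-e) := by
  rintro ⟨s, hs⟩
  have h := he ![s, 1] (by simp [planeForm, ← hs])
  simpa using congrFun h 1

variable [Finite F]

theorem exists_planeForm_eq (h2 : ringChar F ≠ 2) (u : F) :
    ∃ y : Fin 2 → F, planeForm e y y = u := by
  classical
  have := Fintype.ofFinite F
  have he0 : e ≠ 0 := by
    rintro rfl
    have h := he ![0, 1] (by simp [planeForm])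
    simpa using congrFun h 1
  obtain ⟨a, b, hab⟩ := FiniteField.exists_root_sum_quadratic
    (f := Polynomial.C 1 * Polynomial.X ^ 2 + Polynomial.C 0 * Polynomial.X + Polynomial.C (-u))
    (g := Polynomial.C e * Polynomial.X ^ 2 + Polynomial.C 0 * Polynomial.X + Polynomial.C 0)
    (Polynomial.degree_quadratic one_ne_zero) (Polynomial.degree_quadratic he0)
    (FiniteField.odd_card_of_char_ne_two h2)
  refine ⟨![a, b], ?_⟩
  simp at hab
  simp only [planeForm, cons_val_zero, cons_val_one]
  linear_combination hab

/-- The form x² + ey² is the norm of x + y√(-e). Multiplication by an element of norm v/u maps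
vectors of value u injectively to vectors of value v. -/
theorem ncard_planeForm_le (h2 : ringChar F ≠ 2) {u v : F} (hu : u ≠ 0) (hv : v ≠ 0) :
    {y : Fin 2 → F | planeForm e y y = u}.ncard ≤ {y : Fin 2 → F | planeForm e y y = v}.ncard := by
  obtain ⟨w, hw⟩ := exists_planeForm_eq he h2 (v / u)
  have hwne : planeForm e w w ≠ 0 := by rw [hw]; exact div_ne_zero hv hu
  refine Set.ncard_le_ncard_of_injOn
    (fun y => ![y 0 * w 0 - e * (y 1 * w 1), y 0 * w 1 + y 1 * w 0]) ?_ ?_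
  · intro y hy
    simp only [Set.mem_ofPred_eq, planeForm, cons_val_zero, cons_val_one] at hy hw ⊢
    rw [show v = u * (v / u) by field_simp, ← hw, ← hy]
    ring
  · intro y _ z _ hyz
    have h0 := congrFun hyz 0
    have h1 := congrFun hyz 1
    simp only [cons_val_zero, cons_val_one, planeForm] at h0 h1 hwne
    ext i
    fin_cases i
    · refine mul_right_cancel₀ hwne ?_
      simp only [Fin.zero_eta]
      linear_combination w 0 * h0 + e * w 1 * h1
    · refine mul_right_cancel₀ hwne ?_
      simp only [Fin.mk_one]
      linear_combination w 0 * h1 - w 1 * h0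

/-- All non-zero values have equally many preimages, N say, and 0 has one; hence 1 + (q - 1)N = q²
for q = |F|. -/
theorem ncard_planeForm_eq (h2 : ringChar F ≠ 2) {u : F} (hu : u ≠ 0) :
    {y : Fin 2 → F | planeForm e y y = u}.ncard = Nat.card F + 1 := by
  classical
  have := Fintype.ofFinite F
  let N : F → ℕ := fun v => {y : Fin 2 → F | planeForm e y y = v}.ncard
  have hsum : ∑ v, N v = Nat.card F ^ 2 := by
    have h1 : ∀ v, N v = (Finset.univ.filter fun y : Fin 2 → F => planeForm e y y = v).card := by
      intro v
      rw [← Set.ncard_coe_finset]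
      simp [N]
    simp only [h1]
    rw [← Finset.card_eq_sum_card_fiberwise (f := fun y : Fin 2 → F => planeForm e y y)
      (s := Finset.univ) (t := Finset.univ) (fun _ _ => Finset.mem_coe.2 (Finset.mem_univ _))]
    simp [Nat.card_eq_fintype_card]
  have h0 : N 0 = 1 := by
    have : {y : Fin 2 → F | planeForm e y y = 0} = {0} := by
      ext y
      refine ⟨fun h => he y h, ?_⟩
      rintro rfl
      simp [planeForm]
    simp [N, this]
  have hne : ∀ v ∈ Finset.univ.erase (0 : F), N v = N u := by
    intro v hv
    exact le_antisymm (ncard_planeForm_le he h2 (Finset.ne_of_mem_erase hv) hu)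
      (ncard_planeForm_le he h2 hu (Finset.ne_of_mem_erase hv))
  rw [← Finset.add_sum_erase _ _ (Finset.mem_univ (0 : F)), h0, Finset.sum_congr rfl hne,
    Finset.sum_const, Finset.card_erase_of_mem (Finset.mem_univ _), Finset.card_univ,
    ← Nat.card_eq_fintype_card, smul_eq_mul] at hsum
  have hq : 1 < Nat.card F := Finite.one_lt_card
  change N u = _
  obtain ⟨m, hm⟩ : ∃ m, Nat.card F = m + 2 := ⟨Nat.card F - 2, by omega⟩
  rw [hm] at hsum ⊢
  have : (m + 1) * N u = (m + 1) * (m + 2 + 1) := by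
    simp only [Nat.add_succ_sub_one] at hsum
    nlinarith
  exact Nat.eq_of_mul_eq_mul_left (Nat.succ_pos m) this

theorem ncard_orthogonalFrames_one (h2 : ringChar F ≠ 2) {u : Fin 1 → F} (hu : ∀ i, u i ≠ 0) :
    (orthogonalFrames e u).ncard = Nat.card F + 1 := by
  rw [← ncard_planeForm_eq he h2 (hu 0)]
  have : orthogonalFrames e u = (Equiv.funUnique (Fin 1) (Fin 2 → F)).symm ''
      {y : Fin 2 → F | planeForm e y y = u 0} := by
    ext y
    rw [Equiv.image_symm_eq_preimage, Set.mem_preimage]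
    simp only [orthogonalFrames, Set.mem_ofPred_eq]
    constructor
    · rintro ⟨h, -⟩; exact h 0
    · intro h
      refine ⟨fun i => ?_, fun i j hij => absurd (Subsingleton.elim i j) hij⟩
      rw [Subsingleton.elim i 0]; exact h
  rw [this, Set.ncard_image_of_injective _ (Equiv.injective _)]

/-- The orthogonal complement of the first vector x is spanned by (-e x₁, x₀), of value e u₀. The
second vector is m times this one with m² e u₀ = u₁. Since -e and -u₀u₁ are both non-squares, e u₀
u₁ is a square, and there are exactly two such m. -/
theorem ncard_orthogonalFrames_two (h2 : ringChar F ≠ 2) {u : Fin 2 → F} (hu : ∀ i, u i ≠ 0)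
    (hns : ¬ IsSquare (-(u 0 * u 1))) :
    (orthogonalFrames e u).ncard = 2 * (Nat.card F + 1) := by
  classical
  have := Fintype.ofFinite F
  have hen := not_isSquare_neg he
  have he0 : e ≠ 0 := by rintro rfl; exact hen (by simp)
  have hu0 := hu 0
  have hu1 := hu 1
  have hsq : IsSquare (e * u 0 * u 1) := by
    have h1 := quadraticChar_neg_one_iff_not_isSquare.2 hen
    have h3 := quadraticChar_neg_one_iff_not_isSquare.2 hns
    have h4 : quadraticChar F (e * u 0 * u 1) = 1 := by
      rw [show e * u 0 * u 1 = (-e) * (-(u 0 * u 1)) by ring, map_mul, h1, h3]; rfl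
    exact (quadraticChar_one_iff_isSquare (mul_ne_zero (mul_ne_zero he0 hu0) hu1)).1 h4
  obtain ⟨s, hs⟩ := hsq
  let l : F := s / (e * u 0)
  have hl : l ^ 2 * (e * u 0) = u 1 := by
    simp only [l]
    field_simp
    linear_combination -hs
  have hl0 : l ≠ 0 := by
    intro h
    rw [h] at hl
    apply hu1
    rw [← hl]; ring
  have hll : l ≠ -l := by
    intro h
    have : (2 : F) * l = 0 := by linear_combination h
    rcases mul_eq_zero.1 this with h | h
    · exact Ring.two_ne_zero h2 h
    · exact hl0 h
  let f : (Fin 2 → F) × F → Fin 2 → Fin 2 → F :=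
    fun z => ![z.1, ![-(z.2 * (e * z.1 1)), z.2 * z.1 0]]
  have himage : orthogonalFrames e u =
      f '' ({y : Fin 2 → F | planeForm e y y = u 0} ×ˢ ({l, -l} : Set F)) := by
    ext y
    simp only [orthogonalFrames, Set.mem_ofPred_eq, Set.mem_image, Set.mem_prod, Prod.exists]
    constructor
    · rintro ⟨h, h'⟩
      have h0 := h 0
      have h1 := h 1
      have h01 := h' 0 1 (by decide)
      simp only [planeForm] at h0 h1 h01
      -- The coefficient along (-e x₁, x₀), obtained from the determinant of the two vectors.
      let m : F := (y 0 0 * y 1 1 - y 0 1 * y 1 0) / u 0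
      have hm0 : -(m * (e * y 0 1)) = y 1 0 := by
        simp only [m]
        field_simp
        linear_combination y 1 0 * h0 - y 0 0 * h01
      have hm1 : m * y 0 0 = y 1 1 := by
        simp only [m]
        field_simp
        linear_combination y 1 1 * h0 - y 0 1 * h01
      refine ⟨y 0, m, ⟨h0, ?_⟩, ?_⟩
      · have hm : m ^ 2 * (e * u 0) = u 1 := by
          rw [← h1, ← hm0, ← hm1, ← h0]; ring
        have : m ^ 2 = l ^ 2 := mul_right_cancel₀ (mul_ne_zero he0 hu0) (hm.trans hl.symm)
        exact sq_eq_sq_iff_eq_or_eq_neg.1 this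
      · ext i j
        fin_cases i
        · rfl
        · fin_cases j
          · exact hm0
          · exact hm1
    · rintro ⟨x, m, ⟨hx, hm⟩, rfl⟩
      have hm2 : m ^ 2 = l ^ 2 := sq_eq_sq_iff_eq_or_eq_neg.2 hm
      have horth : planeForm e (f (x, m) 0) (f (x, m) 1) = 0 := by
        simp [f, planeForm]; ring
      have horth' : planeForm e (f (x, m) 1) (f (x, m) 0) = 0 := by
        simp [f, planeForm]; ring
      refine ⟨fun i => ?_, fun i j hij => ?_⟩
      · fin_cases i
        · exact hx
        · simp only [planeForm] at hx
          simp only [f, planeForm, Fin.mk_one, cons_val_zero, cons_val_one]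
          linear_combination m ^ 2 * e * hx + (e * u 0) * hm2 + hl
      · fin_cases i <;> fin_cases j
        · exact absurd rfl hij
        · exact horth
        · exact horth'
        · exact absurd rfl hij
  have hinj : Set.InjOn f ({y : Fin 2 → F | planeForm e y y = u 0} ×ˢ ({l, -l} : Set F)) := by
    rintro ⟨x, m⟩ ⟨hx, -⟩ ⟨x', m'⟩ - h
    have h0 : x = x' := congrFun h 0
    subst h0
    have h1 := congrFun (congrFun h 1) 0
    have h3 := congrFun (congrFun h 1) 1
    simp only [f, cons_val_zero, cons_val_one] at h1 h3
    simp only [Set.mem_ofPred_eq, planeForm] at hx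
    have : m = m' := by
      refine mul_right_cancel₀ hu0 ?_
      rw [← hx]
      linear_combination x 0 * h3 - x 1 * h1
    rw [this]
  rw [himage, Set.InjOn.ncard_image hinj, Set.ncard_prod, Set.ncard_pair hll,
    ncard_planeForm_eq he h2 hu0, mul_comm]

end FiniteCount

/-! ### Densities of diagonal matrices with entries of valuation at most one -/

section UnitDiagonal

variable {p : ℕ} [Fact p.Prime] {κ : Type*}

/-- The form `1 ⊥ ε ⊥ p ⊥ pε` over `ℤ_p`. -/
def quaternionForm (ε : ℤ_[p]) : Matrix (Fin 2 ⊕ Fin 2) (Fin 2 ⊕ Fin 2) ℤ_[p] :=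
  diagonal (Sum.elim ![1, ε] ![(p : ℤ_[p]), p * ε])

theorem quaternionForm_isSymm (ε : ℤ_[p]) : (quaternionForm ε).IsSymm := by
  simp [quaternionForm, Matrix.IsSymm]

theorem toPadic_quaternionForm (ε : ℤ_[p]) : toPadic (quaternionForm ε) = U0perp ε := by
  ext i j
  rcases i with i | i <;> rcases j with j | j <;> fin_cases i <;> fin_cases j <;>
    simp [quaternionForm, U0perp, U0, orthSum]

theorem bracket_quaternionForm (ε : ℤ_[p]) (X : Matrix (Fin 2 ⊕ Fin 2) κ ℤ_[p]) (i j : κ) :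
    bracket (quaternionForm ε) X i j =
      (X (.inl 0) i * X (.inl 0) j + ε * (X (.inl 1) i * X (.inl 1) j)) +
      p * (X (.inr 0) i * X (.inr 0) j + ε * (X (.inr 1) i * X (.inr 1) j)) := by
  rw [bracket, Matrix.mul_assoc, Matrix.mul_apply]
  simp [quaternionForm, Fintype.sum_sum_type, Fin.sum_univ_two]
  ring

variable {ε : ℤ_[p]}
  (hε : ∀ x : Fin 2 → ZMod p, planeForm (PadicInt.toZMod ε) x x = 0 → x = 0)

include hε

theorem dvd_of_dvd_plane {a b : ℤ_[p]} (h : (p : ℤ_[p]) ∣ a * a + ε * (b * b)) :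
    (p : ℤ_[p]) ∣ a ∧ (p : ℤ_[p]) ∣ b := by
  rw [dvd_iff_toZMod, map_add, map_mul, map_mul, map_mul] at h
  have := hε ![PadicInt.toZMod a, PadicInt.toZMod b] (by simpa [planeForm] using h)
  exact ⟨(dvd_iff_toZMod _).2 (by simpa using congrFun this 0),
    (dvd_iff_toZMod _).2 (by simpa using congrFun this 1)⟩

/-- Anisotropy modulo p is used twice. First it makes the coordinates in 1 ⊥ ε divisible by p, so
that their contribution is divisible by p²; then, after division by p, it applies to the second
plane. -/
theorem dvd_of_sq_dvd_quaternionForm (x : Fin 2 ⊕ Fin 2 → ℤ_[p])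
    (h : (p : ℤ_[p]) ^ 2 ∣ x ⬝ᵥ quaternionForm ε *ᵥ x) : ∀ r, (p : ℤ_[p]) ∣ x r := by
  have hval : x ⬝ᵥ quaternionForm ε *ᵥ x =
      (x (.inl 0) * x (.inl 0) + ε * (x (.inl 1) * x (.inl 1))) +
      p * (x (.inr 0) * x (.inr 0) + ε * (x (.inr 1) * x (.inr 1))) := by
    have := bracket_quaternionForm ε (of fun r (_ : Unit) => x r) () ()
    rw [bracket, Matrix.mul_assoc, Matrix.mul_apply'] at this
    exact this
  rw [hval] at h
  have h1 : (p : ℤ_[p]) ∣ x (.inl 0) * x (.inl 0) + ε * (x (.inl 1) * x (.inl 1)) :=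
    (dvd_add_left (dvd_mul_right _ _)).1 ((dvd_pow_self _ two_ne_zero).trans h)
  obtain ⟨ha, hb⟩ := dvd_of_dvd_plane hε h1
  have h2 : (p : ℤ_[p]) ^ 2 ∣ x (.inl 0) * x (.inl 0) + ε * (x (.inl 1) * x (.inl 1)) := by
    rw [sq]
    exact dvd_add (mul_dvd_mul ha ha) ((mul_dvd_mul hb hb).mul_left _)
  have h3 := (dvd_add_right h2).1 h
  rw [sq, mul_dvd_mul_iff_left natCast_prime_ne_zero] at h3
  obtain ⟨hc, hd⟩ := dvd_of_dvd_plane hε h3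
  rintro (r | r) <;> fin_cases r <;> assumption

omit hε

/-- The precision on the set of pairs: two if both members are marked and one otherwise. -/
def pairPrecision (b : κ → Bool) : Sym2 κ → ℕ :=
  Sym2.lift ⟨fun i j => if b i && b j then 2 else 1, fun i j => by
    simp only [Bool.and_comm (b i)]⟩

theorem pairPrecision_mk (b : κ → Bool) (i j : κ) :
    pairPrecision b s(i, j) = if b i && b j then 2 else 1 := rfl

/-- The deficit to precision two is one, except on pairs of marked places, of which there are
r(r+1)/2 for r marked places. -/
theorem sum_pairPrecision [Fintype κ] [DecidableEq κ] (b : κ → Bool) :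
    ∑ s, (2 - pairPrecision b s) + Nat.choose ((Finset.univ.filter fun j => b j = true).card + 1) 2 =
      Fintype.card (Sym2 κ) := by
  have hcard : ∀ A : Finset (Sym2 κ), A.card = ∑ s, if s ∈ A then 1 else 0 := by
    intro A
    rw [← Finset.card_filter]; simp
  rw [← Finset.card_sym2, ← Finset.card_univ, Finset.card_eq_sum_ones Finset.univ, hcard,
    ← Finset.sum_add_distrib]
  refine Finset.sum_congr rfl fun s _ => ?_
  induction s with | _ i j
  rw [pairPrecision_mk]
  simp only [Finset.mk_mem_sym2_iff, Finset.mem_filter, Finset.mem_univ, true_and, Bool.and_eq_true]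
  split_ifs <;> rfl

/-- The diagonal matrix with entries `u_j` at unmarked and `p u_j` at marked places. -/
def modularDiag (b : κ → Bool) [DecidableEq κ] (u : κ → ℤ_[p]) : Matrix κ κ ℤ_[p] :=
  diagonal fun j => if b j then (p : ℤ_[p]) * u j else u j

variable [DecidableEq κ]

theorem modularDiag_isSymm (b : κ → Bool) (u : κ → ℤ_[p]) : (modularDiag b u).IsSymm := by
  simp [modularDiag, Matrix.IsSymm]

variable [Fintype κ]

/-- A Newton step adapted to the block structure: the general bound of `mass_add` does not cover
perturbations divisible only by p when entries of valuation one occur. -/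
theorem mass_modularDiag_add (hp : p ≠ 2) (b : κ → Bool) {u : κ → ℤ_[p]} (hu : ∀ j, IsUnit (u j))
    (S : Matrix (Fin 2 ⊕ Fin 2) (Fin 2 ⊕ Fin 2) ℤ_[p]) {D : Matrix κ κ ℤ_[p]} (hD : D.IsSymm)
    (hDk : ∀ i j, (p : ℤ_[p]) ^ pairPrecision b s(i, j) ∣ D i j) :
    mass S (modularDiag b u + D) 2 = mass S (modularDiag b u) 2 := by
  obtain ⟨t, ht⟩ := (isUnit_two hp).exists_right_inv
  choose w hw using fun j => (hu j).exists_right_inv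
  have hD1 : ∀ i j, (p : ℤ_[p]) ∣ D i j := by
    intro i j
    refine dvd_trans (dvd_pow_self _ ?_) (hDk i j)
    rw [pairPrecision_mk]; split_ifs <;> simp
  obtain ⟨D, rfl⟩ := (forall_dvd_iff_exists_smul _ D).1 hD1
  have hDsymm : ∀ i j, D i j = D j i := by
    intro i j
    have := hD.apply j i
    simp only [Matrix.smul_apply, smul_eq_mul] at this
    exact mul_left_cancel₀ natCast_prime_ne_zero this
  -- Marked rows vanish, because the marked block of the perturbation is already 0 modulo p². A
  -- mixed entry is corrected from its unmarked row alone; an unmarked pair shares the correction,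
  -- hence the factor t = 1/2.
  let K : Matrix κ κ ℤ_[p] := of fun i j =>
    if b i then 0 else if b j then w i * D i j else t * w i * D i j
  obtain ⟨h, hgh⟩ := exists_mul_eq_one_of_isUnit_det (isUnit_det_one_add K)
  rw [← mass_bracket S (modularDiag b u) 2 hgh]
  refine mass_congr S fun i j => ?_
  have key : bracket (modularDiag b u) (1 + (p : ℤ_[p]) • K) =
      modularDiag b u + (p : ℤ_[p]) • (Kᵀ * modularDiag b u + modularDiag b u * K) +
        (p : ℤ_[p]) ^ 2 • (Kᵀ * modularDiag b u * K) := by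
    simp only [bracket, Matrix.transpose_add, Matrix.transpose_one, Matrix.transpose_smul,
      Matrix.add_mul, Matrix.mul_add, Matrix.one_mul, Matrix.mul_one, Matrix.smul_mul,
      Matrix.mul_smul, smul_add, sq, ← smul_smul]
    abel
  have hlin : (modularDiag b u + (p : ℤ_[p]) • D - bracket (modularDiag b u)
      (1 + (p : ℤ_[p]) • K) : Matrix κ κ ℤ_[p]) i j = p * (D i j - (K j i * modularDiag b u j j +
        modularDiag b u i i * K i j)) - p ^ 2 * (Kᵀ * modularDiag b u * K) i j := by
    rw [key]
    simp only [modularDiag, Matrix.sub_apply, Matrix.add_apply, Matrix.smul_apply, smul_eq_mul,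
      mul_diagonal, diagonal_mul, transpose_apply, diagonal_apply_eq]
    ring
  rw [hlin]
  refine dvd_sub ?_ (dvd_mul_right _ _)
  have hDk' := hDk i j
  rw [pairPrecision_mk] at hDk'
  by_cases hi : b i <;> by_cases hj : b j
  · simp only [hi, hj, Bool.and_true, if_true, Matrix.smul_apply, smul_eq_mul] at hDk'
    simpa [K, hi, hj] using hDk'
  · have : D i j - (K j i * modularDiag b u j j + modularDiag b u i i * K i j) = 0 := by
      simp only [K, modularDiag, of_apply, diagonal_apply_eq, hi, hj, if_true, if_false,
        Bool.false_eq_true, hDsymm i j]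
      linear_combination -D j i * hw j
    rw [this]; simp
  · have : D i j - (K j i * modularDiag b u j j + modularDiag b u i i * K i j) = 0 := by
      simp only [K, modularDiag, of_apply, diagonal_apply_eq, hi, hj, if_true, if_false,
        Bool.false_eq_true]
      linear_combination -D i j * hw i
    rw [this]; simp
  · have : D i j - (K j i * modularDiag b u j j + modularDiag b u i i * K i j) = 0 := by
      simp only [K, modularDiag, of_apply, diagonal_apply_eq, hi, hj, if_false,
        Bool.false_eq_true, hDsymm j i]
      linear_combination -t * D i j * hw i - t * D i j * hw j - D i j * ht
    rw [this]; simp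

include hε

-- At this precision only X modulo p matters. Anisotropy forces the first-plane part of a marked
-- column to be divisible by p, which settles the mixed pairs and leaves, after division by p, a
-- condition in the second plane. The second-plane part of an unmarked column is free.
omit [Fintype κ] in
theorem mem_congrSet_modularDiag_iff (b : κ → Bool) (u : κ → ℤ_[p])
    (X : Matrix (Fin 2 ⊕ Fin 2) κ ℤ_[p]) :
    X ∈ congrSet (quaternionForm ε) (modularDiag b u) (pairPrecision b) ↔
      (fun (j : {j // b j = false}) r => PadicInt.toZMod (X (.inl r) j)) ∈
          orthogonalFrames (PadicInt.toZMod ε)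
            (fun j : {j // b j = false} => PadicInt.toZMod (u j)) ∧
        (∀ j, b j = true → ∀ r, (p : ℤ_[p]) ∣ X (.inl r) j) ∧
        (fun (j : {j // b j = true}) r => PadicInt.toZMod (X (.inr r) j)) ∈
          orthogonalFrames (PadicInt.toZMod ε)
            (fun j : {j // b j = true} => PadicInt.toZMod (u j)) := by
  set T := modularDiag b u with hT
  have hTd : ∀ i, T i i = if b i then (p : ℤ_[p]) * u i else u i := fun i => by
    simp [hT, modularDiag]
  have hTo : ∀ i j, i ≠ j → T i j = 0 := fun i j hij => by simp [hT, modularDiag, hij]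
  have hplane : ∀ a a' c c' z : ℤ_[p], (p : ℤ_[p]) ∣ a * a' + ε * (c * c') - z ↔
      planeForm (PadicInt.toZMod ε) ![PadicInt.toZMod a, PadicInt.toZMod c]
        ![PadicInt.toZMod a', PadicInt.toZMod c'] = PadicInt.toZMod z := by
    intro a a' c c' z
    rw [dvd_iff_toZMod, map_sub, sub_eq_zero]
    simp [planeForm]
  constructor
  · intro hX
    have hX' : ∀ i j, (p : ℤ_[p]) ^ (if b i && b j then 2 else 1) ∣
        (X (.inl 0) i * X (.inl 0) j + ε * (X (.inl 1) i * X (.inl 1) j)) +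
        p * (X (.inr 0) i * X (.inr 0) j + ε * (X (.inr 1) i * X (.inr 1) j)) - T i j := by
      intro i j
      have := hX i j
      rwa [Matrix.sub_apply, bracket_quaternionForm, pairPrecision_mk] at this
    have hunm : ∀ i j, (b i && b j) = false → (p : ℤ_[p]) ∣
        X (.inl 0) i * X (.inl 0) j + ε * (X (.inl 1) i * X (.inl 1) j) - T i j := by
      intro i j hij
      have := hX' i j
      rw [hij] at this
      simp only [Bool.false_eq_true, if_false, pow_one] at this
      rw [add_sub_right_comm] at this
      exact (dvd_add_left (dvd_mul_right _ _)).1 this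
    have hcol : ∀ j, b j = true → (p : ℤ_[p]) ∣ X (.inl 0) j ∧ (p : ℤ_[p]) ∣ X (.inl 1) j := by
      intro j hj
      apply dvd_of_dvd_plane hε
      have := hX' j j
      rw [hTd, hj] at this
      simp only [Bool.and_self, if_true] at this
      have := (dvd_pow_self _ two_ne_zero).trans this
      rw [add_sub_assoc, ← mul_sub] at this
      exact (dvd_add_left (dvd_mul_right _ _)).1 this
    have hmark : ∀ i j, b i = true → b j = true → ∀ z, T i j = p * z → (p : ℤ_[p]) ∣
        X (.inr 0) i * X (.inr 0) j + ε * (X (.inr 1) i * X (.inr 1) j) - z := by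
      intro i j hi hj z hz
      have := hX' i j
      rw [hi, hj, hz] at this
      simp only [Bool.and_self, if_true] at this
      rw [add_sub_assoc, ← mul_sub] at this
      have h2 : (p : ℤ_[p]) ^ 2 ∣ X (.inl 0) i * X (.inl 0) j + ε * (X (.inl 1) i * X (.inl 1) j) := by
        rw [sq]
        exact dvd_add (mul_dvd_mul (hcol i hi).1 (hcol j hj).1)
          ((mul_dvd_mul (hcol i hi).2 (hcol j hj).2).mul_left _)
      have h3 := (dvd_add_right h2).1 this
      rwa [sq, mul_dvd_mul_iff_left natCast_prime_ne_zero] at h3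
    refine ⟨⟨fun i => ?_, fun i j hij => ?_⟩, fun j hj r => ?_, ⟨fun i => ?_, fun i j hij => ?_⟩⟩
    · have := hunm i i (by simp [i.2])
      rw [hTd, i.2, if_neg Bool.false_ne_true, hplane] at this
      exact this
    · have := hunm i j (by simp [i.2])
      rw [hTo _ _ (Subtype.coe_injective.ne hij), hplane, map_zero] at this
      exact this
    · fin_cases r
      · exact (hcol j hj).1
      · exact (hcol j hj).2
    · have := hmark i i i.2 i.2 (u i) (by rw [hTd, i.2, if_pos rfl])
      rw [hplane] at this
      exact this
    · have := hmark i j i.2 j.2 0 (by rw [hTo _ _ (Subtype.coe_injective.ne hij), mul_zero])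
      rw [hplane, map_zero] at this
      exact this
  · rintro ⟨⟨h1, h2⟩, h3, h4, h5⟩ i j
    rw [Matrix.sub_apply, bracket_quaternionForm, pairPrecision_mk]
    by_cases hi : b i <;> by_cases hj : b j
    · simp only [hi, hj, Bool.and_self, if_true]
      have hfirst : (p : ℤ_[p]) ^ 2 ∣
          X (.inl 0) i * X (.inl 0) j + ε * (X (.inl 1) i * X (.inl 1) j) := by
        rw [sq]
        exact dvd_add (mul_dvd_mul (h3 i hi 0) (h3 j hj 0))
          ((mul_dvd_mul (h3 i hi 1) (h3 j hj 1)).mul_left _)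
      by_cases hij : i = j
      · subst hij
        rw [hTd, hi, if_pos rfl, add_sub_assoc, ← mul_sub, dvd_add_right hfirst, sq,
          mul_dvd_mul_iff_left natCast_prime_ne_zero, hplane]
        have := h4 ⟨i, hi⟩
        exact this
      · rw [hTo _ _ hij, sub_zero, dvd_add_right hfirst, sq,
          mul_dvd_mul_iff_left natCast_prime_ne_zero, ← sub_zero (_ + _), hplane, map_zero]
        have := h5 ⟨i, hi⟩ ⟨j, hj⟩ (fun h => hij (congrArg Subtype.val h))
        exact this
    · have hij : i ≠ j := by rintro rfl; exact hj hi
      simp only [hj, Bool.and_false, Bool.false_eq_true, if_false, pow_one, hTo _ _ hij, sub_zero]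
      exact dvd_add (dvd_add ((h3 i hi 0).mul_right _) (((h3 i hi 1).mul_right _).mul_left _))
        (dvd_mul_right _ _)
    · have hij : i ≠ j := by rintro rfl; exact hi hj
      simp only [hi, Bool.false_and, Bool.false_eq_true, if_false, pow_one, hTo _ _ hij, sub_zero]
      exact dvd_add (dvd_add ((h3 j hj 0).mul_left _) (((h3 j hj 1).mul_left _).mul_left _))
        (dvd_mul_right _ _)
    · rw [Bool.not_eq_true] at hi hj
      simp only [hi, Bool.false_and, Bool.false_eq_true, if_false, pow_one]
      rw [add_sub_right_comm, dvd_add_left (dvd_mul_right _ _)]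
      by_cases hij : i = j
      · subst hij
        rw [hTd, hi, if_neg Bool.false_ne_true, hplane]
        have := h1 ⟨i, hi⟩
        exact this
      · rw [hTo _ _ hij, hplane, map_zero]
        have := h2 ⟨i, hi⟩ ⟨j, hj⟩ (fun h => hij (congrArg Subtype.val h))
        exact this

/-- X modulo p has four independent blocks: two run over orthogonal families, one is zero, and one
is arbitrary with p² choices for each unmarked column. -/
theorem haar_congrSet_modularDiag (b : κ → Bool) (u : κ → ℤ_[p]) :
    (haar p (Fin 2 ⊕ Fin 2) κ).real
        (congrSet (quaternionForm ε) (modularDiag b u) (pairPrecision b)) =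
      ((orthogonalFrames (PadicInt.toZMod ε)
          fun j : {j // b j = false} => PadicInt.toZMod (u j)).ncard *
        (p ^ 2) ^ Fintype.card {j // b j = false} *
        (orthogonalFrames (PadicInt.toZMod ε)
          fun j : {j // b j = true} => PadicInt.toZMod (u j)).ncard : ℕ) /
        (p : ℝ) ^ (4 * Fintype.card κ) := by
  classical
  let V := Fin 2 → ZMod p
  let A := {j // b j = false}
  let B := {j // b j = true}
  let π : Matrix (Fin 2 ⊕ Fin 2) κ ℤ_[p] →+ (A → V) × (B → V) × (A → V) × (B → V) :=
    { toFun := fun X => (fun j r => PadicInt.toZMod (X (.inl r) j),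
        fun j r => PadicInt.toZMod (X (.inl r) j), fun j r => PadicInt.toZMod (X (.inr r) j),
        fun j r => PadicInt.toZMod (X (.inr r) j))
      map_zero' := by ext <;> simp <;> rfl
      map_add' := fun X Y => by ext <;> simp }
  have hset : congrSet (quaternionForm ε) (modularDiag b u) (pairPrecision b) = π ⁻¹'
      ((orthogonalFrames (PadicInt.toZMod ε) fun j : A => PadicInt.toZMod (u j)) ×ˢ
        (({0} : Set (B → V)) ×ˢ ((Set.univ : Set (A → V)) ×ˢ
        (orthogonalFrames (PadicInt.toZMod ε) fun j : B => PadicInt.toZMod (u j))))) := by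
    ext X
    rw [mem_congrSet_modularDiag_iff hε]
    simp only [Set.mem_preimage, Set.mem_prod, Set.mem_univ, Set.mem_singleton_iff, true_and]
    refine and_congr Iff.rfl (and_congr ?_ Iff.rfl)
    simp [π, funext_iff, dvd_iff_toZMod, B]
    exact Iff.rfl
  have hsurj : Function.Surjective π := by
    rintro ⟨y1, y2, y3, y4⟩
    refine ⟨of fun r j => Sum.elim
      (fun r => if h : b j = true then ((y2 ⟨j, h⟩ r).val : ℤ_[p])
        else ((y1 ⟨j, by simpa using h⟩ r).val : ℤ_[p]))
      (fun r => if h : b j = true then ((y4 ⟨j, h⟩ r).val : ℤ_[p])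
        else ((y3 ⟨j, by simpa using h⟩ r).val : ℤ_[p])) r, ?_⟩
    ext j r <;> simp [π, j.2]
  have hopen : IsOpen (π ⁻¹' {0}) := by
    have : π ⁻¹' {0} = ⋂ r, ⋂ j, (fun X : Matrix (Fin 2 ⊕ Fin 2) κ ℤ_[p] => X r j) ⁻¹'
        {z | (p : ℤ_[p]) ^ 1 ∣ z} := by
      ext X
      simp only [Set.mem_preimage, Set.mem_singleton_iff, Set.mem_iInter, Set.mem_ofPred_eq, pow_one,
        dvd_iff_toZMod]
      constructor
      · intro h r j
        have h1 := congrArg (fun z => z.1) h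
        have h2 := congrArg (fun z => z.2.1) h
        have h3 := congrArg (fun z => z.2.2.1) h
        have h4 := congrArg (fun z => z.2.2.2) h
        rcases r with r | r <;> by_cases hj : b j = true
        · exact congrFun (congrFun h2 ⟨j, hj⟩) r
        · exact congrFun (congrFun h1 ⟨j, by simpa using hj⟩) r
        · exact congrFun (congrFun h4 ⟨j, hj⟩) r
        · exact congrFun (congrFun h3 ⟨j, by simpa using hj⟩) r
      · intro h
        ext <;> simp [π, h] <;> rfl
    rw [this]
    refine isOpen_iInter_of_finite fun r => isOpen_iInter_of_finite fun j => ?_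
    exact (isClopen_pow_dvd 1).isOpen.preimage (by fun_prop)
  rw [hset, measureReal_preimage_finite _ π hsurj hopen]
  have hcard : Fintype.card A + Fintype.card B = Fintype.card κ := by
    have := Fintype.card_subtype_compl (fun j => b j = true)
    have h2 : Fintype.card A = Fintype.card {j // ¬ b j = true} :=
      Fintype.card_congr (Equiv.subtypeEquivRight fun j => by simp)
    have h3 := Fintype.card_subtype_le (fun j => b j = true)
    change Fintype.card B ≤ _ at h3
    change _ = _ - Fintype.card B at this
    omega
  congr 1
  · simp only [Set.ncard_prod, Set.ncard_singleton, Set.ncard_univ, Nat.card_fun, Nat.card_zmod,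
      one_mul, V]
    simp only [Nat.card_eq_fintype_card, Fintype.card_fin]
    push_cast
    ring
  · simp only [Nat.card_prod, Nat.card_fun, Nat.card_zmod, V]
    simp only [Nat.card_eq_fintype_card, Fintype.card_fin, ← hcard]
    push_cast
    ring

/-- The density of a diagonal matrix with unit and `p`-modular entries. -/
theorem hasMassDensity_modularDiag (hp : p ≠ 2) (b : κ → Bool) {u : κ → ℤ_[p]}
    (hu : ∀ j, IsUnit (u j)) {cA cB : ℕ}
    (hA : (orthogonalFrames (PadicInt.toZMod ε)
      fun j : {j // b j = false} => PadicInt.toZMod (u j)).ncard = cA)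
    (hB : (orthogonalFrames (PadicInt.toZMod ε)
      fun j : {j // b j = true} => PadicInt.toZMod (u j)).ncard = cB) :
    HasMassDensity (quaternionForm ε) (modularDiag b u)
      ((p : ℝ) ^ Fintype.card (Sym2 κ) *
        (p : ℝ) ^ Nat.choose (Fintype.card {j // b j = true} + 1) 2 *
        (cA * (p ^ 2) ^ Fintype.card {j // b j = false} * cB) / (p : ℝ) ^ (4 * Fintype.card κ)) := by
  have hp0 : (p : ℝ) ≠ 0 := by exact_mod_cast (Fact.out : p.Prime).ne_zero
  choose w hw using fun j => (hu j).exists_right_inv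
  -- Here c = 1, so the density is already visible at level 2.
  have hR : diagonal (fun j => if b j then w j else (p : ℤ_[p]) * w j) * modularDiag b u =
      (p : ℤ_[p]) ^ 1 • 1 := by
    rw [modularDiag, diagonal_mul_diagonal, smul_one_eq_diagonal]
    congr 1
    ext1 j
    split_ifs
    · linear_combination (p : ℤ_[p]) * hw j
    · linear_combination (p : ℤ_[p]) * hw j
  have h1 := haar_congrSet_eq_prod_mul_mass (quaternionForm_isSymm ε) (modularDiag_isSymm b u)
    (pairPrecision b) 2 (fun s => by
      induction s with | _ i j
      rw [pairPrecision_mk]; split_ifs <;> simp)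
    (fun D hD hDk => mass_modularDiag_add hp b hu _ hD hDk)
  rw [haar_congrSet_modularDiag hε, hA, hB, Finset.prod_pow_eq_pow_sum] at h1
  have h2 := hasMassDensity_of_le hp (quaternionForm_isSymm ε) (modularDiag_isSymm b u) hR
    (e := 2) le_rfl
  convert h2 using 1
  have h3 := sum_pairPrecision b
  rw [← Fintype.card_subtype] at h3
  rw [div_eq_iff (pow_ne_zero _ hp0)] at h1 ⊢
  have h4 : (p : ℝ) ^ (2 * Fintype.card (Sym2 κ)) = (p : ℝ) ^ Fintype.card (Sym2 κ) *
      (p : ℝ) ^ Nat.choose (Fintype.card {j // b j = true} + 1) 2 *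
      (p : ℝ) ^ ∑ s, (2 - pairPrecision b s) := by
    rw [← pow_add, ← pow_add]; congr 1; omega
  push_cast at h1
  rw [h1, h4]
  ring

end UnitDiagonal

/-! ### The Hilbert symbol at an odd prime -/

section Hilbert

variable {p : ℕ} [Fact p.Prime]

theorem ringChar_zmod_ne_two (hp : p ≠ 2) : ringChar (ZMod p) ≠ 2 := by
  rwa [ZMod.ringChar_zmod_n]

/-- Hensel's lemma for squares of units. -/
theorem isSquare_iff_toZMod (hp : p ≠ 2) {w : ℤ_[p]} (hw : IsUnit w) :
    IsSquare w ↔ IsSquare (PadicInt.toZMod w) := by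
  constructor
  · intro h; exact h.map PadicInt.toZMod
  · rintro ⟨s, hs⟩
    obtain ⟨a, rfl⟩ := ZMod.ringHom_surjective (PadicInt.toZMod (p := p)) s
    have ha : IsUnit a := by
      rw [isUnit_iff_not_dvd, dvd_iff_toZMod]
      intro h0
      rw [h0, mul_zero, ← dvd_iff_toZMod] at hs
      exact (isUnit_iff_not_dvd w).1 hw hs
    obtain ⟨z, hz, -⟩ := hensels_lemma (p := p)
      (F := (Polynomial.X ^ 2 - Polynomial.C w : Polynomial ℤ_[p])) (a := a) (by
        have h1 : ‖Polynomial.aeval a (Polynomial.derivative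
            (Polynomial.X ^ 2 - Polynomial.C w : Polynomial ℤ_[p]))‖ = 1 := by
          rw [← PadicInt.isUnit_iff]
          simp only [Polynomial.derivative_sub, Polynomial.derivative_X_pow,
            Polynomial.derivative_C, sub_zero, map_mul, map_pow, Polynomial.aeval_X,
            Polynomial.aeval_C]
          simpa using (isUnit_two hp).mul ha
        rw [h1, one_pow]
        rw [PadicInt.norm_lt_one_iff_dvd, dvd_iff_toZMod]
        simp [hs, sq])
    refine ⟨z, ?_⟩
    simp only [map_sub, map_pow, Polynomial.aeval_X, Polynomial.aeval_C, Algebra.algebraMap_self,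
      RingHom.id_apply] at hz
    linear_combination -hz

theorem isSquare_coe_iff (w : ℤ_[p]) : IsSquare (w : ℚ_[p]) ↔ IsSquare w := by
  constructor
  · rintro ⟨s, hs⟩
    have h1 : ‖s‖ ≤ 1 := by
      have h2 : ‖s‖ * ‖s‖ ≤ 1 := by rw [← norm_mul, ← hs]; exact w.norm_le_one
      nlinarith [norm_nonneg s]
    exact ⟨⟨s, h1⟩, Subtype.ext hs⟩
  · rintro ⟨s, rfl⟩
    exact ⟨s, by simp⟩

/-- A non-zero vector over `ℚ_p` is a multiple of a primitive integral vector. -/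
theorem exists_primitive {ι : Type*} [Finite ι] {v : ι → ℚ_[p]} (hv : v ≠ 0) :
    ∃ (c : ℚ_[p]) (w : ι → ℤ_[p]), c ≠ 0 ∧ (∃ i, w i = 1) ∧ ∀ i, v i = c * w i := by
  obtain ⟨i0, hi0⟩ := Function.ne_iff.1 hv
  have : Nonempty ι := ⟨i0⟩
  obtain ⟨i, hi⟩ := Finite.exists_max fun i => ‖v i‖
  have hvi : v i ≠ 0 := by
    intro h
    have := hi i0
    rw [h, norm_zero] at this
    exact hi0 (norm_le_zero_iff.1 this)
  refine ⟨v i, fun j => ⟨v j / v i, ?_⟩, hvi, ⟨i, ?_⟩, fun j => ?_⟩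
  · rw [norm_div]
    exact div_le_one_of_le₀ (hi j) (norm_nonneg _)
  · refine Subtype.ext ?_
    change v i / v i = 1
    exact div_self hvi
  · change v j = v i * (v j / v i)
    field_simp

theorem hilbertSymbol_eq_one_iff (a b : ℚ_[p]) : hilbertSymbol a b = 1 ↔
    ∃ x y z : ℚ_[p], (x, y, z) ≠ (0, 0, 0) ∧ a * x ^ 2 + b * y ^ 2 = z ^ 2 := by
  unfold hilbertSymbol
  split_ifs with h
  · simpa using h
  · simpa using h

theorem hilbertSymbol_eq_or (a b : ℚ_[p]) : hilbertSymbol a b = 1 ∨ hilbertSymbol a b = -1 := by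
  unfold hilbertSymbol
  split_ifs <;> simp

theorem hilbertSymbol_congr {a b a' b' : ℚ_[p]}
    (h : hilbertSymbol a b = 1 ↔ hilbertSymbol a' b' = 1) :
    hilbertSymbol a b = hilbertSymbol a' b' := by
  rcases hilbertSymbol_eq_or a b with h1 | h1 <;> rcases hilbertSymbol_eq_or a' b' with h2 | h2 <;>
    simp [h1, h2] at h ⊢

theorem hilbertSymbol_comm (a b : ℚ_[p]) : hilbertSymbol a b = hilbertSymbol b a := by
  apply hilbertSymbol_congr
  rw [hilbertSymbol_eq_one_iff, hilbertSymbol_eq_one_iff]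
  constructor <;> rintro ⟨x, y, z, h0, h⟩ <;>
    exact ⟨y, x, z, by simp only [ne_eq, Prod.mk.injEq] at h0 ⊢; tauto, by rw [add_comm]; exact h⟩

theorem hilbertSymbol_sq_mul (c a b : ℚ_[p]) (hc : c ≠ 0) :
    hilbertSymbol (c ^ 2 * a) b = hilbertSymbol a b := by
  apply hilbertSymbol_congr
  rw [hilbertSymbol_eq_one_iff, hilbertSymbol_eq_one_iff]
  constructor
  · rintro ⟨x, y, z, h0, h⟩
    refine ⟨c * x, y, z, ?_, by rw [← h]; ring⟩
    simpa [hc] using h0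
  · rintro ⟨x, y, z, h0, h⟩
    refine ⟨x / c, y, z, ?_, by rw [← h]; field_simp⟩
    simpa [hc] using h0

theorem hilbertSymbol_integral {a b : ℤ_[p]} (h : hilbertSymbol (a : ℚ_[p]) b = 1) :
    ∃ x y z : ℤ_[p], a * x ^ 2 + b * y ^ 2 = z ^ 2 ∧
      ¬ ((p : ℤ_[p]) ∣ x ∧ (p : ℤ_[p]) ∣ y ∧ (p : ℤ_[p]) ∣ z) := by
  obtain ⟨x, y, z, h0, h⟩ := (hilbertSymbol_eq_one_iff _ _).1 h
  have hv : ![x, y, z] ≠ 0 := by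
    intro hv
    apply h0
    have h1 := congrFun hv 0
    have h2 := congrFun hv 1
    have h3 := congrFun hv 2
    simp at h1 h2 h3
    simp [h1, h2, h3]
  obtain ⟨c, w, hc, ⟨i, hi⟩, hw⟩ := exists_primitive hv
  have hx := hw 0
  have hy := hw 1
  have hz := hw 2
  simp at hx hy hz
  refine ⟨w 0, w 1, w 2, ?_, ?_⟩
  · have : (((a * w 0 ^ 2 + b * w 1 ^ 2 : ℤ_[p])) : ℚ_[p]) = ((w 2 ^ 2 : ℤ_[p]) : ℚ_[p]) := by
      push_cast
      refine mul_left_cancel₀ (pow_ne_zero 2 hc) ?_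
      rw [hx, hy, hz] at h
      linear_combination h
    exact Subtype.coe_injective this
  · rintro ⟨h1, h2, h3⟩
    have : (p : ℤ_[p]) ∣ w i := by fin_cases i <;> assumption
    rw [hi] at this
    exact (isUnit_iff_not_dvd (1 : ℤ_[p])).1 isUnit_one this

/-- The quadratic residue character on `p`-adic units. -/
def unitChar (p : ℕ) [Fact p.Prime] : ℤ_[p]ˣ →* ℤˣ :=
  Units.map ((quadraticChar (ZMod p)).toMonoidHom.comp (PadicInt.toZMod (p := p)).toMonoidHom)

theorem toZMod_unit_ne_zero (u : ℤ_[p]ˣ) : PadicInt.toZMod (u : ℤ_[p]) ≠ 0 := by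
  rw [ne_eq, ← dvd_iff_toZMod]
  exact (isUnit_iff_not_dvd _).1 u.isUnit

theorem unitChar_eq_one_iff (u : ℤ_[p]ˣ) :
    unitChar p u = 1 ↔ IsSquare (PadicInt.toZMod (u : ℤ_[p])) := by
  rw [← quadraticChar_one_iff_isSquare (toZMod_unit_ne_zero u), Units.ext_iff]
  rfl

theorem eq_unitChar_of_iff {n : ℤ} {x : ℤˣ} (hn : n = 1 ∨ n = -1) (h : n = 1 ↔ x = 1) :
    n = x := by
  rcases Int.units_eq_one_or x with rfl | rfl <;> rcases hn with rfl | rfl <;> simp at h ⊢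

/-- The equation ux² + vy² = 1 is solvable over 𝔽_p; for any lift of a solution the value is ≡ 1
modulo p, hence a square by Hensel. -/
theorem hilbertSymbol_unit_unit (hp : p ≠ 2) (u v : ℤ_[p]ˣ) :
    hilbertSymbol ((u : ℤ_[p]) : ℚ_[p]) ((v : ℤ_[p]) : ℚ_[p]) = 1 := by
  obtain ⟨a, b, hab⟩ := FiniteField.exists_root_sum_quadratic
    (f := Polynomial.C (PadicInt.toZMod (u : ℤ_[p])) * Polynomial.X ^ 2 +
      Polynomial.C 0 * Polynomial.X + Polynomial.C (-1))
    (g := Polynomial.C (PadicInt.toZMod (v : ℤ_[p])) * Polynomial.X ^ 2 +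
      Polynomial.C 0 * Polynomial.X + Polynomial.C 0)
    (Polynomial.degree_quadratic (toZMod_unit_ne_zero u))
    (Polynomial.degree_quadratic (toZMod_unit_ne_zero v))
    (FiniteField.odd_card_of_char_ne_two (ringChar_zmod_ne_two hp))
  obtain ⟨x, rfl⟩ := ZMod.ringHom_surjective (PadicInt.toZMod (p := p)) a
  obtain ⟨y, rfl⟩ := ZMod.ringHom_surjective (PadicInt.toZMod (p := p)) b
  simp at hab
  have h1 : PadicInt.toZMod (u * x ^ 2 + v * y ^ 2 : ℤ_[p]) = 1 := by
    simp only [map_add, map_mul, map_pow]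
    linear_combination hab
  have hunit : IsUnit (u * x ^ 2 + v * y ^ 2 : ℤ_[p]) := by
    rw [isUnit_iff_not_dvd, dvd_iff_toZMod, h1]; exact one_ne_zero
  obtain ⟨s, hs⟩ := (isSquare_iff_toZMod hp hunit).2 (by rw [h1]; exact IsSquare.one)
  rw [hilbertSymbol_eq_one_iff]
  refine ⟨x, y, s, ?_, ?_⟩
  · intro h
    simp only [Prod.mk.injEq] at h
    have hs0 : s = 0 := Subtype.coe_injective h.2.2
    rw [hs, hs0] at hunit
    simp at hunit
  · have := congrArg (fun z : ℤ_[p] => (z : ℚ_[p])) hs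
    push_cast at this
    rw [this]; ring

/-- A primitive solution reduces to vy² ≡ z². If p ∣ y then p ∣ z, and p² ∣ pux² gives p ∣ x,
contradicting primitivity; so v is a square modulo p. -/
theorem hilbertSymbol_prime_unit (hp : p ≠ 2) (u v : ℤ_[p]ˣ) :
    hilbertSymbol ((p : ℚ_[p]) * ((u : ℤ_[p]) : ℚ_[p])) ((v : ℤ_[p]) : ℚ_[p]) = unitChar p v := by
  refine eq_unitChar_of_iff (hilbertSymbol_eq_or _ _) ?_
  rw [unitChar_eq_one_iff]
  constructor
  · intro h
    have h' : hilbertSymbol ((p * u : ℤ_[p]) : ℚ_[p]) ((v : ℤ_[p]) : ℚ_[p]) = 1 := by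
      push_cast; exact h
    obtain ⟨x, y, z, hxyz, hprim⟩ := hilbertSymbol_integral h'
    have hmod : PadicInt.toZMod (v : ℤ_[p]) * PadicInt.toZMod y ^ 2 = PadicInt.toZMod z ^ 2 := by
      have := congrArg PadicInt.toZMod hxyz
      simpa using this
    by_cases hy : PadicInt.toZMod y = 0
    · exfalso
      have hz : PadicInt.toZMod z = 0 := by
        rw [hy] at hmod
        simpa using hmod.symm
      rw [← dvd_iff_toZMod] at hy hz
      apply hprim
      refine ⟨?_, hy, hz⟩
      have h2 : (p : ℤ_[p]) ^ 2 ∣ p * u * x ^ 2 := by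
        have : (p : ℤ_[p]) * u * x ^ 2 = z ^ 2 - v * y ^ 2 := by linear_combination hxyz
        rw [this]
        exact dvd_sub (pow_dvd_pow_of_dvd hz 2) ((pow_dvd_pow_of_dvd hy 2).mul_left _)
      rw [sq, mul_assoc, mul_dvd_mul_iff_left natCast_prime_ne_zero, u.isUnit.dvd_mul_left] at h2
      exact PadicInt.prime_p.dvd_of_dvd_pow h2
    · refine ⟨PadicInt.toZMod z / PadicInt.toZMod y, ?_⟩
      field_simp
      exact hmod
  · intro h
    obtain ⟨s, hs⟩ := (isSquare_iff_toZMod hp v.isUnit).2 h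
    rw [hilbertSymbol_eq_one_iff]
    refine ⟨0, 1, s, by simp, ?_⟩
    rw [hs]; push_cast; ring

theorem hilbertSymbol_prime_prime (hp : p ≠ 2) (u v : ℤ_[p]ˣ) :
    hilbertSymbol ((p : ℚ_[p]) * ((u : ℤ_[p]) : ℚ_[p])) ((p : ℚ_[p]) * ((v : ℤ_[p]) : ℚ_[p])) =
      unitChar p (-1 * u * v) := by
  refine eq_unitChar_of_iff (hilbertSymbol_eq_or _ _) ?_
  rw [unitChar_eq_one_iff]
  constructor
  · intro h
    have h' : hilbertSymbol ((p * u : ℤ_[p]) : ℚ_[p]) ((p * v : ℤ_[p]) : ℚ_[p]) = 1 := by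
      push_cast; exact h
    obtain ⟨x, y, z, hxyz, hprim⟩ := hilbertSymbol_integral h'
    have hz : (p : ℤ_[p]) ∣ z := by
      refine PadicInt.prime_p.dvd_of_dvd_pow (n := 2) ?_
      rw [← hxyz]
      exact ⟨u * x ^ 2 + v * y ^ 2, by ring⟩
    obtain ⟨z, rfl⟩ := hz
    have hxy : (u : ℤ_[p]) * x ^ 2 + v * y ^ 2 = p * z ^ 2 := by
      refine mul_left_cancel₀ natCast_prime_ne_zero ?_
      linear_combination hxyz
    have hmod : PadicInt.toZMod (u : ℤ_[p]) * PadicInt.toZMod x ^ 2 +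
        PadicInt.toZMod (v : ℤ_[p]) * PadicInt.toZMod y ^ 2 = 0 := by
      have := congrArg PadicInt.toZMod hxy
      simpa using this
    by_cases hy : PadicInt.toZMod y = 0
    · exfalso
      rw [hy] at hmod
      have hx : PadicInt.toZMod x = 0 := by
        simpa [toZMod_unit_ne_zero u] using hmod
      rw [← dvd_iff_toZMod] at hx hy
      exact hprim ⟨hx, hy, dvd_mul_right _ _⟩
    · refine ⟨PadicInt.toZMod (u : ℤ_[p]) * PadicInt.toZMod x / PadicInt.toZMod y, ?_⟩
      push_cast
      simp only [map_mul, map_neg, map_one]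
      field_simp
      linear_combination -(PadicInt.toZMod (u : ℤ_[p])) * hmod
  · intro h
    obtain ⟨s, hs⟩ := (isSquare_iff_toZMod hp (Units.isUnit _)).2 h
    push_cast at hs
    have hs' := congrArg (fun z : ℤ_[p] => (z : ℚ_[p])) hs
    push_cast at hs'
    have hu0 : ((u : ℤ_[p]) : ℚ_[p]) ≠ 0 :=
      fun h0 => u.ne_zero (Subtype.coe_injective h0)
    rw [hilbertSymbol_eq_one_iff]
    -- With s² = -uv one has us² + vu² = 0.
    refine ⟨s, (u : ℤ_[p]), 0, fun h0 => hu0 (Prod.mk.inj (Prod.mk.inj h0).2).1, ?_⟩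
    linear_combination -(p : ℚ_[p]) * u * hs'

theorem exists_zpow_mul_unit {a : ℚ_[p]} (ha : a ≠ 0) :
    ∃ (i : ℤ) (u : ℤ_[p]ˣ), a = (p : ℚ_[p]) ^ i * ((u : ℤ_[p]) : ℚ_[p]) := by
  have hp0 : (p : ℚ_[p]) ≠ 0 := by exact_mod_cast (Fact.out : p.Prime).ne_zero
  have hnorm : ‖a * (p : ℚ_[p]) ^ (-a.valuation)‖ = 1 := by
    rw [norm_mul, Padic.norm_eq_zpow_neg_valuation ha, Padic.norm_p_zpow, neg_neg,
      ← zpow_add₀ (by exact_mod_cast (Fact.out : p.Prime).ne_zero)]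
    simp
  refine ⟨a.valuation, PadicInt.mkUnits hnorm, ?_⟩
  rw [PadicInt.mkUnits_eq]
  rw [mul_comm a, ← mul_assoc, ← zpow_add₀ hp0]
  simp

theorem units_zpow_two_mul (x : ℤˣ) (k : ℤ) : x ^ (2 * k) = 1 := by
  rw [_root_.zpow_mul, zpow_ofNat, Int.units_sq, _root_.one_zpow]

theorem units_zpow_two_mul_add_one (x : ℤˣ) (k : ℤ) : x ^ (2 * k + 1) = x := by
  rw [_root_.zpow_add, units_zpow_two_mul, one_mul, zpow_one]

/-- The tame formula for the Hilbert symbol at an odd prime. -/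
theorem hilbertSymbol_formula (hp : p ≠ 2) (i j : ℤ) (u v : ℤ_[p]ˣ) :
    hilbertSymbol ((p : ℚ_[p]) ^ i * ((u : ℤ_[p]) : ℚ_[p])) ((p : ℚ_[p]) ^ j * ((v : ℤ_[p]) : ℚ_[p]))
      = ((unitChar p (-1) ^ (i * j) * unitChar p u ^ j * unitChar p v ^ i : ℤˣ) : ℤ) := by
  have hp0 : (p : ℚ_[p]) ≠ 0 := by exact_mod_cast (Fact.out : p.Prime).ne_zero
  have heven : ∀ (k : ℤ) (w : ℤ_[p]ˣ), (p : ℚ_[p]) ^ (2 * k) * ((w : ℤ_[p]) : ℚ_[p]) =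
      ((p : ℚ_[p]) ^ k) ^ 2 * ((w : ℤ_[p]) : ℚ_[p]) := by
    intro k w
    rw [mul_comm 2 k, _root_.zpow_mul, zpow_ofNat]
  have hodd : ∀ (k : ℤ) (w : ℤ_[p]ˣ), (p : ℚ_[p]) ^ (2 * k + 1) * ((w : ℤ_[p]) : ℚ_[p]) =
      ((p : ℚ_[p]) ^ k) ^ 2 * (p * ((w : ℤ_[p]) : ℚ_[p])) := by
    intro k w
    rw [zpow_add₀ hp0, mul_comm 2 k, _root_.zpow_mul, zpow_ofNat, zpow_one, mul_assoc]
  have hk : ∀ k : ℤ, (p : ℚ_[p]) ^ k ≠ 0 := fun k => zpow_ne_zero _ hp0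
  have hright : ∀ (k : ℤ) (a b : ℚ_[p]), hilbertSymbol a (((p : ℚ_[p]) ^ k) ^ 2 * b) =
      hilbertSymbol a b := by
    intro k a b
    rw [hilbertSymbol_comm, hilbertSymbol_sq_mul _ _ _ (hk k), hilbertSymbol_comm]
  -- Square factors drop out on both sides, so only the parities of the exponents count.
  rcases Int.even_or_odd' i with ⟨i, rfl | rfl⟩ <;> rcases Int.even_or_odd' j with ⟨j, rfl | rfl⟩
  · rw [heven, heven, hilbertSymbol_sq_mul _ _ _ (hk i), hright, hilbertSymbol_unit_unit hp,
      mul_assoc 2 i, units_zpow_two_mul, units_zpow_two_mul, units_zpow_two_mul]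
    simp
  · rw [heven, hodd, hilbertSymbol_sq_mul _ _ _ (hk i), hright, hilbertSymbol_comm,
      hilbertSymbol_prime_unit hp, mul_assoc 2 i, units_zpow_two_mul, units_zpow_two_mul,
      units_zpow_two_mul_add_one]
    simp
  · rw [hodd, heven, hilbertSymbol_sq_mul _ _ _ (hk i), hright,
      hilbertSymbol_prime_unit hp, mul_left_comm (2 * i + 1) 2, units_zpow_two_mul,
      units_zpow_two_mul, units_zpow_two_mul_add_one]
    simp
  · rw [hodd, hodd, hilbertSymbol_sq_mul _ _ _ (hk i), hright, hilbertSymbol_prime_prime hp,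
      units_zpow_two_mul_add_one, units_zpow_two_mul_add_one,
      show (2 * i + 1) * (2 * j + 1) = 2 * (2 * i * j + i + j) + 1 by ring,
      units_zpow_two_mul_add_one, map_mul, map_mul]

/-- Multiplicativity is visible in the tame formula, which is bilinear in exponents and unit
characters. -/
theorem hilbertSymbol_mul_left (hp : p ≠ 2) {a b c : ℚ_[p]} (ha : a ≠ 0) (hb : b ≠ 0)
    (hc : c ≠ 0) : hilbertSymbol (a * b) c = hilbertSymbol a c * hilbertSymbol b c := by
  have hp0 : (p : ℚ_[p]) ≠ 0 := by exact_mod_cast (Fact.out : p.Prime).ne_zero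
  obtain ⟨i, u, rfl⟩ := exists_zpow_mul_unit ha
  obtain ⟨j, v, rfl⟩ := exists_zpow_mul_unit hb
  obtain ⟨k, w, rfl⟩ := exists_zpow_mul_unit hc
  have h : (p : ℚ_[p]) ^ i * ((u : ℤ_[p]) : ℚ_[p]) * ((p : ℚ_[p]) ^ j * ((v : ℤ_[p]) : ℚ_[p])) =
      (p : ℚ_[p]) ^ (i + j) * (((u * v : ℤ_[p]ˣ) : ℤ_[p]) : ℚ_[p]) := by
    rw [zpow_add₀ hp0]; push_cast; ring
  rw [h, hilbertSymbol_formula hp, hilbertSymbol_formula hp, hilbertSymbol_formula hp,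
    ← Units.val_mul]
  congr 1
  rw [map_mul, add_mul, _root_.zpow_add, _root_.zpow_add, mul_zpow]
  simp only [mul_assoc, mul_comm, mul_left_comm]

theorem hilbertSymbol_mul_right (hp : p ≠ 2) {a b c : ℚ_[p]} (ha : a ≠ 0) (hb : b ≠ 0)
    (hc : c ≠ 0) : hilbertSymbol a (b * c) = hilbertSymbol a b * hilbertSymbol a c := by
  rw [hilbertSymbol_comm, hilbertSymbol_mul_left hp hb hc ha, hilbertSymbol_comm b,
    hilbertSymbol_comm c]

theorem hilbertSymbol_self (hp : p ≠ 2) {a : ℚ_[p]} (ha : a ≠ 0) :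
    hilbertSymbol a a = hilbertSymbol (-1) a := by
  have h1 : hilbertSymbol a (-a) = 1 := by
    rw [hilbertSymbol_eq_one_iff]
    exact ⟨1, 1, 0, by simp, by ring⟩
  have h2 : hilbertSymbol a (-a) = hilbertSymbol a (-1) * hilbertSymbol a a := by
    rw [← hilbertSymbol_mul_right hp ha (by simp) ha, neg_one_mul]
  rw [h1, hilbertSymbol_comm a (-1)] at h2
  rcases hilbertSymbol_eq_or (-1) a with h | h <;> rw [h] at h2 ⊢ <;> linarith

theorem hilbertSymbol_sq (a b : ℚ_[p]) : hilbertSymbol a b ^ 2 = 1 := by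
  rcases hilbertSymbol_eq_or a b with h | h <;> rw [h] <;> rfl

theorem hilbertSymbol_sq_mul_right (c a b : ℚ_[p]) (hc : c ≠ 0) :
    hilbertSymbol a (c ^ 2 * b) = hilbertSymbol a b := by
  rw [hilbertSymbol_comm, hilbertSymbol_sq_mul _ _ _ hc, hilbertSymbol_comm]

/-- The ternary form `⟨b₀, b₁, b₂⟩` is isotropic iff a Hilbert symbol is trivial. -/
theorem hilbertSymbol_eq_one_iff_ternary {a b c : ℚ_[p]} (hc : c ≠ 0) :
    hilbertSymbol (-(a * c)) (-(b * c)) = 1 ↔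
      ∃ x y z : ℚ_[p], (x, y, z) ≠ (0, 0, 0) ∧ a * x ^ 2 + b * y ^ 2 + c * z ^ 2 = 0 := by
  rw [hilbertSymbol_eq_one_iff]
  constructor
  · rintro ⟨x, y, z, h0, h⟩
    -- Multiplying the ternary equation by -c turns its last term into the square (cz)².
    refine ⟨x, y, z / c, ?_, ?_⟩
    · simpa [hc] using h0
    · field_simp
      linear_combination -h
  · rintro ⟨x, y, z, h0, h⟩
    refine ⟨x, y, c * z, ?_, ?_⟩
    · simpa [hc] using h0
    · linear_combination -c * h

/-- The product of Hilbert symbols in the ternary Clifford invariant. -/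
theorem hilbertSymbol_ternary (hp : p ≠ 2) {a b c : ℚ_[p]} (ha : a ≠ 0) (hb : b ≠ 0) (hc : c ≠ 0) :
    hilbertSymbol (-1 : ℚ_[p]) (-1) * hilbertSymbol (-1) (a * b * c) *
        (hilbertSymbol a b * hilbertSymbol a c * hilbertSymbol b c) =
      hilbertSymbol (-(a * c)) (-(b * c)) := by
  have h1 : (-1 : ℚ_[p]) ≠ 0 := by simp
  have e1 : -(a * c) = -1 * (a * c) := by ring
  have e2 : -(b * c) = -1 * (b * c) := by ring
  have hac := mul_ne_zero ha hc
  have hbc := mul_ne_zero hb hc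
  rw [e1, e2, hilbertSymbol_mul_left hp h1 hac (mul_ne_zero h1 hbc),
    hilbertSymbol_mul_left hp ha hc (mul_ne_zero h1 hbc)]
  simp only [hilbertSymbol_mul_right hp h1 h1 hbc, hilbertSymbol_mul_right hp ha h1 hbc,
    hilbertSymbol_mul_right hp hc h1 hbc, hilbertSymbol_mul_right hp h1 hb hc,
    hilbertSymbol_mul_right hp ha hb hc, hilbertSymbol_mul_right hp hc hb hc,
    hilbertSymbol_self hp hc, hilbertSymbol_mul_right hp h1 (mul_ne_zero ha hb) hc,
    hilbertSymbol_mul_right hp h1 ha hb, hilbertSymbol_comm a (-1), hilbertSymbol_comm c (-1),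
    hilbertSymbol_comm c b]
  -- After full expansion the two sides differ only by the factor ⟨-1, c⟩² = 1.
  have := hilbertSymbol_sq (-1) c
  linear_combination -(hilbertSymbol (-1 : ℚ_[p]) (-1) * hilbertSymbol (-1) a *
    hilbertSymbol (-1) b * hilbertSymbol (-1) c * hilbertSymbol a b * hilbertSymbol a c *
    hilbertSymbol b c) * this

/-- The symbols involving d multiply to ⟨abc, abc⟩ = ⟨-1, abc⟩, which reduces the quaternary
invariant to the ternary one. -/
theorem hilbertSymbol_quaternary (hp : p ≠ 2) {a b c s d : ℚ_[p]} (ha : a ≠ 0) (hb : b ≠ 0)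
    (hc : c ≠ 0) (hs : s ≠ 0) (hd : d = s ^ 2 * (a * b * c)) :
    hilbertSymbol a b * hilbertSymbol a c * hilbertSymbol a d * hilbertSymbol b c *
        hilbertSymbol b d * hilbertSymbol c d =
      hilbertSymbol (-1) (a * b * c) *
        (hilbertSymbol a b * hilbertSymbol a c * hilbertSymbol b c) := by
  have h1 : (-1 : ℚ_[p]) ≠ 0 := by simp
  have hab := mul_ne_zero ha hb
  simp only [hd, hilbertSymbol_sq_mul_right _ _ _ hs, hilbertSymbol_mul_right hp ha hab hc,
    hilbertSymbol_mul_right hp hb hab hc, hilbertSymbol_mul_right hp hc hab hc,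
    hilbertSymbol_mul_right hp h1 hab hc, hilbertSymbol_mul_right hp ha ha hb,
    hilbertSymbol_mul_right hp hb ha hb, hilbertSymbol_mul_right hp hc ha hb,
    hilbertSymbol_mul_right hp h1 ha hb, hilbertSymbol_self hp ha, hilbertSymbol_self hp hb,
    hilbertSymbol_self hp hc, hilbertSymbol_comm b a, hilbertSymbol_comm c a,
    hilbertSymbol_comm c b]
  have e1 := hilbertSymbol_sq a b
  have e2 := hilbertSymbol_sq a c
  have e3 := hilbertSymbol_sq b c
  generalize hilbertSymbol a b = x at *
  generalize hilbertSymbol a c = y at *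
  generalize hilbertSymbol b c = z at *
  generalize hilbertSymbol (-1) a * 1 = w at *
  linear_combination (hilbertSymbol (-1) a * hilbertSymbol (-1) b * hilbertSymbol (-1) c * x * y * z)
    * (y ^ 2 * z ^ 2 * e1 + z ^ 2 * e2 + e3)

/-- If the discriminant is a square, an isotropic quaternary form has isotropic ternary subforms. -/
theorem ternary_isotropic_of_quaternary {K : Type*} [Field K] {a b c d s x0 x1 x2 x3 : K}
    (ha : a ≠ 0) (hb : b ≠ 0) (hc : c ≠ 0) (hs : s ≠ 0) (hd : d = s ^ 2 * (a * b * c))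
    (hx : (x0, x1, x2, x3) ≠ (0, 0, 0, 0))
    (h : a * x0 ^ 2 + b * x1 ^ 2 + c * x2 ^ 2 + d * x3 ^ 2 = 0) :
    ∃ x y z : K, (x, y, z) ≠ (0, 0, 0) ∧ a * x ^ 2 + b * y ^ 2 + c * z ^ 2 = 0 := by
  have hd0 : d ≠ 0 := by
    rw [hd]; exact mul_ne_zero (pow_ne_zero _ hs) (mul_ne_zero (mul_ne_zero ha hb) hc)
  by_cases h3 : x3 = 0
  · refine ⟨x0, x1, x2, ?_, by rw [h3] at h; linear_combination h⟩
    simpa [h3] using hx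
  have hk : s * (a * b) ≠ 0 := mul_ne_zero hs (mul_ne_zero ha hb)
  -- With x₂ = sabt one has c x₂² = abd t², so the equation reads N(a x₀ + x₃θ) = -ab N(x₁ + tθ),
  -- where θ² = -ad and N is the norm.
  obtain ⟨t, rfl⟩ : ∃ t, x2 = s * (a * b) * t := ⟨x2 / (s * (a * b)), by field_simp⟩
  by_cases h0 : d * x3 ^ 2 + a * x0 ^ 2 = 0
  · refine ⟨0, d * x3, s * (a * b) * x0, ?_, ?_⟩
    · simp [hd0, h3]
    · rw [hd] at h0 ⊢
      linear_combination b * (s ^ 2 * a * b * c) * h0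
  -- Up to sign, the last two coordinates come from the components of (a x₀ + x₃θ)(x₁ - tθ);
  -- multiplicativity of the norm gives the identity.
  · refine ⟨d * x3 ^ 2 + a * x0 ^ 2, a * (x0 * x1 + d * x3 * t),
      s * (a * b) * (a * x0 * t - x1 * x3), ?_, ?_⟩
    · simp [h0]
    · subst hd
      linear_combination a * (s ^ 2 * (a * b * c) * x3 ^ 2 + a * x0 ^ 2) * h

end Hilbert

/-! ### The Clifford invariant detects anisotropy -/

section Anisotropy

/-- A quadratic form is anisotropic if it has no non-trivial zero. -/
def IsAnisotropic {R κ : Type*} [CommRing R] [Fintype κ] (T : Matrix κ κ R) : Prop :=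
  ∀ v : κ → R, v ⬝ᵥ T *ᵥ v = 0 → v = 0

theorem dotProduct_bracket {R ι κ : Type*} [CommRing R] [Fintype ι] [Fintype κ]
    (T : Matrix ι ι R) (X : Matrix ι κ R) (v : κ → R) :
    v ⬝ᵥ bracket T X *ᵥ v = (X *ᵥ v) ⬝ᵥ T *ᵥ (X *ᵥ v) := by
  rw [bracket, ← mulVec_mulVec, ← mulVec_mulVec, dotProduct_mulVec, vecMul_transpose]

theorem dotProduct_diagonal_mulVec {R κ : Type*} [CommRing R] [Fintype κ] [DecidableEq κ]
    (b v : κ → R) : v ⬝ᵥ diagonal b *ᵥ v = ∑ i, b i * v i ^ 2 := by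
  rw [dotProduct]
  exact Finset.sum_congr rfl fun i _ => by rw [mulVec_diagonal]; ring

theorem isAnisotropic_bracket_iff {K κ : Type*} [Field K] [Fintype κ] [DecidableEq κ]
    (T : Matrix κ κ K) {g : Matrix κ κ K} (hg : g.det ≠ 0) :
    IsAnisotropic (bracket T g) ↔ IsAnisotropic T := by
  have hu : IsUnit g.det := hg.isUnit
  constructor
  · intro h v hv
    have h1 := h (g⁻¹ *ᵥ v) (by
      rw [dotProduct_bracket, mulVec_mulVec, Matrix.mul_nonsing_inv g hu, one_mulVec, hv])
    have h2 := congrArg (fun w => g *ᵥ w) h1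
    simpa [mulVec_mulVec, Matrix.mul_nonsing_inv g hu] using h2
  · intro h v hv
    rw [dotProduct_bracket] at hv
    exact eq_zero_of_mulVec_eq_zero hg (h _ hv)

variable {p : ℕ} [Fact p.Prime]

theorem det_eq_of_isDiagonalization {n : ℕ} {T : Matrix (Fin n) (Fin n) ℚ_[p]}
    {b : Fin n → ℚ_[p]} (h : IsDiagonalization T b) :
    ∃ c : ℚ_[p], c ≠ 0 ∧ ∏ i, b i = c ^ 2 * T.det := by
  obtain ⟨hb, g, hg⟩ := h
  refine ⟨(g : Matrix (Fin n) (Fin n) ℚ_[p]).det, ?_, ?_⟩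
  · exact ((Matrix.isUnit_iff_isUnit_det _).1 g.isUnit).ne_zero
  · rw [← det_diagonal, ← hg, bracket, det_mul, det_mul, det_transpose]; ring

theorem isAnisotropic_iff_of_isDiagonalization {n : ℕ} {T : Matrix (Fin n) (Fin n) ℚ_[p]}
    {b : Fin n → ℚ_[p]} (h : IsDiagonalization T b) :
    IsAnisotropic T ↔ IsAnisotropic (diagonal b) := by
  obtain ⟨hb, g, hg⟩ := h
  rw [← hg, isAnisotropic_bracket_iff]
  exact ((Matrix.isUnit_iff_isUnit_det _).1 g.isUnit).ne_zero

theorem isAnisotropic_diagonal_three (b : Fin 3 → ℚ_[p]) (hb : b 2 ≠ 0) :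
    IsAnisotropic (diagonal b) ↔ hilbertSymbol (-(b 0 * b 2)) (-(b 1 * b 2)) = -1 := by
  have h1 : hilbertSymbol (-(b 0 * b 2)) (-(b 1 * b 2)) = -1 ↔
      ¬ hilbertSymbol (-(b 0 * b 2)) (-(b 1 * b 2)) = 1 := by
    rcases hilbertSymbol_eq_or (-(b 0 * b 2)) (-(b 1 * b 2)) with h | h <;> rw [h] <;> decide
  rw [h1, hilbertSymbol_eq_one_iff_ternary hb]
  constructor
  · rintro h ⟨x, y, z, h0, hxyz⟩
    have := h ![x, y, z] (by simpa [dotProduct_diagonal_mulVec, Fin.sum_univ_three] using hxyz)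
    apply h0
    have e0 := congrFun this 0
    have e1 := congrFun this 1
    have e2 := congrFun this 2
    simp at e0 e1 e2
    simp [e0, e1, e2]
  · intro h v hv
    by_contra hne
    refine h ⟨v 0, v 1, v 2, fun h0 => hne ?_, ?_⟩
    · simp only [Prod.mk.injEq] at h0
      ext i
      fin_cases i
      · exact h0.1
      · exact h0.2.1
      · exact h0.2.2
    · simpa [dotProduct_diagonal_mulVec, Fin.sum_univ_three] using hv

/-- Using the very diagonalization chosen in `epsInvariant` avoids proving independence of the
choice; det T agrees with b₀b₁b₂ up to a square. -/
theorem cliffordInvariant_three (hp : p ≠ 2) {T : Matrix (Fin 3) (Fin 3) ℚ_[p]} (hT : T.IsSymm)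
    (hd : T.det ≠ 0) : ∃ b, IsDiagonalization T b ∧
      cliffordInvariant T = hilbertSymbol (-(b 0 * b 2)) (-(b 1 * b 2)) := by
  have hex := exists_isDiagonalization T hT hd
  refine ⟨hex.choose, hex.choose_spec, ?_⟩
  have heps : epsInvariant T = ∏ i : Fin 3, ∏ j ∈ Finset.Ioi i,
      hilbertSymbol (hex.choose i) (hex.choose j) := by
    rw [epsInvariant, dif_pos hex]
  have hspec := hex.choose_spec
  generalize hex.choose = b at *
  obtain ⟨c, hc, hdet⟩ := det_eq_of_isDiagonalization hspec
  have hb := hspec.1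
  have h1 : hilbertSymbol (-1) T.det = hilbertSymbol (-1) (b 0 * b 1 * b 2) := by
    rw [← hilbertSymbol_sq_mul_right c _ _ hc, ← hdet, Fin.prod_univ_three]
  rw [cliffordInvariant, if_pos (by decide), heps, ← hilbertSymbol_ternary hp (hb 0) (hb 1) (hb 2)]
  have hI0 : Finset.Ioi (0 : Fin 3) = {1, 2} := by decide
  have hI1 : Finset.Ioi (1 : Fin 3) = {2} := by decide
  have hI2 : Finset.Ioi (2 : Fin 3) = ∅ := by decide
  rw [Fin.prod_univ_three, hI0, hI1, hI2, Finset.prod_pair (by decide), Finset.prod_singleton,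
    Finset.prod_empty]
  norm_num [h1]

theorem cliffordInvariant_four (hp : p ≠ 2) {T : Matrix (Fin 4) (Fin 4) ℚ_[p]} (hT : T.IsSymm)
    (hd : T.det ≠ 0) (hsq : IsSquare T.det) : ∃ b s, IsDiagonalization T b ∧ s ≠ 0 ∧
      b 3 = s ^ 2 * (b 0 * b 1 * b 2) ∧
      cliffordInvariant T = hilbertSymbol (-(b 0 * b 2)) (-(b 1 * b 2)) := by
  have hex := exists_isDiagonalization T hT hd
  have heps : epsInvariant T = ∏ i : Fin 4, ∏ j ∈ Finset.Ioi i,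
      hilbertSymbol (hex.choose i) (hex.choose j) := by
    rw [epsInvariant, dif_pos hex]
  have hspec := hex.choose_spec
  generalize hex.choose = b at *
  obtain ⟨c, hc, hdet⟩ := det_eq_of_isDiagonalization hspec
  obtain ⟨r, hr⟩ := hsq
  have hb := hspec.1
  have hb0 := hb 0
  have hb1 := hb 1
  have hb2 := hb 2
  have hr0 : r ≠ 0 := by rintro rfl; simp at hr; exact hd hr
  rw [Fin.prod_univ_four, hr] at hdet
  have hb3 : b 3 = (c * r / (b 0 * b 1 * b 2)) ^ 2 * (b 0 * b 1 * b 2) := by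
    field_simp
    linear_combination hdet
  have hs0 : c * r / (b 0 * b 1 * b 2) ≠ 0 :=
    div_ne_zero (mul_ne_zero hc hr0) (mul_ne_zero (mul_ne_zero hb0 hb1) hb2)
  refine ⟨b, _, hspec, hs0, hb3, ?_⟩
  have h1 : hilbertSymbol (-1) T.det = 1 := by
    rw [hilbertSymbol_eq_one_iff]
    exact ⟨0, 1, r, by simp, by rw [hr]; ring⟩
  rw [cliffordInvariant, if_neg (by decide), heps, ← hilbertSymbol_ternary hp hb0 hb1 hb2,
    mul_assoc (hilbertSymbol (-1) (-1)), ← hilbertSymbol_quaternary hp hb0 hb1 hb2 hs0 hb3]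
  have hI0 : Finset.Ioi (0 : Fin 4) = {1, 2, 3} := by decide
  have hI1 : Finset.Ioi (1 : Fin 4) = {2, 3} := by decide
  have hI2 : Finset.Ioi (2 : Fin 4) = {3} := by decide
  have hI3 : Finset.Ioi (3 : Fin 4) = ∅ := by decide
  rw [Fin.prod_univ_four, hI0, hI1, hI2, hI3, Finset.prod_insert (by decide),
    Finset.prod_pair (by decide), Finset.prod_pair (by decide), Finset.prod_singleton,
    Finset.prod_empty]
  have h3 : ((-1 : ℚ_[p]) ^ (4 / 2 + 1)) = -1 := by norm_num
  have h4 : 4 / 2 * (4 / 2 - 1) / 2 = 1 := by norm_num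
  rw [h3, h1, h4]
  ring

theorem cliffordInvariant_three_eq_neg_one_iff (hp : p ≠ 2) {T : Matrix (Fin 3) (Fin 3) ℚ_[p]}
    (hT : T.IsSymm) (hd : T.det ≠ 0) : cliffordInvariant T = -1 ↔ IsAnisotropic T := by
  obtain ⟨b, hb, hη⟩ := cliffordInvariant_three hp hT hd
  rw [hη, isAnisotropic_iff_of_isDiagonalization hb, isAnisotropic_diagonal_three b (hb.1 2)]

theorem cliffordInvariant_three_eq_or (hp : p ≠ 2) {T : Matrix (Fin 3) (Fin 3) ℚ_[p]}
    (hT : T.IsSymm) (hd : T.det ≠ 0) : cliffordInvariant T = 1 ∨ cliffordInvariant T = -1 := by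
  obtain ⟨b, -, hη⟩ := cliffordInvariant_three hp hT hd
  rw [hη]
  exact hilbertSymbol_eq_or _ _

/-- With square determinant both sides depend only on three of the diagonal entries: the symbols
reduce to the ternary ones, and the quaternary form is isotropic exactly when its ternary subform
is. -/
theorem cliffordInvariant_four_eq_neg_one_iff (hp : p ≠ 2) {T : Matrix (Fin 4) (Fin 4) ℚ_[p]}
    (hT : T.IsSymm) (hd : T.det ≠ 0) (hsq : IsSquare T.det) :
    cliffordInvariant T = -1 ↔ IsAnisotropic T := by
  obtain ⟨b, s, hb, hs, hb3, hη⟩ := cliffordInvariant_four hp hT hd hsq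
  have key : IsAnisotropic (diagonal ![b 0, b 1, b 2]) ↔
      hilbertSymbol (-(b 0 * b 2)) (-(b 1 * b 2)) = -1 := isAnisotropic_diagonal_three _ (hb.1 2)
  rw [hη, isAnisotropic_iff_of_isDiagonalization hb, ← key]
  constructor
  · intro h v hv
    by_contra hne
    rw [dotProduct_diagonal_mulVec, Fin.sum_univ_four] at hv
    obtain ⟨x, y, z, h0, hxyz⟩ := ternary_isotropic_of_quaternary (hb.1 0) (hb.1 1) (hb.1 2) hs hb3
      (fun h0 => hne (by
        simp only [Prod.mk.injEq] at h0
        ext i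
        fin_cases i
        · exact h0.1
        · exact h0.2.1
        · exact h0.2.2.1
        · exact h0.2.2.2)) hv
    have := h ![x, y, z] (by simpa [dotProduct_diagonal_mulVec, Fin.sum_univ_three] using hxyz)
    apply h0
    have e0 := congrFun this 0
    have e1 := congrFun this 1
    have e2 := congrFun this 2
    simp at e0 e1 e2
    simp [e0, e1, e2]
  · intro h v hv
    rw [dotProduct_diagonal_mulVec, Fin.sum_univ_three] at hv
    have := h ![v 0, v 1, v 2, 0] (by
      rw [dotProduct_diagonal_mulVec, Fin.sum_univ_four]
      simpa using hv)
    ext i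
    fin_cases i
    · exact congrFun this 0
    · exact congrFun this 1
    · exact congrFun this 2

theorem isAnisotropic_quaternionForm {ε : ℤ_[p]}
    (hε : ∀ x : Fin 2 → ZMod p, planeForm (PadicInt.toZMod ε) x x = 0 → x = 0) :
    IsAnisotropic (toPadic (quaternionForm ε)) := by
  intro v hv
  by_contra hne
  obtain ⟨c, w, hc, ⟨i, hi⟩, hw⟩ := exists_primitive hne
  have h1 : v ⬝ᵥ toPadic (quaternionForm ε) *ᵥ v =
      c ^ 2 * ((w ⬝ᵥ quaternionForm ε *ᵥ w : ℤ_[p]) : ℚ_[p]) := by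
    have hmap : toPadic (quaternionForm ε) =
        diagonal fun j => ((Sum.elim ![1, ε] ![(p : ℤ_[p]), p * ε] j : ℤ_[p]) : ℚ_[p]) := by
      rw [quaternionForm, toPadic, diagonal_map rfl]
    rw [hmap, dotProduct_diagonal_mulVec, quaternionForm, dotProduct_diagonal_mulVec]
    rw [PadicInt.coe_sum, Finset.mul_sum]
    exact Finset.sum_congr rfl fun j _ => by rw [hw j]; push_cast; ring
  rw [h1] at hv
  have h2 : w ⬝ᵥ quaternionForm ε *ᵥ w = 0 :=
    Subtype.coe_injective ((mul_eq_zero.1 hv).resolve_left (pow_ne_zero 2 hc))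
  have h3 := dvd_of_sq_dvd_quaternionForm hε w (by rw [h2]; exact dvd_zero _) i
  rw [hi] at h3
  exact (isUnit_iff_not_dvd (1 : ℤ_[p])).1 isUnit_one h3

/-- A non-degenerate matrix represented by an anisotropic form is anisotropic. -/
theorem IsAnisotropic.bracket {K ι κ : Type*} [Field K] [Fintype ι] [Fintype κ] [DecidableEq κ]
    {S : Matrix ι ι K} (hS : IsAnisotropic S) {X : Matrix ι κ K} (hd : (bracket S X).det ≠ 0) :
    IsAnisotropic (LocalDensity.bracket S X) := by
  intro v hv
  rw [dotProduct_bracket] at hv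
  refine eq_zero_of_mulVec_eq_zero hd ?_
  rw [LocalDensity.bracket, ← mulVec_mulVec, hS _ hv, mulVec_zero]

end Anisotropy

/-! ### Reduction to diagonal matrices and the final values -/

section Assembly

variable {p : ℕ} [Fact p.Prime]

theorem toPadic_modularDiag {κ : Type*} [DecidableEq κ] (b : κ → Bool) (u : κ → ℤ_[p]) :
    toPadic (modularDiag b u) =
      diagonal fun j => (if b j then (p : ℚ_[p]) else 1) * (u j : ℚ_[p]) := by
  rw [modularDiag, toPadic, diagonal_map rfl]
  congr 1
  ext1 j
  split_ifs <;> simp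

theorem exists_pow_mul_unit {a : ℤ_[p]} (ha : a ≠ 0) :
    ∃ (v : ℕ) (u : ℤ_[p]ˣ), a = (p : ℤ_[p]) ^ v * u :=
  ⟨_, _, (PadicInt.unitCoeff_spec ha).trans (mul_comm _ _)⟩

theorem pow_mul_unit_injective {a b : ℕ} {u v : ℤ_[p]} (hu : IsUnit u) (hv : IsUnit v)
    (h : (p : ℤ_[p]) ^ a * u = (p : ℤ_[p]) ^ b * v) : a = b := by
  have hnu : ¬ IsUnit (p : ℤ_[p]) := by
    rw [isUnit_iff_not_dvd]; simp
  have h1 : (p : ℤ_[p]) ^ a ∣ p ^ b := by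
    rw [← hv.dvd_mul_right, ← h]; exact dvd_mul_right _ _
  have h2 : (p : ℤ_[p]) ^ b ∣ p ^ a := by
    rw [← hu.dvd_mul_right, h]; exact dvd_mul_right _ _
  exact le_antisymm ((pow_dvd_pow_iff natCast_prime_ne_zero hnu).1 h1)
    ((pow_dvd_pow_iff natCast_prime_ne_zero hnu).1 h2)

/-- Up to integral isogeny, every non-degenerate symmetric matrix is diagonal with entries of
valuation at most one. -/
theorem exists_modularDiag {n : ℕ} {T : Matrix (Fin n) (Fin n) ℤ_[p]} (hT : T.IsSymm)
    (hd : T.det ≠ 0) : ∃ (g h : Matrix (Fin n) (Fin n) ℤ_[p]) (b : Fin n → Bool)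
      (u : Fin n → ℤ_[p]ˣ), g.det ≠ 0 ∧ h.det ≠ 0 ∧
        bracket T g = bracket (modularDiag b fun j => (u j : ℤ_[p])) h := by
  have hd' : (toPadic T).det ≠ 0 := by
    rw [det_toPadic]
    exact fun h0 => hd (Subtype.coe_injective h0)
  have hT' : (toPadic T).IsSymm := by rw [Matrix.IsSymm, toPadic, ← transpose_map, hT.eq]
  obtain ⟨d, hd0, G, hG⟩ := exists_isDiagonalization (toPadic T) hT' hd'
  -- A common denominator c makes the rational diagonalizing matrix integral, multiplying the
  -- diagonal by c².
  obtain ⟨c, hc⟩ := IsLocalization.exist_integer_multiples_of_finite (nonZeroDivisors ℤ_[p])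
    (fun ij : Fin n × Fin n => (G : Matrix (Fin n) (Fin n) ℚ_[p]) ij.1 ij.2)
  choose g' hg' using hc
  let g : Matrix (Fin n) (Fin n) ℤ_[p] := of fun i j => g' (i, j)
  have hg : toPadic g = (c : ℤ_[p]) • (G : Matrix (Fin n) (Fin n) ℚ_[p]) := by
    ext i j : 1
    exact hg' (i, j)
  have hbr : toPadic (bracket T g) = ((c : ℤ_[p]) ^ 2) • diagonal d := by
    rw [toPadic_bracket, hg, ← hG]
    simp [bracket, smul_smul, sq]
  have hc0 : (c : ℤ_[p]) ≠ 0 := nonZeroDivisors.ne_zero c.2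
  have hc0' : ((c : ℤ_[p]) : ℚ_[p]) ≠ 0 := fun h0 => hc0 (Subtype.coe_injective h0)
  have hentry : ∀ i j, ((bracket T g i j : ℤ_[p]) : ℚ_[p]) =
      ((c : ℤ_[p]) : ℚ_[p]) ^ 2 * diagonal d i j := by
    intro i j
    have := congrFun (congrFun hbr i) j
    rw [toPadic, map_apply, Matrix.smul_apply, Algebra.smul_def] at this
    rw [this]; simp
  have hdiag : bracket T g = diagonal fun i => bracket T g i i := by
    ext i j : 1
    by_cases hij : i = j
    · subst hij; simp
    · rw [diagonal_apply_ne _ hij]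
      refine Subtype.coe_injective ?_
      have := hentry i j
      rw [diagonal_apply_ne _ hij, mul_zero] at this
      exact this
  have hne : ∀ i, bracket T g i i ≠ 0 := by
    intro i h0
    have := hentry i i
    rw [h0, diagonal_apply_eq] at this
    exact mul_ne_zero (pow_ne_zero 2 hc0') (hd0 i) this.symm
  choose v u hvu using fun i => exists_pow_mul_unit (hne i)
  have hdetbr : (bracket T g).det ≠ 0 := by
    rw [hdiag, det_diagonal]
    exact Finset.prod_ne_zero_iff.2 fun i _ => hne i
  -- The even part of each valuation is moved into h; the mark records the parity that remains.
  refine ⟨g, diagonal fun i => (p : ℤ_[p]) ^ (v i / 2), fun i => decide (v i % 2 = 1), u, ?_, ?_, ?_⟩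
  · intro h0
    rw [bracket, det_mul, h0, mul_zero] at hdetbr
    exact hdetbr rfl
  · rw [det_diagonal]
    exact Finset.prod_ne_zero_iff.2 fun i _ => pow_ne_zero _ natCast_prime_ne_zero
  · rw [hdiag, funext hvu]
    rw [bracket, modularDiag, diagonal_transpose, diagonal_mul_diagonal, diagonal_mul_diagonal]
    congr 1
    ext1 i
    have hv := Nat.div_add_mod (v i) 2
    by_cases hpar : v i % 2 = 1
    · simp only [hpar, decide_true, if_true]
      conv_lhs => rw [← hv, hpar, pow_add, pow_mul]
      ring
    · have h0 : v i % 2 = 0 := by omega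
      simp only [h0, zero_ne_one, decide_false, Bool.false_eq_true, if_false]
      conv_lhs => rw [← hv, h0, add_zero, pow_mul]
      ring

theorem IsAnisotropic.diagonal_comp {K κ τ : Type*} [Field K] [Fintype κ] [DecidableEq κ]
    [Fintype τ] [DecidableEq τ] {t : κ → K} (h : IsAnisotropic (diagonal t)) {f : τ → κ}
    (hf : Function.Injective f) : IsAnisotropic (diagonal (t ∘ f)) := by
  intro v hv
  rw [dotProduct_diagonal_mulVec] at hv
  have h1 := h (Function.extend f v 0) (by
    rw [dotProduct_diagonal_mulVec, ← hv]
    symm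
    refine Fintype.sum_of_injective f hf _ _ (fun i hi => ?_) fun i => ?_
    · rw [Function.extend_apply' _ _ _ (by simpa using hi)]; simp
    · rw [hf.extend_apply]; rfl)
  ext i
  have := congrFun h1 (f i)
  rwa [hf.extend_apply] at this

/-- If -u_i u_j were a square modulo p, it would be s² over ℤ_p, and (s, u_i) would be isotropic for
u_i ⊥ u_j; a common mark only scales this form. -/
theorem not_isSquare_of_isAnisotropic (hp : p ≠ 2) {κ : Type*} [Fintype κ] [DecidableEq κ]
    {b : κ → Bool} {u : κ → ℤ_[p]ˣ}
    (h : IsAnisotropic (toPadic (modularDiag b fun j => (u j : ℤ_[p])))) {i j : κ} (hij : i ≠ j)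
    (hb : b i = b j) :
    ¬ IsSquare (-(PadicInt.toZMod (u i : ℤ_[p]) * PadicInt.toZMod (u j : ℤ_[p]))) := by
  intro hsq
  rw [← map_mul, ← map_neg, ← isSquare_iff_toZMod hp ((u i).isUnit.mul (u j).isUnit).neg] at hsq
  obtain ⟨s, hs⟩ := hsq
  have hs' : -(((u i : ℤ_[p]) : ℚ_[p]) * ((u j : ℤ_[p]) : ℚ_[p])) = (s : ℚ_[p]) * s := by
    have := congrArg (fun z : ℤ_[p] => (z : ℚ_[p])) hs
    push_cast at this
    exact this
  obtain ⟨c, hc⟩ : ∃ c : Bool → ℚ_[p], toPadic (modularDiag b fun j => (u j : ℤ_[p])) =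
      diagonal fun j => c (b j) * ((u j : ℤ_[p]) : ℚ_[p]) :=
    ⟨fun β => if β then (p : ℚ_[p]) else 1, toPadic_modularDiag _ _⟩
  rw [hc] at h
  have hinj : Function.Injective ![i, j] := by
    intro a c hac
    fin_cases a <;> fin_cases c <;> simp [hij, hij.symm] at hac ⊢
  have h1 := h.diagonal_comp hinj ![(s : ℚ_[p]), ((u i : ℤ_[p]) : ℚ_[p])] (by
    rw [dotProduct_diagonal_mulVec, Fin.sum_univ_two]
    simp only [Function.comp, cons_val_zero, cons_val_one, hb]
    linear_combination -c (b j) * ((u i : ℤ_[p]) : ℚ_[p]) * hs')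
  have h2 := congrFun h1 1
  exact (u i).ne_zero (Subtype.coe_injective h2)

/-- Three entries with the same mark form a multiple of a unit ternary form, which is isotropic
because symbols of units are trivial. -/
theorem card_class_le_two (hp : p ≠ 2) {κ : Type*} [Fintype κ] [DecidableEq κ]
    {b : κ → Bool} {u : κ → ℤ_[p]ˣ}
    (h : IsAnisotropic (toPadic (modularDiag b fun j => (u j : ℤ_[p])))) (β : Bool) :
    Fintype.card {j // b j = β} ≤ 2 := by
  by_contra hlt
  rw [not_le, Fintype.two_lt_card_iff] at hlt
  obtain ⟨i, j, k, hij, hik, hjk⟩ := hlt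
  rw [toPadic_modularDiag] at h
  have hinj : Function.Injective ![(i : κ), j, k] := by
    have h1 := Subtype.coe_injective.ne hij
    have h2 := Subtype.coe_injective.ne hik
    have h3 := Subtype.coe_injective.ne hjk
    intro a c hac
    fin_cases a <;> fin_cases c <;> simp [h1, h2, h3, h1.symm, h2.symm, h3.symm] at hac ⊢
  have h1 := h.diagonal_comp hinj
  have hp0 : (p : ℚ_[p]) ≠ 0 := by exact_mod_cast (Fact.out : p.Prime).ne_zero
  have hc0 : (if β = true then (p : ℚ_[p]) else 1) ≠ 0 := by split_ifs <;> simp [hp0]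
  have hu0 : ∀ l, ((u l : ℤ_[p]) : ℚ_[p]) ≠ 0 :=
    fun l h0 => (u l).ne_zero (Subtype.coe_injective h0)
  rw [isAnisotropic_diagonal_three _ (by
    simp only [Function.comp, k.2, cons_val]
    exact mul_ne_zero hc0 (hu0 _))] at h1
  simp only [Function.comp, cons_val_zero, cons_val_one, cons_val, i.2, j.2, k.2] at h1
  have e : ∀ l m : κ, -((if β = true then (p : ℚ_[p]) else 1) * ((u l : ℤ_[p]) : ℚ_[p]) *
      ((if β = true then (p : ℚ_[p]) else 1) * ((u m : ℤ_[p]) : ℚ_[p]))) =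
      (if β = true then (p : ℚ_[p]) else 1) ^ 2 * (((-(u l * u m) : ℤ_[p]ˣ) : ℤ_[p]) : ℚ_[p]) := by
    intro l m
    push_cast
    ring
  rw [e, e, hilbertSymbol_sq_mul _ _ _ hc0, hilbertSymbol_sq_mul_right _ _ _ hc0,
    hilbertSymbol_unit_unit hp] at h1
  exact absurd h1 (by decide)

theorem card_false_add_card_true {κ : Type*} [Fintype κ] (b : κ → Bool) :
    Fintype.card {j // b j = false} + Fintype.card {j // b j = true} = Fintype.card κ := by
  rw [Fintype.card_subtype, Fintype.card_subtype, ← Finset.card_univ,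
    ← Finset.card_filter_add_card_filter_not (s := Finset.univ) (fun j => b j = false)]
  simp

theorem isAnisotropic_toPadic_iff {n : ℕ} {T M g h : Matrix (Fin n) (Fin n) ℤ_[p]}
    (hg : g.det ≠ 0) (hh : h.det ≠ 0) (hgh : bracket T g = bracket M h) :
    IsAnisotropic (toPadic M) ↔ IsAnisotropic (toPadic T) := by
  have hcoe : ∀ a : Matrix (Fin n) (Fin n) ℤ_[p], a.det ≠ 0 → (toPadic a).det ≠ 0 := by
    intro a ha
    rw [det_toPadic]
    exact fun h0 => ha (Subtype.coe_injective h0)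
  rw [← isAnisotropic_bracket_iff (toPadic T) (hcoe g hg),
    ← isAnisotropic_bracket_iff (toPadic M) (hcoe h hh), ← toPadic_bracket, ← toPadic_bracket, hgh]

variable {ε : ℤ_[p]}

/-- The character value excludes a square -ε, hence by Hensel a square modulo p, whereas a zero with
x₁ ≠ 0 would give -ε ≡ (x₀/x₁)². -/
theorem planeForm_anisotropic (hp : p ≠ 2) (hε : IsUnit ε) (hχ : quadChar (-ε) = -1)
    (x : Fin 2 → ZMod p) (hx : planeForm (PadicInt.toZMod ε) x x = 0) : x = 0 := by
  have hns : ¬ IsSquare (((-ε : ℤ_[p])) : ℚ_[p]) := by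
    intro h
    rw [quadChar, if_pos h] at hχ
    exact absurd hχ (by decide)
  rw [isSquare_coe_iff, isSquare_iff_toZMod hp hε.neg, map_neg] at hns
  simp only [planeForm] at hx
  have h1 : x 1 = 0 := by
    by_contra h1
    refine hns ⟨x 0 / x 1, ?_⟩
    field_simp
    linear_combination -hx
  have h0 : x 0 = 0 := by
    rw [h1] at hx
    simpa using hx
  ext i
  fin_cases i
  · exact h0
  · exact h1

variable (hε : ∀ x : Fin 2 → ZMod p, planeForm (PadicInt.toZMod ε) x x = 0 → x = 0)

include hε

theorem ncard_frames_of_card_one (hp : p ≠ 2) {α : Type*} [Fintype α] {u : α → ℤ_[p]ˣ}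
    (hα : Fintype.card α = 1) : (orthogonalFrames (PadicInt.toZMod ε)
      fun j => PadicInt.toZMod (u j : ℤ_[p])).ncard = p + 1 := by
  let σ := (Fintype.equivFinOfCardEq hα).symm
  have h := ncard_orthogonalFrames_one hε (ringChar_zmod_ne_two hp)
    (u := (fun j => PadicInt.toZMod (u j : ℤ_[p])) ∘ σ) fun i => toZMod_unit_ne_zero _
  rw [← ncard_orthogonalFrames_congr _ _ σ, h, Nat.card_zmod]

theorem ncard_frames_of_card_two (hp : p ≠ 2) {α : Type*} [Fintype α] {u : α → ℤ_[p]ˣ}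
    (hα : Fintype.card α = 2)
    (hns : ∀ i j, i ≠ j →
      ¬ IsSquare (-(PadicInt.toZMod (u i : ℤ_[p]) * PadicInt.toZMod (u j : ℤ_[p])))) :
    (orthogonalFrames (PadicInt.toZMod ε) fun j => PadicInt.toZMod (u j : ℤ_[p])).ncard =
      2 * (p + 1) := by
  let σ := (Fintype.equivFinOfCardEq hα).symm
  have h := ncard_orthogonalFrames_two hε (ringChar_zmod_ne_two hp)
    (u := (fun j => PadicInt.toZMod (u j : ℤ_[p])) ∘ σ) (fun i => toZMod_unit_ne_zero _)
    (hns _ _ (σ.injective.ne (by decide)))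
  rw [← ncard_orthogonalFrames_congr _ _ σ, h, Nat.card_zmod]

theorem hasMassDensity_modularDiag_three (hp : p ≠ 2) {b : Fin 3 → Bool} {u : Fin 3 → ℤ_[p]ˣ}
    (h : IsAnisotropic (toPadic (modularDiag b fun j => (u j : ℤ_[p])))) :
    HasMassDensity (quaternionForm ε) (modularDiag b fun j => (u j : ℤ_[p]))
      (2 * (1 + (p : ℝ)) * (1 + (p : ℝ)⁻¹)) := by
  have hp0 : (p : ℝ) ≠ 0 := by exact_mod_cast (Fact.out : p.Prime).ne_zero
  have hF := card_class_le_two hp h false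
  have hB := card_class_le_two hp h true
  have hsum := card_false_add_card_true b
  have hns : ∀ β, ∀ i j : {j // b j = β}, i ≠ j →
      ¬ IsSquare (-(PadicInt.toZMod (u i : ℤ_[p]) * PadicInt.toZMod (u j : ℤ_[p]))) :=
    fun β i j hij => not_isSquare_of_isAnisotropic hp h (Subtype.coe_injective.ne hij)
      (i.2.trans j.2.symm)
  have hN : Fintype.card (Sym2 (Fin 3)) = 6 := by rw [Sym2.card]; rfl
  rw [Fintype.card_fin] at hsum
  -- Both shapes give the same density 2(p+1)²/p.
  have hcases : (Fintype.card {j // b j = false} = 2 ∧ Fintype.card {j // b j = true} = 1) ∨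
      (Fintype.card {j // b j = false} = 1 ∧ Fintype.card {j // b j = true} = 2) := by omega
  rcases hcases with ⟨h1, h2⟩ | ⟨h1, h2⟩
  · convert hasMassDensity_modularDiag hε hp b (fun j => (u j).isUnit)
      (ncard_frames_of_card_two hε hp (u := fun j : {j // b j = false} => u j) h1 (hns false))
      (ncard_frames_of_card_one hε hp (u := fun j : {j // b j = true} => u j) h2) using 1
    rw [h1, h2, hN, Fintype.card_fin]
    norm_num [Nat.choose]
    field_simp
    ring
  · convert hasMassDensity_modularDiag hε hp b (fun j => (u j).isUnit)
      (ncard_frames_of_card_one hε hp (u := fun j : {j // b j = false} => u j) h1)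
      (ncard_frames_of_card_two hε hp (u := fun j : {j // b j = true} => u j) h2 (hns true))
      using 1
    rw [h1, h2, hN, Fintype.card_fin]
    norm_num [Nat.choose]
    field_simp
    ring

theorem hasMassDensity_modularDiag_four (hp : p ≠ 2) {b : Fin 4 → Bool} {u : Fin 4 → ℤ_[p]ˣ}
    (h : IsAnisotropic (toPadic (modularDiag b fun j => (u j : ℤ_[p])))) :
    HasMassDensity (quaternionForm ε) (modularDiag b fun j => (u j : ℤ_[p]))
        (4 * (1 + (p : ℝ)) ^ 2 * p) ∧
      ∃ w : ℤ_[p], IsUnit w ∧ (modularDiag b fun j => (u j : ℤ_[p])).det = (p : ℤ_[p]) ^ 2 * w := by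
  have hp0 : (p : ℝ) ≠ 0 := by exact_mod_cast (Fact.out : p.Prime).ne_zero
  have hF := card_class_le_two hp h false
  have hB := card_class_le_two hp h true
  have hsum := card_false_add_card_true b
  have hns : ∀ β, ∀ i j : {j // b j = β}, i ≠ j →
      ¬ IsSquare (-(PadicInt.toZMod (u i : ℤ_[p]) * PadicInt.toZMod (u j : ℤ_[p]))) :=
    fun β i j hij => not_isSquare_of_isAnisotropic hp h (Subtype.coe_injective.ne hij)
      (i.2.trans j.2.symm)
  have hN : Fintype.card (Sym2 (Fin 4)) = 10 := by rw [Sym2.card]; rfl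
  rw [Fintype.card_fin] at hsum
  have h1 : Fintype.card {j // b j = false} = 2 := by omega
  have h2 : Fintype.card {j // b j = true} = 2 := by omega
  constructor
  · convert hasMassDensity_modularDiag hε hp b (fun j => (u j).isUnit)
      (ncard_frames_of_card_two hε hp (u := fun j : {j // b j = false} => u j) h1 (hns false))
      (ncard_frames_of_card_two hε hp (u := fun j : {j // b j = true} => u j) h2 (hns true))
      using 1
    rw [h1, h2, hN, Fintype.card_fin]
    norm_num [Nat.choose]
    field_simp
    ring
  · refine ⟨∏ j, (u j : ℤ_[p]), ?_, ?_⟩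
    · rw [← Units.coe_prod]; exact Units.isUnit _
    · have h3 : ∀ j, (if b j = true then (p : ℤ_[p]) * u j else (u j : ℤ_[p])) =
          (if b j = true then (p : ℤ_[p]) else 1) * u j := by
        intro j; split_ifs <;> simp
      rw [modularDiag, det_diagonal, Finset.prod_congr rfl fun j _ => h3 j,
        Finset.prod_mul_distrib, Finset.prod_ite, Finset.prod_const, Finset.prod_const_one, mul_one,
        ← Fintype.card_subtype, h2]

/-- For n = 3 the scaling factor is p^4 / p^4 = 1, so the density equals that of the diagonal model.
-/
theorem hasMassDensity_three (hp : p ≠ 2) {T : Matrix (Fin 3) (Fin 3) ℤ_[p]} (hT : T.IsSymm)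
    (hd : T.det ≠ 0) (h : IsAnisotropic (toPadic T)) :
    HasMassDensity (quaternionForm ε) T (2 * (1 + (p : ℝ)) * (1 + (p : ℝ)⁻¹)) := by
  obtain ⟨g, k, b, u, hg, hk, hgk⟩ := exists_modularDiag hT hd
  have hS := quaternionForm_isSymm ε
  have hS2 := dvd_of_sq_dvd_quaternionForm hε
  have hM := hasMassDensity_modularDiag_three hε hp ((isAnisotropic_toPadic_iff hg hk hgk).2 h)
  obtain ⟨α, hα⟩ := exists_hasMassDensity hp hS hT hd
  obtain ⟨vg, ug, hvg⟩ := exists_pow_mul_unit hg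
  obtain ⟨vk, uk, hvk⟩ := exists_pow_mul_unit hk
  have hMd : (modularDiag b fun j => (u j : ℤ_[p])).det ≠ 0 := by
    intro h0
    have := congrArg Matrix.det hgk
    rw [bracket, bracket, det_mul, det_mul, det_mul, det_mul, h0, det_transpose] at this
    simp [hg, hd] at this
  have h1 := hα.change_of_variables hp hS hS2 hT hd ug.isUnit hvg
  have h2 := hM.change_of_variables hp hS hS2 (modularDiag_isSymm _ _) hMd uk.isUnit hvk
  rw [hgk] at h1
  have h3 := h1.unique h2
  have hp0 : (p : ℝ) ^ 4 ≠ 0 := pow_ne_zero _ (by exact_mod_cast (Fact.out : p.Prime).ne_zero)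
  simp only [Fintype.card_fin, Fintype.card_sum] at h3
  norm_num [div_self hp0] at h3
  rwa [h3] at hα

/-- For n = 4 the scaling factor is p per unit of valuation. The diagonal model has determinant of
valuation 2, so comparing determinants shows that T gains p^(m-1) over the model. -/
theorem hasMassDensity_four (hp : p ≠ 2) {T : Matrix (Fin 4) (Fin 4) ℤ_[p]} (hT : T.IsSymm)
    {m : ℕ} {w : ℤ_[p]} (hw : IsUnit w) (hd : T.det = (p : ℤ_[p]) ^ (2 * m) * w)
    (h : IsAnisotropic (toPadic T)) :
    HasMassDensity (quaternionForm ε) T (4 * (1 + (p : ℝ)) ^ 2 * (p : ℝ) ^ m) := by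
  have hd0 : T.det ≠ 0 := by
    rw [hd]; exact mul_ne_zero (pow_ne_zero _ natCast_prime_ne_zero) hw.ne_zero
  obtain ⟨g, k, b, u, hg, hk, hgk⟩ := exists_modularDiag hT hd0
  have hS := quaternionForm_isSymm ε
  have hS2 := dvd_of_sq_dvd_quaternionForm hε
  obtain ⟨hM, w', hw', hdM⟩ :=
    hasMassDensity_modularDiag_four hε hp ((isAnisotropic_toPadic_iff hg hk hgk).2 h)
  obtain ⟨α, hα⟩ := exists_hasMassDensity hp hS hT hd0
  obtain ⟨vg, ug, hvg⟩ := exists_pow_mul_unit hg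
  obtain ⟨vk, uk, hvk⟩ := exists_pow_mul_unit hk
  have hMd : (modularDiag b fun j => (u j : ℤ_[p])).det ≠ 0 := by
    rw [hdM]; exact mul_ne_zero (pow_ne_zero _ natCast_prime_ne_zero) hw'.ne_zero
  have h1 := hα.change_of_variables hp hS hS2 hT hd0 ug.isUnit hvg
  have h2 := hM.change_of_variables hp hS hS2 (modularDiag_isSymm _ _) hMd uk.isUnit hvk
  rw [hgk] at h1
  have h3 := h1.unique h2
  have hdet := congrArg Matrix.det hgk
  rw [bracket, bracket, det_mul, det_mul, det_mul, det_mul, det_transpose, det_transpose, hvg, hvk,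
    hd, hdM] at hdet
  have hexp : 2 * m + 2 * vg = 2 + 2 * vk := by
    refine pow_mul_unit_injective (u := w * (ug : ℤ_[p]) ^ 2)
      (v := w' * (uk : ℤ_[p]) ^ 2)
      (hw.mul (ug.isUnit.pow 2)) (hw'.mul (uk.isUnit.pow 2)) ?_
    linear_combination hdet
  have hp0 : (p : ℝ) ≠ 0 := by exact_mod_cast (Fact.out : p.Prime).ne_zero
  have hr : (p : ℝ) ^ (4 + 1) / (p : ℝ) ^ (2 + 2) = p := by
    rw [div_eq_iff (pow_ne_zero _ hp0)]; ring
  simp only [Fintype.card_fin, Fintype.card_sum, hr] at h3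
  have hα' : α = 4 * (1 + (p : ℝ)) ^ 2 * (p : ℝ) ^ m := by
    refine mul_left_cancel₀ (pow_ne_zero vg hp0) ?_
    rw [h3]
    have : (p : ℝ) ^ vg * (p : ℝ) ^ m = (p : ℝ) ^ vk * p := by
      rw [← pow_add, ← pow_succ]; congr 1; omega
    linear_combination -(4 * (1 + (p : ℝ)) ^ 2) * this
  rwa [hα'] at hα

theorem isAnisotropic_of_hasMassDensity {κ : Type*} [Fintype κ] [DecidableEq κ]
    {T : Matrix κ κ ℤ_[p]} (hd : T.det ≠ 0) {α : ℝ} (hα : HasMassDensity (quaternionForm ε) T α)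
    (h0 : α ≠ 0) : IsAnisotropic (toPadic T) := by
  obtain ⟨X, rfl⟩ := exists_bracket_eq_of_hasMassDensity hα h0
  rw [toPadic_bracket]
  refine (isAnisotropic_quaternionForm hε).bracket ?_
  rw [← toPadic_bracket, det_toPadic]
  exact fun h => hd (Subtype.coe_injective h)

omit hε

theorem det_bracket_quaternionForm (X : Matrix (Fin 2 ⊕ Fin 2) (Fin 4) ℤ_[p]) :
    ∃ d : ℤ_[p], (bracket (quaternionForm ε) X).det = (p : ℤ_[p]) ^ 2 * ε ^ 2 * d ^ 2 := by
  let σ : Fin 4 ≃ Fin 2 ⊕ Fin 2 :=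
    (finSumFinEquiv (m := 2) (n := 2)).symm
  have h1 : bracket (quaternionForm ε) X =
      bracket ((quaternionForm ε).submatrix σ σ) (X.submatrix σ id) := by
    rw [bracket, bracket, transpose_submatrix, submatrix_mul_equiv, submatrix_mul_equiv,
      submatrix_id_id]
  refine ⟨(X.submatrix σ id).det, ?_⟩
  rw [h1, bracket, det_mul, det_mul, det_transpose, det_submatrix_equiv_self, quaternionForm,
    det_diagonal]
  simp [Fintype.prod_sum_type, Fin.prod_univ_two]
  ring

theorem hasLocalDensity_three (hp : p ≠ 2) (hε : IsUnit ε) (hχ : quadChar (-ε) = -1)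
    (T : Matrix (Fin 3) (Fin 3) ℚ_[p]) (hT : IsHalfIntegral T) (hd : T.det ≠ 0) :
    HasLocalDensity (U0perp ε) T (localDensity (U0perp ε) T) ∧
      localDensity (U0perp ε) T =
        (1 + (p : ℝ)) * (1 + (p : ℝ)⁻¹) * (1 - (cliffordInvariant T : ℝ)) := by
  have hplane := planeForm_anisotropic hp hε hχ
  have hS := quaternionForm_isSymm ε
  rw [← toPadic_quaternionForm]
  have hTs := hT.1
  obtain ⟨T, hT0, rfl⟩ := (isHalfIntegral_iff hp T).1 hT
  have hd0 : T.det ≠ 0 := by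
    intro h0
    rw [det_toPadic, h0] at hd
    exact hd rfl
  obtain ⟨α, hα⟩ := exists_hasMassDensity hp hS hT0 hd0
  have hdens := hα.hasLocalDensity hp hS hT0
  rw [hdens.localDensity_eq]
  refine ⟨hdens, ?_⟩
  rw [if_neg (by simp), one_mul]
  have hiff := cliffordInvariant_three_eq_neg_one_iff hp hTs hd
  rcases cliffordInvariant_three_eq_or hp hTs hd with h | h
  · rw [h]
    -- A non-zero density would make T anisotropic and the invariant -1.
    have : α = 0 := by
      by_contra hne
      have := hiff.2 (isAnisotropic_of_hasMassDensity hplane hd0 hα hne)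
      rw [h] at this
      exact absurd this (by decide)
    rw [this]; simp
  · rw [hα.unique (hasMassDensity_three hplane hp hT0 hd0 (hiff.1 h)), h]
    push_cast
    ring

theorem hasLocalDensity_four (hp : p ≠ 2) (hε : IsUnit ε) (hχ : quadChar (-ε) = -1)
    (T : Matrix (Fin 4) (Fin 4) ℚ_[p]) (hT : IsHalfIntegral T) (hd : T.det ≠ 0) :
    HasLocalDensity (U0perp ε) T (localDensity (U0perp ε) T) ∧
      (localDensity (U0perp ε) T ≠ 0 →
        (∃ (m : ℕ) (ξ : ℤ_[p]ˣ), 0 < m ∧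
          ((2 : ℚ_[p]) • T).det = (p : ℚ_[p]) ^ (2 * m) * ((ξ : ℤ_[p]) : ℚ_[p]) ^ 2) ∧
        cliffordInvariant T = -1) ∧
      (∀ (m : ℕ) (ξ : ℤ_[p]ˣ), 0 < m →
        ((2 : ℚ_[p]) • T).det = (p : ℚ_[p]) ^ (2 * m) * ((ξ : ℤ_[p]) : ℚ_[p]) ^ 2 →
        cliffordInvariant T = -1 →
        localDensity (U0perp ε) T = 2 * (1 + (p : ℝ)) ^ 2 * (p : ℝ) ^ m) := by
  have hplane := planeForm_anisotropic hp hε hχ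
  have hS := quaternionForm_isSymm ε
  rw [← toPadic_quaternionForm]
  have hTs := hT.1
  obtain ⟨T, hT0, rfl⟩ := (isHalfIntegral_iff hp T).1 hT
  have hd0 : T.det ≠ 0 := by
    intro h0
    rw [det_toPadic, h0] at hd
    exact hd rfl
  have hdet2 : ((2 : ℚ_[p]) • toPadic T).det = 2 ^ 4 * (T.det : ℚ_[p]) := by
    rw [Matrix.det_smul, det_toPadic, Fintype.card_fin]
  obtain ⟨α, hα⟩ := exists_hasMassDensity hp hS hT0 hd0
  have hdens := hα.hasLocalDensity hp hS hT0
  rw [hdens.localDensity_eq]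
  refine ⟨hdens, fun hne => ?_, fun m ξ hm hdet hη => ?_⟩
  · have hα0 : α ≠ 0 := fun h0 => hne (by rw [h0, mul_zero])
    have haniso := isAnisotropic_of_hasMassDensity hplane hd0 hα hα0
    obtain ⟨X, hX⟩ := exists_bracket_eq_of_hasMassDensity hα hα0
    obtain ⟨d, hd'⟩ := det_bracket_quaternionForm (ε := ε) X
    rw [hX] at hd'
    have hdne : d ≠ 0 := by
      rintro rfl
      rw [hd'] at hd0
      simp at hd0
    obtain ⟨v, w, rfl⟩ := exists_pow_mul_unit hdne
    -- From det(2T) = 2⁴p²ε²(p^v w)²: the factor p² of det S makes the exponent positive, and ξ =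
    -- 4εw.
    refine ⟨⟨1 + v, (isUnit_two hp).unit ^ 2 * hε.unit * w, by omega, ?_⟩, ?_⟩
    · rw [hdet2, hd']
      push_cast
      simp only [IsUnit.unit_spec]
      have h2 : ((2 : ℤ_[p]) : ℚ_[p]) = 2 := rfl
      rw [h2]
      ring
    · rw [cliffordInvariant_four_eq_neg_one_iff hp hTs hd]
      · exact haniso
      · rw [det_toPadic, hd']
        have hsq : IsSquare ((p : ℤ_[p]) ^ 2 * ε ^ 2 * (p ^ v * w) ^ 2) :=
          ⟨p * ε * (p ^ v * w), by ring⟩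
        exact hsq.map PadicInt.Coe.ringHom
  · rw [hdet2] at hdet
    obtain ⟨t, ht⟩ := (isUnit_two hp).exists_right_inv
    have ht' : (2 : ℚ_[p]) * t = 1 := congrArg (fun z : ℤ_[p] => (z : ℚ_[p])) ht
    have htu : IsUnit t := IsUnit.of_mul_eq_one_right _ ht
    have hdetT : (T.det : ℚ_[p]) = (p : ℚ_[p]) ^ (2 * m) *
        (((ξ : ℤ_[p]) : ℚ_[p]) * t ^ 2) ^ 2 := by
      have h16 : (2 : ℚ_[p]) ^ 4 * t ^ 4 = 1 := by rw [← mul_pow, ht', one_pow]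
      linear_combination (t : ℚ_[p]) ^ 4 * hdet - T.det * h16
    have hdetT0 : T.det = (p : ℤ_[p]) ^ (2 * m) * ((ξ : ℤ_[p]) * t ^ 2) ^ 2 := by
      refine Subtype.coe_injective ?_
      change (T.det : ℚ_[p]) = (((p : ℤ_[p]) ^ (2 * m) * ((ξ : ℤ_[p]) * t ^ 2) ^ 2 : ℤ_[p]) : ℚ_[p])
      rw [hdetT]; push_cast; rfl
    have haniso := (cliffordInvariant_four_eq_neg_one_iff hp hTs hd (by
      rw [det_toPadic, hdetT]
      exact ⟨(p : ℚ_[p]) ^ m * (((ξ : ℤ_[p]) : ℚ_[p]) * t ^ 2), by ring⟩)).1 hη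
    have hmass := hasMassDensity_four hplane hp hT0 ((ξ.isUnit.mul (htu.pow 2)).pow 2) hdetT0
      haniso
    -- Equal degrees bring in the factor 1/2 from the Kronecker delta, turning 4 into 2.
    rw [hα.unique hmass, if_pos (by simp)]
    ring

end Assembly

end LocalDensity
end

theorem proposition3p17 (p : ℕ) [Fact p.Prime] (hp : p ≠ 2)
    (ε : ℤ_[p]) (hε : IsUnit ε) (hχ : LocalDensity.quadChar (-ε) = -1) :
    (∀ T : Matrix (Fin 3) (Fin 3) ℚ_[p], LocalDensity.IsHalfIntegral T → T.det ≠ 0 →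
      LocalDensity.HasLocalDensity (LocalDensity.U0perp ε) T
        (LocalDensity.localDensity (LocalDensity.U0perp ε) T) ∧
      LocalDensity.localDensity (LocalDensity.U0perp ε) T =
        (1 + (p : ℝ)) * (1 + (p : ℝ)⁻¹) * (1 - (LocalDensity.cliffordInvariant T : ℝ))) ∧
    (∀ T : Matrix (Fin 4) (Fin 4) ℚ_[p], LocalDensity.IsHalfIntegral T → T.det ≠ 0 →
      LocalDensity.HasLocalDensity (LocalDensity.U0perp ε) T
        (LocalDensity.localDensity (LocalDensity.U0perp ε) T) ∧
      (LocalDensity.localDensity (LocalDensity.U0perp ε) T ≠ 0 →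
        (∃ (m : ℕ) (ξ : ℤ_[p]ˣ), 0 < m ∧
          ((2 : ℚ_[p]) • T).det = (p : ℚ_[p]) ^ (2 * m) * ((ξ : ℤ_[p]) : ℚ_[p]) ^ 2) ∧
        LocalDensity.cliffordInvariant T = -1) ∧
      (∀ (m : ℕ) (ξ : ℤ_[p]ˣ), 0 < m →
        ((2 : ℚ_[p]) • T).det = (p : ℚ_[p]) ^ (2 * m) * ((ξ : ℤ_[p]) : ℚ_[p]) ^ 2 →
        LocalDensity.cliffordInvariant T = -1 →
        LocalDensity.localDensity (LocalDensity.U0perp ε) T =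
          2 * (1 + (p : ℝ)) ^ 2 * (p : ℝ) ^ m)) := by
  exact ⟨LocalDensity.hasLocalDensity_three hp hε hχ, LocalDensity.hasLocalDensity_four hp hε hχ⟩
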